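/- **Setting.** Let $\Theta\subset\mathbb R^d$ be compact and let $f_\theta:\mathbb N_0^{\mathbb N}\to\mathbb R$ be measurable functions, defined for $\theta\in\mathbb R^d$. A model is a subset $m\subseteq\{1,\dots,d\}$, with $|m|$ elements and parameter set $\Theta(m)=\{\theta\in\Theta:\theta_i=0\text{ for } i\notin m\}$. Let $\mathcal M$ be a family of models, $m^*\in\mathcal M$ the true model and $\theta^*\in\Theta(m^*)$ the true parameter, such that $m^*\subseteq m$ for every $m\in\mathcal M$ with $\theta^*\in\Theta(m)$. Let $Y=(Y_t)_{t\in\mathbb Z}$ be a strictly stationary ergodic $\mathbb N_0$-valued process with $\mathbb E\,Y_t^{1+\epsilon}<C$ for all $t$, for some $C$ and some $\epsilon>1$. Let $\mathcal F_{t-1}=\sigma(Y_{t-1},Y_{t-2},\dots)$ and $\lambda_t(\theta)=f_\theta(Y_{t-1},Y_{t-2},\dots)$. Assume that $Y_t\mid\mathcal F_{t-1}\sim p(\cdot;\lambda_t(\theta^*))$ for some (unknown) family $p$ of distributions on $\mathbb N_0$, and $\lambda_t(\theta^*)=\mathbb E(Y_t\mid\mathcal F_{t-1})$. Put $\widehat\lambda_t(\theta)=f_\theta(Y_{t-1},\dots,Y_1,0,0,\dots)$,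 $\ell_t(\theta)=Y_t\log\lambda_t(\theta)-\lambda_t(\theta)$, and $$\widehat L_n(\theta)=\sum_{t=1}^n\big(Y_t\log\widehat\lambda_t(\theta)-\widehat\lambda_t(\theta)\big),\qquad \widehat\theta(m)\in\operatorname*{argmax}_{\theta\in\Theta(m)}\widehat L_n(\theta),$$ $$\widehat m_n\in\operatorname*{argmin}_{m\in\mathcal M}\big(-2\widehat L_n(\widehat\theta(m))+\kappa_n|m|\big),$$ where $\widehat\theta(m)$ (the Poisson QMLE in the model $m$, computed from $Y_1,\dots,Y_n$) and $\widehat m_n$ are measurable selections, and $(\kappa_n)_{n\ge1}$ is an increasing sequence with $\kappa_n<n$ and $\kappa_n\to\infty$. **Assumptions.** - *Smoothness and Lipschitz conditions.* For every $y$, the function $\theta\mapsto f_\theta(y)$ is twice continuously differentiable in a neighbourhood of each point of $\Theta$, and for $i=0,1,2$ there are $\alpha^{(i)}_k\ge0$ with $\sum_{k\ge1}\alpha^{(0)}_k<1$ and $\sum_{k\ge1}\alpha_k^{(i)}<\infty$ for $i=1,2$, such that $\sup_{\theta\in\Theta}\big\|\partial_\theta^if_\theta(y)-\partial_\theta^if_\theta(y')\big\|\le\sum_{k\ge1}\alpha_k^{(i)}|y_k-y_k'|$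 for all $y,y'\in\mathbb N_0^{\mathbb N}$ (the right-hand side may be $+\infty$). - *Identifiability and lower bound.* If $\theta,\theta'\in\Theta$ and $\lambda_t(\theta)=\lambda_t(\theta')$ a.s. for some $t$, then $\theta=\theta'$. There is $\underline c>0$ with $f_\theta(y)\ge\underline c$ for all $\theta\in\Theta$ and all $y$. - *Position of $\theta^*$.* $\theta^*$ is an interior point of $\Theta(m^*)$ relative to the coordinate subspace $\{\theta\in\mathbb R^d:\theta_i=0\text{ for } i\notin m^*\}$. There is $r>0$ such that for every $m\in\mathcal M$ with $m\supseteq m^*$ and every $\theta\in\Theta(m)$ with $\|\theta-\theta^*\|<r$, the segment $[\theta^*,\theta]$ lies in $\Theta$. - *Initial values.* With $a_t=\sup_{\theta\in\Theta}|\widehat\lambda_t(\theta)-\lambda_t(\theta)|$, a.s. $a_t\to0$ and $Y_ta_t\to0$ as $t\to\infty$. With $$b_t=\sup_{\theta\in\Theta}\mathbb E\Big\|\frac{\partial\widehat\lambda_t(\theta)}{\partial\theta}-\frac{\partial\lambda_t(\theta)}{\partial\theta}\Big\|,\qquad d_t=\sup_{\theta\in\Theta}\max\Big\{\mathbb E\Big\|\frac1{\widehat\lambda_t(\theta)}\frac{\partial\widehat\lambda_t(\theta)}{\partial\theta}\Big\|,\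 \mathbb E\Big\|\frac1{\lambda_t(\theta)}\frac{\partial\lambda_t(\theta)}{\partial\theta}\Big\|\Big\},$$ there is $h>1/2$ such that a.s. $b_t$, $b_tY_t$ and $a_td_tY_t$ are $O(t^{-h})$ as $t\to\infty$. - *Matrices.* The $d\times d$ matrices $$J=\mathbb E\Big[\frac1{\lambda_1(\theta^*)}\frac{\partial\lambda_1(\theta^*)}{\partial\theta}\frac{\partial\lambda_1(\theta^*)}{\partial\theta'}\Big],\qquad I=\mathbb E\Big[\frac{\operatorname{Var}(Y_1\mid\mathcal F_0)}{\lambda_1^2(\theta^*)}\frac{\partial\lambda_1(\theta^*)}{\partial\theta}\frac{\partial\lambda_1(\theta^*)}{\partial\theta'}\Big]$$ are finite (all entries are integrable). If $c\in\mathbb R^d$ and $c'\,\partial\lambda_1(\theta^*)/\partial\theta=0$ a.s., then $c=0$. - *Second derivatives.* There is a neighbourhood $V$ of $\theta^*$ in $\Theta$ with $\mathbb E\big[\sup_{\theta\in V}|\partial^2\ell_1(\theta)/\partial\theta_i\partial\theta_j|\big]<\infty$ for all $i,j$. - *Regularization.* $\sum_{\ell\ge1}\frac1{\kappa_\ell}\sum_{k\ge\ell}\alpha^{(i)}_k<\infty$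 for $i=0,1,2$, and $\kappa_n=o(n)$. **Theorem.** Let $J_{m^*}$ and $I_{m^*}$ be the submatrices of $J$ and $I$ with rows and columns in $m^*$. Then $J_{m^*}$ is invertible, and as $n\to\infty$ $$\sqrt n\,\big(\widehat\theta(\widehat m_n)-\theta^*\big)\ \longrightarrow\ \mathcal N_d(0,\Sigma)\quad\text{in distribution},$$ where $\Sigma$ is the positive semidefinite $d\times d$ matrix whose $m^*\times m^*$ block is $J_{m^*}^{-1}I_{m^*}J_{m^*}^{-1}$ and whose other entries are zero. -/

import Mathlib

open MeasureTheory ProbabilityTheory Filter Topology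
open scoped ENNReal NNReal Gradient Asymptotics

namespace CountSeries

noncomputable section

/-- The parameter space `ℝ^d` with its Euclidean norm. -/
abbrev Param (d : ℕ) : Type := EuclideanSpace ℝ (Fin d)

/-- `Θ(m)`: the parameters in `Θ` whose coordinates outside the model `m` vanish. -/
def modelSet {d : ℕ} (Θ : Set (Param d)) (m : Finset (Fin d)) : Set (Param d) :=
  {θ | θ ∈ Θ ∧ ∀ i, i ∉ m → θ i = 0}

section Objects

variable {Ω : Type*} {d : ℕ}

/-- The whole past `(Y_{t-1}, Y_{t-2}, …)`; entry `k` of the sequence is the value at lag `k + 1`. -/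
def past (Y : ℤ → Ω → ℕ) (t : ℤ) (ω : Ω) : ℕ → ℕ := fun k => Y (t - 1 - k) ω

/-- The observed past `(Y_{t-1}, …, Y_1, 0, 0, …)`. -/
def obsPast (Y : ℤ → Ω → ℕ) (t : ℤ) (ω : Ω) : ℕ → ℕ :=
  fun k => if 1 ≤ t - 1 - (k : ℤ) then Y (t - 1 - k) ω else 0

/-- `F_{t-1}`, the σ-algebra generated by `Y_{t-1}, Y_{t-2}, …`. -/
abbrev pastSigma (Y : ℤ → Ω → ℕ) (t : ℤ) : MeasurableSpace Ω :=
  ⨆ s : {s : ℤ // s < t}, MeasurableSpace.comap (Y s) inferInstance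

variable (f : Param d → (ℕ → ℕ) → ℝ) (Y : ℤ → Ω → ℕ)

/-- `λ_t(θ) = f_θ(Y_{t-1}, Y_{t-2}, …)`. -/
def lam (t : ℤ) (θ : Param d) (ω : Ω) : ℝ := f θ (past Y t ω)

/-- `λ̂_t(θ) = f_θ(Y_{t-1}, …, Y_1, 0, 0, …)`. -/
def lamHat (t : ℤ) (θ : Param d) (ω : Ω) : ℝ := f θ (obsPast Y t ω)

/-- `∂λ_t(θ)/∂θ`. -/
def gradLam (t : ℤ) (θ : Param d) (ω : Ω) : Param d := ∇ (fun ϑ => lam f Y t ϑ ω) θ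

/-- `∂λ̂_t(θ)/∂θ`. -/
def gradLamHat (t : ℤ) (θ : Param d) (ω : Ω) : Param d := ∇ (fun ϑ => lamHat f Y t ϑ ω) θ

/-- `ℓ_t(θ) = Y_t log λ_t(θ) - λ_t(θ)`. -/
def ell (t : ℤ) (θ : Param d) (ω : Ω) : ℝ :=
  (Y t ω : ℝ) * Real.log (lam f Y t θ ω) - lam f Y t θ ω

/-- The second partial derivative `∂²ℓ_t(θ)/∂θ_i∂θ_j`. -/
def hessEll (t : ℤ) (i j : Fin d) (θ : Param d) (ω : Ω) : ℝ :=
  fderiv ℝ (fun ϑ => fderiv ℝ (fun η => ell f Y t η ω) ϑ (EuclideanSpace.single j 1)) θ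
    (EuclideanSpace.single i 1)

/-- The approximated Poisson quasi-log-likelihood
`L̂_n(θ) = ∑_{t=1}^n (Y_t log λ̂_t(θ) - λ̂_t(θ))`. -/
def quasiLogLik (n : ℕ) (θ : Param d) (ω : Ω) : ℝ :=
  ∑ t ∈ Finset.Icc 1 n,
    ((Y (t : ℤ) ω : ℝ) * Real.log (lamHat f Y t θ ω) - lamHat f Y t θ ω)

/-- The penalized criterion `Ĉ_n(m) = -2 L̂_n(θ̂(m)) + κ_n |m|`, where `θhat n m` is the
estimator `θ̂(m)` computed from `n` observations. -/
def criterion (κ : ℕ → ℝ) (θhat : ℕ → Finset (Fin d) → Ω → Param d)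
    (n : ℕ) (m : Finset (Fin d)) (ω : Ω) : ℝ :=
  -2 * quasiLogLik f Y n (θhat n m ω) ω + κ n * (m.card : ℝ)

/-- `a_t = sup_{θ ∈ Θ} |λ̂_t(θ) - λ_t(θ)|`. -/
def aCoef (Θ : Set (Param d)) (t : ℤ) (ω : Ω) : ℝ≥0∞ :=
  ⨆ θ ∈ Θ, ‖lamHat f Y t θ ω - lam f Y t θ ω‖ₑ

variable [MeasurableSpace Ω] (P : Measure Ω)

/-- `b_t = sup_{θ ∈ Θ} E ‖∂λ̂_t(θ)/∂θ - ∂λ_t(θ)/∂θ‖`. -/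
def bCoef (Θ : Set (Param d)) (t : ℤ) : ℝ≥0∞ :=
  ⨆ θ ∈ Θ, ∫⁻ ω, ‖gradLamHat f Y t θ ω - gradLam f Y t θ ω‖ₑ ∂P

/-- `d_t = sup_{θ ∈ Θ} max (E ‖λ̂_t(θ)⁻¹ ∂λ̂_t(θ)/∂θ‖, E ‖λ_t(θ)⁻¹ ∂λ_t(θ)/∂θ‖)`. -/
def dCoef (Θ : Set (Param d)) (t : ℤ) : ℝ≥0∞ :=
  ⨆ θ ∈ Θ, max (∫⁻ ω, ‖(lamHat f Y t θ ω)⁻¹ • gradLamHat f Y t θ ω‖ₑ ∂P)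
    (∫⁻ ω, ‖(lam f Y t θ ω)⁻¹ • gradLam f Y t θ ω‖ₑ ∂P)

/-- The `(i, j)` entry of `λ_1(θ)⁻¹ (∂λ_1(θ)/∂θ) (∂λ_1(θ)/∂θ')`. -/
def entryJ (θ : Param d) (i j : Fin d) (ω : Ω) : ℝ :=
  (1 / lam f Y 1 θ ω) * (gradLam f Y 1 θ ω i * gradLam f Y 1 θ ω j)

/-- The `(i, j)` entry of `Var(Y_1 | F_0) λ_1(θ)⁻² (∂λ_1(θ)/∂θ) (∂λ_1(θ)/∂θ')`. -/
def entryI (θ : Param d) (i j : Fin d) (ω : Ω) : ℝ :=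
  (condVar (pastSigma Y 1) (fun ω' => (Y 1 ω' : ℝ)) P ω / lam f Y 1 θ ω ^ 2) *
    (gradLam f Y 1 θ ω i * gradLam f Y 1 θ ω j)

/-- The matrix `J(θ)`. -/
def matJ (θ : Param d) : Matrix (Fin d) (Fin d) ℝ :=
  Matrix.of fun i j => ∫ ω, entryJ f Y θ i j ω ∂P

/-- The matrix `I(θ)`. -/
def matI (θ : Param d) : Matrix (Fin d) (Fin d) ℝ :=
  Matrix.of fun i j => ∫ ω, entryI f Y P θ i j ω ∂P

/-- `Y` is strictly stationary and ergodic: the left shift on `ℤ`-indexed paths preserves the law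
of `Y` and is ergodic for it. -/
def IsStationaryErgodic : Prop :=
  (∀ t, Measurable (Y t)) ∧
    Ergodic (fun (y : ℤ → ℕ) (t : ℤ) => y (t + 1)) (P.map (fun ω t => Y t ω))

/-- `Y` is an observation-driven process with parameter `θ`: for some family `p(·; l)` of
distributions on the non-negative integers, the conditional law of `Y_t` given `F_{t-1}` is
`p(·; λ_t(θ))`, and `λ_t(θ) = E(Y_t | F_{t-1})`. -/
def IsODProcess (θ : Param d) : Prop :=
  ∃ p : ℝ → PMF ℕ, ∀ t : ℤ,
    (∀ k : ℕ, P[(Y t ⁻¹' {k}).indicator (fun _ => (1 : ℝ)) | pastSigma Y t]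
      =ᵐ[P] fun ω => (p (lam f Y t θ ω) k).toReal) ∧
    P[(fun ω => (Y t ω : ℝ)) | pastSigma Y t] =ᵐ[P] lam f Y t θ

/-- Uniformly bounded moments of some order larger than two: `E Y_t^{1+ε} < C`, with `ε > 1`. -/
def HasMoments : Prop :=
  ∃ C : ℝ≥0, ∃ ε : ℝ, 1 < ε ∧ ∀ t, ∫⁻ ω, (Y t ω : ℝ≥0∞) ^ (1 + ε) ∂P < C

/-- Parameters in `Θ` that give the same conditional mean almost surely are equal. -/
def Identifiable (Θ : Set (Param d)) : Prop :=
  ∀ θ ∈ Θ, ∀ θ' ∈ Θ, (∃ t : ℤ, ∀ᵐ ω ∂P, lam f Y t θ ω = lam f Y t θ' ω) → θ = θ'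

/-- Almost surely `a_t → 0` and `Y_t a_t → 0`. -/
def InitialEffectVanishes (Θ : Set (Param d)) : Prop :=
  ∀ᵐ ω ∂P, Tendsto (fun t : ℕ => aCoef f Y Θ t ω) atTop (𝓝 0) ∧
    Tendsto (fun t : ℕ => (Y t ω : ℝ≥0∞) * aCoef f Y Θ t ω) atTop (𝓝 0)

/-- There is a neighbourhood of `θ₀` in `Θ` on which the second derivatives of `ℓ_1` are
dominated by an integrable function. -/
def HessianDominated (Θ : Set (Param d)) (θ₀ : Param d) : Prop :=
  ∃ V ∈ 𝓝[Θ] θ₀, ∀ i j : Fin d, ∫⁻ ω, (⨆ θ ∈ V ∩ Θ, ‖hessEll f Y 1 i j θ ω‖ₑ) ∂P < ∞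

end Objects

/-- The sequence `x_t` is `O(t^{-h})`. -/
def IsPowerBounded (h : ℝ) (x : ℕ → ℝ≥0∞) : Prop :=
  ∃ K : ℝ≥0, ∀ᶠ t : ℕ in atTop, x t ≤ K * (t : ℝ≥0∞) ^ (-h)

/-- For some `h > 1/2`, almost surely `b_t`, `b_t Y_t` and `a_t d_t Y_t` are `O(t^{-h})`. -/
def InitialEffectRate {Ω : Type*} {d : ℕ} (f : Param d → (ℕ → ℕ) → ℝ) (Y : ℤ → Ω → ℕ)
    [MeasurableSpace Ω] (P : Measure Ω) (Θ : Set (Param d)) : Prop :=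
  ∃ h : ℝ, 1 / 2 < h ∧
    IsPowerBounded h (fun t => bCoef f Y P Θ t) ∧
    (∀ᵐ ω ∂P, IsPowerBounded h (fun t => bCoef f Y P Θ t * (Y t ω : ℝ≥0∞))) ∧
    ∀ᵐ ω ∂P, IsPowerBounded h
      (fun t => aCoef f Y Θ t ω * dCoef f Y P Θ t * (Y t ω : ℝ≥0∞))

/-- `|∂^i f_θ(y)/∂θ^i - ∂^i f_θ(y')/∂θ^i| ≤ ∑_{k ≥ 1} α_k |y_k - y'_k|` for all `θ ∈ Θ` and all
`y, y'`; the right-hand side may be infinite, and entry `k` of `y` is the value at lag `k + 1`. -/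
def DerivLipschitz {d : ℕ} (f : Param d → (ℕ → ℕ) → ℝ) (Θ : Set (Param d)) (i : ℕ)
    (α : ℕ → ℝ≥0) : Prop :=
  ∀ y y' : ℕ → ℕ, ∀ θ ∈ Θ,
    ‖iteratedFDeriv ℝ i (fun ϑ => f ϑ y) θ - iteratedFDeriv ℝ i (fun ϑ => f ϑ y') θ‖ₑ
      ≤ ∑' k : ℕ, (α (k + 1) : ℝ≥0∞) * ‖(y k : ℝ) - (y' k : ℝ)‖ₑ

/-- The submatrix of `A` with rows and columns in `m`. -/
def activeBlock {d : ℕ} (m : Finset (Fin d)) (A : Matrix (Fin d) (Fin d) ℝ) : Matrix m m ℝ :=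
  A.submatrix Subtype.val Subtype.val

/-- The `d × d` matrix whose `m × m` block is `J_m⁻¹ I_m J_m⁻¹` and whose other entries vanish. -/
def sandwich {d : ℕ} (m : Finset (Fin d)) (J I : Matrix (Fin d) (Fin d) ℝ) :
    Matrix (Fin d) (Fin d) ℝ :=
  Matrix.of fun i j =>
    if h : i ∈ m ∧ j ∈ m then
      ((activeBlock m J)⁻¹ * activeBlock m I * (activeBlock m J)⁻¹) ⟨i, h.1⟩ ⟨j, h.2⟩
    else 0

end

end CountSeries

/-! Write L for the quasi-log-likelihood and Z_n = n^{-1/2} ∑ s_t for the normalized score at θ*,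
with s_t = (Y_t - λ_t) λ_t⁻¹ ∂λ_t. Since E(Y_t | F_{t-1}) = λ_t, the s_t are stationary ergodic
martingale differences with covariance I, hence Z_n converges to N(0, I)
(`tendsto_charFun_normScore`, an instance of the martingale central limit theorem
`tendsto_integral_exp_martingale`). The other limits are limits in probability; those of empirical
averages come from the mean ergodic theorem in L¹. They are all phrased with the filter `whp`, so
that uniform statements in θ can be combined like ordinary eventual statements.

Local part. With w = √n (θ - θ*), the ratio L(θ) - L(θ*) equals ⟨w, Z_n⟩ - w'Jw/2 + o(1), uniformly
for bounded w (`eventually_abs_quasiLogLik_sub_le`). The logarithm is expanded exactly, log(1 + x) =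
x - `logRem` x, with x the relative increment of λ_t. The second derivative of λ_t then carries the
centred weight Y_t/λ_t - 1 and averages out (`eventually_abs_sum_quad_le`), so the curvature J comes
from `logRem` alone. Only Y_t and the envelope of the family are known to be square integrable, and
Y_t times the squared envelope need not be integrable. The two bounds of the remainder are therefore
obtained differently: from below by truncating the envelope and using `logRem` ≥ 0
(`eventually_le_remSum`), from above only at distance O(n^{-1/2}), where the maximum of the envelope
over n times is o(√n) (`eventually_remSum_le`). Replacing the full past by the observed one costs
o(1) in the score because n^{-1/2} ∑ t^{-h} → 0 for h > 1/2 (`tendsto_whp_inv_sqrt_mul_sum`).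

Global part. The strict inequality log u < u - 1 and identifiability make L smaller than L(θ*) - ρn
away from θ* (`eventually_quasiLogLik_le`, by compactness). Together with the lower bound of the
remainder, any θ in a correct model with L(θ) ≥ L(θ*) is at distance O_P(n^{-1/2}) of θ* and gains
only O_P(1) (`eventually_close_of_quasiLogLik_le`).

Selection and limit. A wrong model loses ρn, more than the penalty κ_n |m*| = o(n); a correct model
larger than m* gains O_P(1), less than the extra penalty κ_n → ∞. So the selected model is m* with
probability tending to one (`eventually_selection`). Inside m*, comparing the maximizer with the
maximizer of the quadratic approximation, which is J_{m*}⁻¹ extended by zero and applied to Z_n, and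
using strong concavity, shows that the two differ by o_P(1) in the coordinate w
(`eventually_norm_sub_gainMap_le`). Slutsky's lemma concludes. -/

namespace CountSeries

/-! ### Convergence in probability as convergence along a filter -/

section Whp

variable {Ω : Type*} [MeasurableSpace Ω]

/-- The filter of the events `A n` whose probability tends to one: convergence along it is
convergence in probability. -/
def whp (P : Measure Ω) : Filter (ℕ × Ω) where
  sets := {A | Tendsto (fun n => P {ω | (n, ω) ∉ A}) atTop (𝓝 0)}
  univ_sets := by simp
  sets_of_superset := by
    intro A B hA hAB
    refine tendsto_of_tendsto_of_tendsto_of_le_of_le tendsto_const_nhds hA (fun _ => zero_le)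
      (fun n => measure_mono fun ω hω h => hω (hAB h))
  inter_sets := by
    intro A B hA hB
    have h := hA.add hB
    rw [add_zero] at h
    refine tendsto_of_tendsto_of_tendsto_of_le_of_le tendsto_const_nhds h (fun _ => zero_le)
      (fun n => (measure_mono fun ω hω => ?_).trans (measure_union_le _ _))
    by_cases hA : (n, ω) ∈ A
    · exact Or.inr fun hB => hω ⟨hA, hB⟩
    · exact Or.inl hA

variable {P : Measure Ω}

lemma eventually_whp {p : ℕ × Ω → Prop} :
    (∀ᶠ x in whp P, p x) ↔ Tendsto (fun n => P {ω | ¬ p (n, ω)}) atTop (𝓝 0) := Iff.rfl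

lemma eventually_whp_of_ae {p : ℕ × Ω → Prop} (h : ∀ᶠ n in atTop, ∀ᵐ ω ∂P, p (n, ω)) :
    ∀ᶠ x in whp P, p x := by
  rw [eventually_whp]
  refine tendsto_const_nhds.congr' ?_
  filter_upwards [h] with n hn
  exact (ae_iff.1 hn).symm

lemma tendsto_fst_whp : Tendsto (fun x : ℕ × Ω => x.1) (whp P) atTop := by
  rw [tendsto_atTop]
  intro b
  refine eventually_whp_of_ae ?_
  filter_upwards [eventually_ge_atTop b] with n hn
  exact Eventually.of_forall fun _ => hn

/-- To show that `p` holds with probability tending to one, it is enough to do it on each member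
of a family of events that exhausts the probability. -/
lemma eventually_whp_of_exhaust {ι : Type*} {p : ℕ × Ω → Prop} (A : ι → Set (ℕ × Ω))
    (hA : ∀ ε : ℝ≥0∞, 0 < ε → ∃ K, ∀ᶠ n in atTop, P {ω | (n, ω) ∉ A K} ≤ ε)
    (h : ∀ K, ∀ᶠ x in whp P ⊓ 𝓟 (A K), p x) : ∀ᶠ x in whp P, p x := by
  rw [eventually_whp, ENNReal.tendsto_nhds_zero]
  intro ε hε
  obtain ⟨K, hK⟩ := hA (ε / 2) (ENNReal.half_pos hε.ne')
  have hp := h K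
  rw [eventually_inf_principal, eventually_whp, ENNReal.tendsto_nhds_zero] at hp
  filter_upwards [hK, hp (ε / 2) (ENNReal.half_pos hε.ne')] with n h1 h2
  calc P {ω | ¬ p (n, ω)} ≤ P ({ω | (n, ω) ∉ A K} ∪ {ω | ¬ ((n, ω) ∈ A K → p (n, ω))}) := by
        refine measure_mono fun ω hω => ?_
        by_cases hA : (n, ω) ∈ A K
        · exact Or.inr fun h => hω (h hA)
        · exact Or.inl hA
    _ ≤ ε / 2 + ε / 2 := (measure_union_le _ _).trans (add_le_add h1 h2)
    _ = ε := ENNReal.add_halves ε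

lemma tendsto_whp_of_exhaust {ι β : Type*} {X : ℕ × Ω → β} {l : Filter β} (A : ι → Set (ℕ × Ω))
    (hA : ∀ ε : ℝ≥0∞, 0 < ε → ∃ K, ∀ᶠ n in atTop, P {ω | (n, ω) ∉ A K} ≤ ε)
    (h : ∀ K, Tendsto X (whp P ⊓ 𝓟 (A K)) l) : Tendsto X (whp P) l :=
  fun _ hs => eventually_whp_of_exhaust A hA fun K => h K hs

/-- An increasing sequence of measurable events with almost sure union is exhausting. -/
lemma exhaust_of_monotone [IsFiniteMeasure P] (E : ℕ → Set Ω) (hE : Monotone E)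
    (hm : ∀ N, MeasurableSet (E N)) (h : ∀ᵐ ω ∂P, ∃ N, ω ∈ E N) (ε : ℝ≥0∞) (hε : 0 < ε) :
    ∃ N, ∀ᶠ n : ℕ in atTop, P {ω | (n, ω) ∉ {x : ℕ × Ω | x.2 ∈ E N}} ≤ ε := by
  have hlim := tendsto_measure_iInter_atTop (μ := P) (s := fun N => (E N)ᶜ)
    (fun N => (hm N).compl.nullMeasurableSet)
    (fun a b hab => Set.compl_subset_compl.2 (hE hab)) ⟨0, measure_ne_top _ _⟩
  have h0 : P (⋂ N, (E N)ᶜ) = 0 := by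
    rw [← Set.compl_iUnion]
    refine (measure_mono_null ?_ (ae_iff.1 h))
    intro ω hω
    simpa using hω
  rw [h0, ENNReal.tendsto_nhds_zero] at hlim
  obtain ⟨N, hN⟩ := (hlim ε hε).exists
  exact ⟨N, Eventually.of_forall fun n => hN⟩

lemma tendsto_whp_zero_of_lintegral {X : ℕ → Ω → ℝ} (hX : ∀ n, AEMeasurable (X n) P)
    (h : Tendsto (fun n => ∫⁻ ω, ‖X n ω‖ₑ ∂P) atTop (𝓝 0)) :
    Tendsto (fun x : ℕ × Ω => X x.1 x.2) (whp P) (𝓝 0) := by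
  rw [Metric.tendsto_nhds]
  intro ε hε
  rw [eventually_whp]
  have hε' : ENNReal.ofReal ε ≠ 0 := by simpa using hε
  have h2 := ENNReal.Tendsto.const_mul (a := (ENNReal.ofReal ε)⁻¹) h
    (Or.inr (ENNReal.inv_ne_top.2 hε'))
  rw [mul_zero] at h2
  refine tendsto_of_tendsto_of_tendsto_of_le_of_le tendsto_const_nhds h2 (fun _ => zero_le)
    (fun n => ?_)
  have h3 := mul_meas_ge_le_lintegral₀ (μ := P) (hX n).enorm (ENNReal.ofReal ε)
  have h4 : P {ω | ¬ dist (X n ω) 0 < ε} ≤ P {ω | ENNReal.ofReal ε ≤ ‖X n ω‖ₑ} := by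
    refine measure_mono fun ω hω => ?_
    simp only [dist_zero_right, not_lt, Set.mem_ofPred_eq] at hω ⊢
    rw [← ofReal_norm]
    exact ENNReal.ofReal_le_ofReal hω
  refine h4.trans ?_
  rw [mul_comm, ← div_eq_mul_inv, ENNReal.le_div_iff_mul_le (Or.inl hε') (Or.inl (by simp)),
    mul_comm]
  exact h3

lemma tendsto_whp_zero_of_integral {X : ℕ → Ω → ℝ} (hX : ∀ n, Integrable (X n) P)
    (h : Tendsto (fun n => ∫ ω, |X n ω| ∂P) atTop (𝓝 0)) :
    Tendsto (fun x : ℕ × Ω => X x.1 x.2) (whp P) (𝓝 0) := by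
  refine tendsto_whp_zero_of_lintegral (fun n => (hX n).aemeasurable) ?_
  have h1 := (ENNReal.tendsto_ofReal h)
  rw [ENNReal.ofReal_zero] at h1
  refine h1.congr fun n => ?_
  rw [ofReal_integral_eq_lintegral_ofReal (hX n).abs (ae_of_all _ fun _ => abs_nonneg _)]
  exact lintegral_congr fun ω => by rw [← ofReal_norm, Real.norm_eq_abs]

lemma tendsto_whp_of_ae [IsFiniteMeasure P] {X : ℕ → Ω → ℝ} (hX : ∀ n, AEStronglyMeasurable (X n) P)
    (h : ∀ᵐ ω ∂P, Tendsto (fun n => X n ω) atTop (𝓝 0)) :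
    Tendsto (fun x : ℕ × Ω => X x.1 x.2) (whp P) (𝓝 0) := by
  have h1 := tendstoInMeasure_of_tendsto_ae (g := fun _ => (0 : ℝ)) hX h
  rw [Metric.tendsto_nhds]
  intro ε hε
  rw [eventually_whp]
  rw [tendstoInMeasure_iff_norm] at h1
  simpa using h1 ε hε

lemma tendstoInMeasure_of_whp {E : Type*} [NormedAddCommGroup E] {X : ℕ → Ω → E}
    (h : Tendsto (fun x : ℕ × Ω => X x.1 x.2) (whp P) (𝓝 0)) :
    TendstoInMeasure P X atTop 0 := by
  rw [tendstoInMeasure_iff_norm]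
  intro ε hε
  have h1 := Metric.tendsto_nhds.1 h ε hε
  rw [eventually_whp] at h1
  simpa using h1

end Whp

/-! ### The mean ergodic theorem, in L² and then in L¹ -/

section MeanErgodic

variable {S : Type*} [MeasurableSpace S] {μ : Measure S} {T : S → S}

lemma iterate_compMeasurePreserving (hT : MeasurePreserving T μ μ) (g : Lp ℝ 2 μ) (k : ℕ) :
    ((Lp.compMeasurePreservingₗᵢ ℝ T hT).toContinuousLinearMap^[k] g : S → ℝ)
      =ᵐ[μ] fun x => g (T^[k] x) := by
  induction k with
  | zero => rfl
  | succ k ih =>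
    rw [Function.iterate_succ_apply']
    refine (Lp.coeFn_compMeasurePreserving _ hT).trans ?_
    have := hT.quasiMeasurePreserving.ae_eq_comp ih
    refine this.trans (Eventually.of_forall fun x => ?_)
    simp [Function.iterate_succ_apply]

lemma integral_average_iterate (hT : MeasurePreserving T μ μ) {G : S → ℝ} (hG : Integrable G μ)
    {n : ℕ} (hn : n ≠ 0) :
    ∫ x, (n : ℝ)⁻¹ * ∑ k ∈ Finset.range n, G (T^[k] x) ∂μ = ∫ y, G y ∂μ := by
  have hk : ∀ k, ∫ x, G (T^[k] x) ∂μ = ∫ y, G y ∂μ := by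
    intro k
    have h := hT.iterate k
    rw [← integral_map h.aemeasurable (h.map_eq.symm ▸ hG.aestronglyMeasurable), h.map_eq]
  rw [integral_const_mul, integral_finsetSum _ (f := fun k x => G (T^[k] x))
    (fun k _ => ((hT.iterate k).integrable_comp_of_integrable hG))]
  simp only [hk, Finset.sum_const, Finset.card_range, nsmul_eq_mul]
  field_simp

lemma integrable_average_iterate (hT : MeasurePreserving T μ μ) {G : S → ℝ} (hG : Integrable G μ)
    (n : ℕ) : Integrable (fun x => (n : ℝ)⁻¹ * ∑ k ∈ Finset.range n, G (T^[k] x)) μ :=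
  (integrable_finsetSum _ fun k _ => (hT.iterate k).integrable_comp_of_integrable hG).const_mul _

/-- Von Neumann's theorem for the Koopman operator gives convergence in L² to the projection on the
invariant functions. Ergodicity makes this projection almost everywhere constant, and the constant
is ∫ G because every average has that integral. The L¹ distance is at most the L² distance. -/
lemma tendsto_integral_abs_average_sub_of_memLp_two [IsProbabilityMeasure μ] (hT : Ergodic T μ)
    {G : S → ℝ} (hG : MemLp G 2 μ) :
    Tendsto (fun n : ℕ => ∫ x, |(n : ℝ)⁻¹ * ∑ k ∈ Finset.range n, G (T^[k] x) - ∫ y, G y ∂μ| ∂μ)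
      atTop (𝓝 0) := by
  have hMP := hT.toMeasurePreserving
  have hG1 : Integrable G μ := hG.integrable one_le_two
  set U : Lp ℝ 2 μ →L[ℝ] Lp ℝ 2 μ := (Lp.compMeasurePreservingₗᵢ ℝ T hMP).toContinuousLinearMap
    with hU
  have hU1 : ‖U‖ ≤ 1 := LinearIsometry.norm_toContinuousLinearMap_le _
  have h := U.tendsto_birkhoffAverage_orthogonalProjection hU1 (hG.toLp G)
  set π := (U.eqLocus (1 : Lp ℝ 2 μ →L[ℝ] Lp ℝ 2 μ)).orthogonalProjectionOnto (hG.toLp G)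
  have hπ : U (π : Lp ℝ 2 μ) = (π : Lp ℝ 2 μ) := π.2
  have hπ2 : (fun x => ((π : Lp ℝ 2 μ) : S → ℝ) x) ∘ T =ᵐ[μ] fun x => ((π : Lp ℝ 2 μ) : S → ℝ) x := by
    have h1 := Lp.coeFn_compMeasurePreserving (π : Lp ℝ 2 μ) hMP
    have h2 : Lp.compMeasurePreserving T hMP (π : Lp ℝ 2 μ) = (π : Lp ℝ 2 μ) := hπ
    rw [h2] at h1
    exact h1.symm
  obtain ⟨c, hc⟩ := hT.ae_eq_const_of_ae_eq_comp_ae (Lp.aestronglyMeasurable _) hπ2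
  set A : ℕ → S → ℝ := fun n x => (n : ℝ)⁻¹ * ∑ k ∈ Finset.range n, G (T^[k] x) with hA
  have hAe : ∀ n, ((birkhoffAverage ℝ U _root_.id n (hG.toLp G) : Lp ℝ 2 μ) : S → ℝ) =ᵐ[μ] A n := by
    intro n
    have hk : ∀ k, (U^[k] (hG.toLp G) : S → ℝ) =ᵐ[μ] fun x => G (T^[k] x) := by
      intro k
      refine (iterate_compMeasurePreserving hMP (hG.toLp G) k).trans ?_
      exact (hMP.iterate k).quasiMeasurePreserving.ae_eq_comp hG.coeFn_toLp
    have hsum : ((∑ k ∈ Finset.range n, U^[k] (hG.toLp G) : Lp ℝ 2 μ) : S → ℝ)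
        =ᵐ[μ] fun x => ∑ k ∈ Finset.range n, G (T^[k] x) := by
      induction n with
      | zero => simp only [Finset.range_zero, Finset.sum_empty]; exact Lp.coeFn_zero ℝ 2 μ
      | succ n ih =>
        rw [Finset.sum_range_succ]
        refine (Lp.coeFn_add _ _).trans ?_
        filter_upwards [ih, hk n] with x h1 h2
        rw [Pi.add_apply, h1, h2, Finset.sum_range_succ]
    simp only [birkhoffAverage, birkhoffSum, id]
    refine (Lp.coeFn_smul _ _).trans ?_
    filter_upwards [hsum] with x hx
    rw [Pi.smul_apply, hx, smul_eq_mul]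
  have hAi : ∀ n, Integrable (A n) μ := integrable_average_iterate hMP hG1
  have hle : ∀ n, ∫ x, |A n x - c| ∂μ
      ≤ ‖birkhoffAverage ℝ U _root_.id n (hG.toLp G) - (π : Lp ℝ 2 μ)‖ := by
    intro n
    have he : ((birkhoffAverage ℝ U _root_.id n (hG.toLp G) - (π : Lp ℝ 2 μ) : Lp ℝ 2 μ) : S → ℝ)
        =ᵐ[μ] fun x => A n x - c := by
      refine (Lp.coeFn_sub _ _).trans ?_
      filter_upwards [hAe n, hc] with x h1 h2
      simp [h1, h2]
    have hint : Integrable (fun x => A n x - c) μ := (hAi n).sub (integrable_const c)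
    rw [Lp.norm_def, eLpNorm_congr_ae he]
    have h1 : ∫ x, |A n x - c| ∂μ = (eLpNorm (fun x => A n x - c) 1 μ).toReal := by
      rw [eLpNorm_one_eq_lintegral_enorm, ← integral_norm_eq_lintegral_enorm hint.1]
      rfl
    rw [h1]
    refine ENNReal.toReal_mono ?_ (eLpNorm_le_eLpNorm_of_exponent_le one_le_two hint.1)
    rw [← eLpNorm_congr_ae he]
    exact Lp.eLpNorm_ne_top _
  have hlim : Tendsto (fun n => ∫ x, |A n x - c| ∂μ) atTop (𝓝 0) :=
    squeeze_zero (fun n => integral_nonneg fun _ => abs_nonneg _) hle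
      (tendsto_iff_norm_sub_tendsto_zero.1 h)
  have hcG : c = ∫ y, G y ∂μ := by
    have h0 : Tendsto (fun _ : ℕ => |∫ y, G y ∂μ - c|) atTop (𝓝 0) := by
      refine squeeze_zero' (Eventually.of_forall fun _ => abs_nonneg _) ?_ hlim
      filter_upwards [eventually_ne_atTop 0] with n hn
      have : ∫ y, G y ∂μ - c = ∫ x, (A n x - c) ∂μ := by
        rw [integral_sub (hAi n) (integrable_const c), integral_average_iterate hMP hG1 hn]
        simp
      rw [this]
      exact abs_integral_le_integral_abs
    have := tendsto_nhds_unique h0 tendsto_const_nhds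
    linarith [abs_eq_zero.1 this.symm]
  rw [← hcG]
  exact hlim

/-- The mean ergodic theorem in `L¹`. -/
theorem tendsto_integral_abs_average_sub [IsProbabilityMeasure μ] (hT : Ergodic T μ)
    {G : S → ℝ} (hG : Integrable G μ) :
    Tendsto (fun n : ℕ => ∫ x, |(n : ℝ)⁻¹ * ∑ k ∈ Finset.range n, G (T^[k] x) - ∫ y, G y ∂μ| ∂μ)
      atTop (𝓝 0) := by
  have hMP := hT.toMeasurePreserving
  rw [Metric.tendsto_atTop]
  intro ε hε
  -- Simple functions lie in L² and are dense in L¹. As `T` preserves `μ`, replacing `G` by `H`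
  -- changes the averages by less than ε/3 in L¹ for every n, and the limit by less than ε/3.
  obtain ⟨H, hH, -⟩ := (memLp_one_iff_integrable.2 hG).exists_simpleFunc_eLpNorm_sub_lt
    ENNReal.one_ne_top (ε := ENNReal.ofReal (ε / 3)) (by simpa using by positivity)
  have hHi : Integrable H μ := SimpleFunc.integrable_of_isFiniteMeasure H
  have hGH : ∫ x, |G x - H x| ∂μ < ε / 3 := by
    have h1 : ∫ x, |G x - H x| ∂μ = (eLpNorm (G - ⇑H) 1 μ).toReal := by
      rw [eLpNorm_one_eq_lintegral_enorm, ← integral_norm_eq_lintegral_enorm (hG.sub hHi).1]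
      rfl
    rw [h1]
    exact (ENNReal.toReal_lt_of_lt_ofReal hH)
  have hlim := tendsto_integral_abs_average_sub_of_memLp_two hT
    (H.memLp_of_isFiniteMeasure 2 μ)
  obtain ⟨N, hN⟩ := (Metric.tendsto_atTop.1 hlim) (ε / 3) (by positivity)
  refine ⟨max N 1, fun n hn => ?_⟩
  have h3 := hN n ((le_max_left _ _).trans hn)
  have hn0 : n ≠ 0 := by have := (le_max_right N 1).trans hn; omega
  rw [Real.dist_eq, sub_zero, abs_of_nonneg (integral_nonneg fun _ => abs_nonneg _)] at h3 ⊢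
  have hD : Integrable (fun x => |G x - H x|) μ := (hG.sub hHi).abs
  have hint := integral_average_iterate hMP hD hn0
  have hb : ∀ x, |(n : ℝ)⁻¹ * ∑ k ∈ Finset.range n, G (T^[k] x) - ∫ y, G y ∂μ|
      ≤ (n : ℝ)⁻¹ * ∑ k ∈ Finset.range n, |G (T^[k] x) - H (T^[k] x)|
        + |(n : ℝ)⁻¹ * ∑ k ∈ Finset.range n, H (T^[k] x) - ∫ y, H y ∂μ|
        + ∫ y, |G y - H y| ∂μ := by
    intro x
    have e1 : |(n : ℝ)⁻¹ * ∑ k ∈ Finset.range n, G (T^[k] x)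
        - (n : ℝ)⁻¹ * ∑ k ∈ Finset.range n, H (T^[k] x)|
        ≤ (n : ℝ)⁻¹ * ∑ k ∈ Finset.range n, |G (T^[k] x) - H (T^[k] x)| := by
      rw [← mul_sub, ← Finset.sum_sub_distrib, abs_mul, abs_of_nonneg (by positivity)]
      exact mul_le_mul_of_nonneg_left (Finset.abs_sum_le_sum_abs _ _) (by positivity)
    have e2 : |∫ y, H y ∂μ - ∫ y, G y ∂μ| ≤ ∫ y, |G y - H y| ∂μ := by
      rw [abs_sub_comm, ← integral_sub hG hHi]
      exact abs_integral_le_integral_abs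
    have := abs_add_le ((n : ℝ)⁻¹ * ∑ k ∈ Finset.range n, G (T^[k] x)
        - (n : ℝ)⁻¹ * ∑ k ∈ Finset.range n, H (T^[k] x))
        ((n : ℝ)⁻¹ * ∑ k ∈ Finset.range n, H (T^[k] x) - ∫ y, H y ∂μ)
    have := abs_add_le (((n : ℝ)⁻¹ * ∑ k ∈ Finset.range n, G (T^[k] x)
        - (n : ℝ)⁻¹ * ∑ k ∈ Finset.range n, H (T^[k] x))
        + ((n : ℝ)⁻¹ * ∑ k ∈ Finset.range n, H (T^[k] x) - ∫ y, H y ∂μ))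
        (∫ y, H y ∂μ - ∫ y, G y ∂μ)
    have e3 : (((n : ℝ)⁻¹ * ∑ k ∈ Finset.range n, G (T^[k] x)
        - (n : ℝ)⁻¹ * ∑ k ∈ Finset.range n, H (T^[k] x))
        + ((n : ℝ)⁻¹ * ∑ k ∈ Finset.range n, H (T^[k] x) - ∫ y, H y ∂μ))
        + (∫ y, H y ∂μ - ∫ y, G y ∂μ)
        = (n : ℝ)⁻¹ * ∑ k ∈ Finset.range n, G (T^[k] x) - ∫ y, G y ∂μ := by ring
    rw [e3] at this
    linarith
  have i1 := integrable_average_iterate hMP hD n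
  have i2 : Integrable (fun x => |(n : ℝ)⁻¹ * ∑ k ∈ Finset.range n, H (T^[k] x) - ∫ y, H y ∂μ|) μ :=
    ((integrable_average_iterate hMP hHi n).sub (integrable_const _)).abs
  have hmono := integral_mono (((integrable_average_iterate hMP hG n).sub
    (integrable_const (∫ y, G y ∂μ))).abs)
    ((i1.add i2).add (integrable_const (∫ y, |G y - H y| ∂μ))) hb
  have e4 : ∫ x, ((n : ℝ)⁻¹ * ∑ k ∈ Finset.range n, |G (T^[k] x) - H (T^[k] x)|
        + |(n : ℝ)⁻¹ * ∑ k ∈ Finset.range n, H (T^[k] x) - ∫ y, H y ∂μ|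
        + ∫ y, |G y - H y| ∂μ) ∂μ = ∫ y, |G y - H y| ∂μ
        + ∫ x, |(n : ℝ)⁻¹ * ∑ k ∈ Finset.range n, H (T^[k] x) - ∫ y, H y ∂μ| ∂μ
        + ∫ y, |G y - H y| ∂μ := by
    rw [integral_add (f := fun x => (n : ℝ)⁻¹ * ∑ k ∈ Finset.range n, |G (T^[k] x) - H (T^[k] x)|
        + |(n : ℝ)⁻¹ * ∑ k ∈ Finset.range n, H (T^[k] x) - ∫ y, H y ∂μ|)
      (i1.add i2) (integrable_const _), integral_add i1 i2, hint]
    simp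
  have hmono' : ∫ x, |(n : ℝ)⁻¹ * ∑ k ∈ Finset.range n, G (T^[k] x) - ∫ y, G y ∂μ| ∂μ
      ≤ ∫ y, |G y - H y| ∂μ
        + ∫ x, |(n : ℝ)⁻¹ * ∑ k ∈ Finset.range n, H (T^[k] x) - ∫ y, H y ∂μ| ∂μ
        + ∫ y, |G y - H y| ∂μ := hmono.trans_eq e4
  linarith

end MeanErgodic

/-! ### Averages and maxima along a stationary ergodic sequence -/

section StationarySequence

variable {Ω S : Type*} [MeasurableSpace Ω] [MeasurableSpace S] {P : Measure Ω} {μ : Measure S}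
  {T : S → S} {τ : ℕ → Ω → S}

lemma sum_Icc_one_eq_sum_range {M : Type*} [AddCommMonoid M] (f : ℕ → M) (n : ℕ) :
    ∑ t ∈ Finset.Icc 1 n, f t = ∑ k ∈ Finset.range n, f (k + 1) := by
  induction n with
  | zero => simp
  | succ n ih => rw [Finset.sum_Icc_succ_top (by omega), ih, Finset.sum_range_succ]

lemma tendsto_average_whp_of_integrable [IsProbabilityMeasure μ] (hT : Ergodic T μ)
    (hτ : ∀ t, MeasurePreserving (τ t) P μ) (hTτ : ∀ t ω, τ (t + 1) ω = T (τ t ω))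
    {G : S → ℝ} (hG : Integrable G μ) :
    Tendsto (fun x : ℕ × Ω => (x.1 : ℝ)⁻¹ * ∑ t ∈ Finset.Icc 1 x.1, G (τ t x.2)) (whp P)
      (𝓝 (∫ s, G s ∂μ)) := by
  have hτk : ∀ k ω, τ (k + 1) ω = T^[k] (τ 1 ω) := by
    intro k ω
    induction k with
    | zero => rfl
    | succ k ih => rw [hTτ, ih, Function.iterate_succ_apply']
  have hS : ∀ n ω, ∑ t ∈ Finset.Icc 1 n, G (τ t ω)
      = ∑ k ∈ Finset.range n, G (T^[k] (τ 1 ω)) := fun n ω => by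
    rw [sum_Icc_one_eq_sum_range]
    exact Finset.sum_congr rfl fun k _ => by rw [hτk]
  rw [tendsto_iff_norm_sub_tendsto_zero]
  have hi : ∀ n : ℕ, Integrable (fun s => |(n : ℝ)⁻¹ * ∑ k ∈ Finset.range n, G (T^[k] s)
      - ∫ s, G s ∂μ|) μ := fun n =>
    ((integrable_average_iterate hT.toMeasurePreserving hG n).sub (integrable_const _)).abs
  have h := tendsto_whp_zero_of_integral (P := P)
    (X := fun n ω => |(n : ℝ)⁻¹ * ∑ t ∈ Finset.Icc 1 n, G (τ t ω) - ∫ s, G s ∂μ|) ?_ ?_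
  · exact h
  · intro n
    refine ((hτ 1).integrable_comp_of_integrable (hi n)).congr (ae_of_all _ fun ω => ?_)
    simp only [Function.comp_apply, hS]
  · refine (tendsto_integral_abs_average_sub hT hG).congr fun n => ?_
    have h1 := integral_map (hτ 1).aemeasurable ((hτ 1).map_eq.symm ▸ (hi n).aestronglyMeasurable)
    rw [(hτ 1).map_eq] at h1
    rw [h1]
    refine integral_congr_ae (ae_of_all _ fun ω => ?_)
    simp only [hS, abs_abs]

/-- By stationarity the t-th term has L¹ norm ∫ |g t| dμ, which tends to zero by domination; its
Cesàro means bound the L¹ norm of the average. Letting the function vary with t is needed because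
the observed past is cut at a time that depends on t. -/
lemma tendsto_average_whp_zero (hτ : ∀ t, MeasurePreserving (τ t) P μ)
    {g : ℕ → S → ℝ} {G : S → ℝ} (hg : ∀ t, AEStronglyMeasurable (g t) μ) (hG : Integrable G μ)
    (hle : ∀ t, ∀ᵐ s ∂μ, |g t s| ≤ G s) (hlim : ∀ᵐ s ∂μ, Tendsto (fun t => g t s) atTop (𝓝 0)) :
    Tendsto (fun x : ℕ × Ω => (x.1 : ℝ)⁻¹ * ∑ t ∈ Finset.Icc 1 x.1, g t (τ t x.2)) (whp P)
      (𝓝 0) := by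
  have hgi : ∀ t, Integrable (g t) μ := fun t => hG.mono' (hg t) (hle t)
  have hgτ : ∀ t, Integrable (fun ω => g t (τ t ω)) P := fun t =>
    (hτ t).integrable_comp_of_integrable (hgi t)
  have hD : Tendsto (fun t => ∫ s, |g t s| ∂μ) atTop (𝓝 0) := by
    have := tendsto_integral_of_dominated_convergence (μ := μ) (F := fun t s => |g t s|)
      (f := fun _ => 0) G (fun t => (hgi t).abs.aestronglyMeasurable) hG
      (fun t => by simpa using hle t) (by
        filter_upwards [hlim] with s hs
        simpa using hs.abs)
    simpa using this
  refine tendsto_whp_zero_of_integral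
    (X := fun n ω => (n : ℝ)⁻¹ * ∑ t ∈ Finset.Icc 1 n, g t (τ t ω))
    (fun n => (integrable_finsetSum _ fun t _ => hgτ t).const_mul _) ?_
  have hces := ((tendsto_add_atTop_iff_nat 1).2 hD).cesaro
  refine squeeze_zero (fun n => integral_nonneg fun _ => abs_nonneg _) (fun n => ?_) hces
  calc ∫ ω, |(n : ℝ)⁻¹ * ∑ t ∈ Finset.Icc 1 n, g t (τ t ω)| ∂P
      ≤ ∫ ω, (n : ℝ)⁻¹ * ∑ t ∈ Finset.Icc 1 n, |g t (τ t ω)| ∂P := by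
        refine integral_mono ((integrable_finsetSum _ fun t _ => hgτ t).const_mul _).abs
          ((integrable_finsetSum _ fun t _ => (hgτ t).abs).const_mul _) fun ω => ?_
        simp only [abs_mul, abs_inv, Nat.abs_cast]
        exact mul_le_mul_of_nonneg_left (Finset.abs_sum_le_sum_abs _ _) (by positivity)
    _ = (n : ℝ)⁻¹ * ∑ t ∈ Finset.Icc 1 n, ∫ ω, |g t (τ t ω)| ∂P := by
        rw [integral_const_mul, integral_finsetSum _ fun t _ => (hgτ t).abs]
    _ = (n : ℝ)⁻¹ * ∑ t ∈ Finset.Icc 1 n, ∫ s, |g t s| ∂μ := by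
        congr 1
        refine Finset.sum_congr rfl fun t _ => ?_
        have h1 := integral_map (hτ t).aemeasurable
          ((hτ t).map_eq.symm ▸ (hgi t).abs.aestronglyMeasurable)
        rw [(hτ t).map_eq] at h1
        exact h1.symm
    _ = (n : ℝ)⁻¹ * ∑ k ∈ Finset.range n, ∫ s, |g (k + 1) s| ∂μ := by
        rw [sum_Icc_one_eq_sum_range]

/-- Averages of functions `g t` of a stationary ergodic sequence, where `g t` converges and is
dominated. -/
theorem tendsto_average_whp [IsProbabilityMeasure μ] (hT : Ergodic T μ)
    (hτ : ∀ t, MeasurePreserving (τ t) P μ) (hTτ : ∀ t ω, τ (t + 1) ω = T (τ t ω))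
    {g : ℕ → S → ℝ} {g' G : S → ℝ} (hg : ∀ t, AEStronglyMeasurable (g t) μ) (hG : Integrable G μ)
    (hle : ∀ t, ∀ᵐ s ∂μ, |g t s| ≤ G s)
    (hlim : ∀ᵐ s ∂μ, Tendsto (fun t => g t s) atTop (𝓝 (g' s))) :
    Tendsto (fun x : ℕ × Ω => (x.1 : ℝ)⁻¹ * ∑ t ∈ Finset.Icc 1 x.1, g t (τ t x.2)) (whp P)
      (𝓝 (∫ s, g' s ∂μ)) := by
  have hg'm : AEStronglyMeasurable g' μ := aestronglyMeasurable_of_tendsto_ae atTop hg hlim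
  have hle' : ∀ᵐ s ∂μ, |g' s| ≤ G s := by
    filter_upwards [hlim, ae_all_iff.2 hle] with s hs h
    exact le_of_tendsto hs.abs (Eventually.of_forall h)
  have hg'i : Integrable g' μ := hG.mono' hg'm hle'
  have h1 := tendsto_average_whp_of_integrable hT hτ hTτ hg'i
  have h2 := tendsto_average_whp_zero hτ (g := fun t s => g t s - g' s) (G := fun s => G s + G s)
    (fun t => (hg t).sub hg'm) (hG.add hG)
    (fun t => by
      filter_upwards [hle t, hle'] with s h3 h4
      exact (abs_sub _ _).trans (add_le_add h3 h4))
    (by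
      filter_upwards [hlim] with s hs
      simpa using hs.sub_const (g' s))
  have h3 := h1.add h2
  rw [add_zero] at h3
  refine h3.congr fun x => ?_
  rw [Finset.sum_sub_distrib]
  ring

/-- The maximum of the first `n` terms of a stationary integrable sequence is `o(n)` in
probability. -/
theorem eventually_whp_forall_le (hτ : ∀ t, MeasurePreserving (τ t) P μ)
    {V : S → ℝ} (hV : Integrable V μ) {ε : ℝ} (hε : 0 < ε) :
    ∀ᶠ x in whp P, ∀ t ∈ Finset.Icc 1 x.1, V (τ t x.2) ≤ ε * x.1 := by
  have hset : ∀ n : ℕ, NullMeasurableSet {s | ε * n < V s} μ := fun n =>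
    nullMeasurableSet_lt aemeasurable_const hV.aemeasurable
  -- The union bound and stationarity reduce the claim to n μ{V > εn} → 0, and this quantity is at
  -- most ε⁻¹ times the tail integral considered here.
  have hlim : Tendsto (fun n : ℕ => ∫⁻ s in {s | ε * n < V s}, ‖V s‖ₑ ∂μ) atTop (𝓝 0) := by
    have := tendsto_lintegral_of_dominated_convergence' (μ := μ)
      (F := fun (n : ℕ) s => {s | ε * n < V s}.indicator (fun s => ‖V s‖ₑ) s)
      (f := fun _ => 0) (fun s => ‖V s‖ₑ)
      (fun n => hV.aemeasurable.enorm.indicator₀ (hset n))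
      (fun n => ae_of_all _ fun s => Set.indicator_le_self _ _ _) hV.2.ne
      (ae_of_all _ fun s => by
        refine tendsto_const_nhds.congr' ?_
        obtain ⟨N, hN⟩ := exists_nat_gt (V s / ε)
        filter_upwards [eventually_ge_atTop N] with n hn
        rw [Set.indicator_of_notMem]
        simp only [Set.mem_ofPred_eq, not_lt]
        have : V s / ε < n := hN.trans_le (by exact_mod_cast hn)
        rw [div_lt_iff₀ hε] at this
        linarith)
    simp only [lintegral_zero] at this
    refine this.congr fun n => ?_
    rw [lintegral_indicator₀ (hset n)]
  rw [eventually_whp]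
  have hε' : ENNReal.ofReal ε ≠ 0 := by simpa using hε
  have h2 := ENNReal.Tendsto.const_mul (a := (ENNReal.ofReal ε)⁻¹) hlim
    (Or.inr (ENNReal.inv_ne_top.2 hε'))
  rw [mul_zero] at h2
  refine tendsto_of_tendsto_of_tendsto_of_le_of_le tendsto_const_nhds h2 (fun _ => zero_le)
    (fun n => ?_)
  have hm : ENNReal.ofReal ε * n * μ {s | ε * n < V s} ≤ ∫⁻ s in {s | ε * n < V s}, ‖V s‖ₑ ∂μ := by
    rw [← setLIntegral_const]
    refine setLIntegral_mono_ae hV.aemeasurable.enorm.restrict (ae_of_all _ fun s hs => ?_)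
    rw [← ENNReal.ofReal_natCast, ← ENNReal.ofReal_mul hε.le, ← ofReal_norm]
    exact ENNReal.ofReal_le_ofReal (hs.le.trans (le_abs_self _))
  calc P {ω | ¬ ∀ t ∈ Finset.Icc 1 n, V (τ t ω) ≤ ε * n}
      ≤ P (⋃ t ∈ Finset.Icc 1 n, τ t ⁻¹' {s | ε * n < V s}) := by
        refine measure_mono fun ω hω => ?_
        simp only [not_forall, not_le, Set.mem_ofPred_eq] at hω
        obtain ⟨t, ht, h⟩ := hω
        exact Set.mem_biUnion ht h
    _ ≤ ∑ t ∈ Finset.Icc 1 n, P (τ t ⁻¹' {s | ε * n < V s}) := measure_biUnion_finset_le _ _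
    _ = n * μ {s | ε * n < V s} := by
        rw [Finset.sum_congr rfl fun t _ => (hτ t).measure_preimage (hset n)]
        simp
    _ ≤ (ENNReal.ofReal ε)⁻¹ * ∫⁻ s in {s | ε * n < V s}, ‖V s‖ₑ ∂μ := by
        rw [mul_comm _ (∫⁻ _ in _, _ ∂μ), ← div_eq_mul_inv,
          ENNReal.le_div_iff_mul_le (Or.inl hε') (Or.inl (by simp))]
        refine le_of_eq_of_le ?_ hm
        ring

end StationarySequence

/-! ### The central limit theorem for martingale differences, by McLeish's products -/

section MartingaleCLT

variable {Ω S : Type*} [MeasurableSpace Ω] [MeasurableSpace S] {P : Measure Ω} {μ : Measure S}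
  {T : S → S} {τ : ℕ → Ω → S}

/-- Boundedness in L² gives uniform integrability. On the rare event where V ≥ ε/4, the inequality V
≤ aV² + 1/(4a) is used; `a` is chosen so that aC stays below ε/4, and 1/(4a) is multiplied by a
vanishing probability. -/
lemma tendsto_integral_zero_of_whp [IsProbabilityMeasure P] {V : ℕ → Ω → ℝ} {C : ℝ}
    (hV : ∀ n, MemLp (V n) 2 P) (h0 : ∀ n ω, 0 ≤ V n ω) (hC : ∀ n, ∫ ω, V n ω ^ 2 ∂P ≤ C)
    (h : Tendsto (fun x : ℕ × Ω => V x.1 x.2) (whp P) (𝓝 0)) :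
    Tendsto (fun n => ∫ ω, V n ω ∂P) atTop (𝓝 0) := by
  have hC0 : 0 ≤ C := (integral_nonneg fun ω => sq_nonneg (V 0 ω)).trans (hC 0)
  rw [Metric.tendsto_nhds]
  intro ε hε
  set a : ℝ := ε / (4 * (C + 1)) with ha
  have ha0 : 0 < a := by positivity
  have h1 := Metric.tendsto_nhds.1 h (ε / 4) (by positivity)
  rw [eventually_whp] at h1
  have h1' := (ENNReal.tendsto_toReal ENNReal.zero_ne_top).comp h1
  have h2 := (h1'.const_mul (1 / (4 * a)))
  simp only [ENNReal.toReal_zero, mul_zero] at h2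
  filter_upwards [Metric.tendsto_nhds.1 h2 (ε / 4) (by positivity)] with n hn
  rw [Real.dist_eq, sub_zero] at hn ⊢
  rw [abs_of_nonneg (integral_nonneg (h0 n))]
  set B : Set Ω := {ω | ¬ dist (V n ω) 0 < ε / 4} with hB
  have hBm : NullMeasurableSet B P := by
    have : B = {ω | ε / 4 ≤ V n ω} := by
      ext ω
      simp [hB, abs_of_nonneg (h0 n ω)]
    rw [this]
    exact nullMeasurableSet_le aemeasurable_const (hV n).1.aemeasurable
  have hsq : Integrable (fun ω => V n ω ^ 2) P := (hV n).integrable_sq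
  have hind : Integrable (B.indicator fun _ => (1 : ℝ)) P :=
    (integrable_const (1 : ℝ)).indicator₀ hBm
  have hle : ∀ ω, V n ω ≤ ε / 4 + a * V n ω ^ 2 + 1 / (4 * a) * B.indicator (fun _ => (1 : ℝ)) ω := by
    intro ω
    by_cases hω : ω ∈ B
    · rw [Set.indicator_of_mem hω]
      have : V n ω ≤ a * V n ω ^ 2 + 1 / (4 * a) := by
        have h4 : a * V n ω ^ 2 + 1 / (4 * a) - V n ω = a * (V n ω - 1 / (2 * a)) ^ 2 := by
          field_simp
          ring
        have : 0 ≤ a * (V n ω - 1 / (2 * a)) ^ 2 := by positivity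
        linarith
      linarith
    · rw [Set.indicator_of_notMem hω]
      have hω' : dist (V n ω) 0 < ε / 4 := by simpa [hB] using hω
      rw [Real.dist_eq, sub_zero, abs_of_nonneg (h0 n ω)] at hω'
      have : 0 ≤ a * V n ω ^ 2 := by positivity
      linarith
  have i1 : Integrable (fun ω => ε / 4 + a * V n ω ^ 2) P :=
    (integrable_const _).add (hsq.const_mul a)
  have hmono := integral_mono ((hV n).integrable one_le_two) (i1.add (hind.const_mul (1 / (4 * a))))
    hle
  have he : ∫ ω, (ε / 4 + a * V n ω ^ 2 + 1 / (4 * a) * B.indicator (fun _ => (1 : ℝ)) ω) ∂P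
      = ε / 4 + a * ∫ ω, V n ω ^ 2 ∂P + 1 / (4 * a) * (P B).toReal := by
    rw [integral_add i1 (hind.const_mul _), integral_add (integrable_const _) (hsq.const_mul a),
      integral_const_mul, integral_const_mul, integral_indicator₀ hBm]
    simp [Measure.real]
  have h5 : a * ∫ ω, V n ω ^ 2 ∂P ≤ ε / 4 := by
    calc a * ∫ ω, V n ω ^ 2 ∂P ≤ a * (C + 1) := by
          refine mul_le_mul_of_nonneg_left ((hC n).trans (by linarith)) ha0.le
      _ = ε / 4 := by rw [ha]; field_simp
  have h6 : 1 / (4 * a) * (P B).toReal < ε / 4 := (le_abs_self _).trans_lt hn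
  have hmono' : ∫ ω, V n ω ∂P ≤ ε / 4 + a * ∫ ω, V n ω ^ 2 ∂P + 1 / (4 * a) * (P B).toReal :=
    hmono.trans_eq he
  linarith

/-- The second order Taylor polynomial of log(1 + ix) is ix + x²/2. This is why ∏(1 + iX_s) is close
to exp(i∑X_s) exp(∑X_s²/2) when the X_s are small. -/
lemma norm_log_one_add_mul_I_sub_le {x : ℝ} (hx : |x| ≤ 1 / 2) :
    ‖Complex.log (1 + x * Complex.I) - x * Complex.I - ((x ^ 2 / 2 : ℝ) : ℂ)‖ ≤ |x| * x ^ 2 := by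
  have hz : ‖(x * Complex.I : ℂ)‖ = |x| := by simp
  have h := Complex.norm_log_sub_logTaylor_le 2 (z := x * Complex.I) (by rw [hz]; linarith)
  have he : Complex.logTaylor (2 + 1) (x * Complex.I)
      = x * Complex.I + ((x ^ 2 / 2 : ℝ) : ℂ) := by
    simp [Complex.logTaylor, Finset.sum_range_succ]
    ring_nf
    simp
  rw [he, hz, ← sub_sub] at h
  refine h.trans ?_
  have h1 : (1 - |x|)⁻¹ ≤ 2 := by
    rw [inv_le_comm₀ (by linarith) (by norm_num)]
    linarith
  have h2 : |x| ^ (2 + 1) = |x| * x ^ 2 := by rw [pow_succ, sq_abs]; ring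
  rw [h2]
  have h3 : 0 ≤ |x| * x ^ 2 := by positivity
  push_cast
  nlinarith

/-- The factors of the martingale transform, stopped when the quadratic variation exceeds `b`. -/
noncomputable def stoppedProd (X : ℕ → ℝ) (b : ℝ) (k : ℕ) : ℂ :=
  ∏ s ∈ Finset.Icc 1 k,
    (1 + ((if ∑ r ∈ Finset.Icc 1 (s - 1), X r ^ 2 ≤ b then X s else 0 : ℝ) : ℂ) * Complex.I)

lemma normSq_one_add_mul_I (x : ℝ) : ‖(1 + x * Complex.I : ℂ)‖ ^ 2 = 1 + x ^ 2 := by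
  rw [← Complex.normSq_eq_norm_sq, Complex.normSq_apply]
  simp
  ring

lemma stoppedProd_succ (X : ℕ → ℝ) (b : ℝ) (k : ℕ) :
    stoppedProd X b (k + 1) = stoppedProd X b k *
      (1 + ((if ∑ r ∈ Finset.Icc 1 k, X r ^ 2 ≤ b then X (k + 1) else 0 : ℝ) : ℂ) * Complex.I) := by
  rw [stoppedProd, Finset.prod_Icc_succ_top (by omega), stoppedProd]
  simp

lemma norm_stoppedProd_sq_le_exp (X : ℕ → ℝ) (b : ℝ) (k : ℕ) :
    ‖stoppedProd X b k‖ ^ 2 ≤ Real.exp (∑ r ∈ Finset.Icc 1 k, X r ^ 2) := by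
  induction k with
  | zero => simp [stoppedProd]
  | succ k ih =>
    rw [stoppedProd_succ, norm_mul, mul_pow, normSq_one_add_mul_I,
      Finset.sum_Icc_succ_top (by omega), Real.exp_add]
    refine mul_le_mul ih ?_ (by positivity) (by positivity)
    have h := Real.add_one_le_exp (X (k + 1) ^ 2)
    split_ifs
    · linarith
    · have := sq_nonneg (X (k + 1))
      simp only [ne_eq, OfNat.ofNat_ne_zero, not_false_eq_true, zero_pow, add_zero]
      linarith

/-- As long as the quadratic variation is at most b, the squared modulus is at most exp(b). A single
further factor, of squared modulus 1 + X², can enter when the level is crossed, and all later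
factors equal one. Second moments of X thus suffice for the product to be in L². -/
lemma norm_stoppedProd_sq_le (X : ℕ → ℝ) {b : ℝ} (hb : 0 ≤ b) (k : ℕ) :
    ‖stoppedProd X b k‖ ^ 2 ≤ Real.exp b * (1 + ∑ r ∈ Finset.Icc 1 k, X r ^ 2) := by
  induction k with
  | zero => simpa [stoppedProd] using hb
  | succ k ih =>
    have hq : 0 ≤ ∑ r ∈ Finset.Icc 1 k, X r ^ 2 := Finset.sum_nonneg fun _ _ => sq_nonneg _
    rw [stoppedProd_succ, norm_mul, mul_pow, normSq_one_add_mul_I,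
      Finset.sum_Icc_succ_top (by omega)]
    split_ifs with h
    · have h1 := (norm_stoppedProd_sq_le_exp X b k).trans (Real.exp_le_exp.2 h)
      refine mul_le_mul h1 (by linarith) (by positivity) (by positivity)
    · simp only [ne_eq, OfNat.ofNat_ne_zero, not_false_eq_true, zero_pow, add_zero, mul_one]
      refine ih.trans (mul_le_mul_of_nonneg_left ?_ (Real.exp_pos b).le)
      have := sq_nonneg (X (k + 1))
      linarith

lemma stoppedProd_eq_prod (X : ℕ → ℝ) {b : ℝ} {n : ℕ} (h : ∑ r ∈ Finset.Icc 1 n, X r ^ 2 ≤ b) :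
    stoppedProd X b n = ∏ s ∈ Finset.Icc 1 n, (1 + (X s : ℂ) * Complex.I) := by
  refine Finset.prod_congr rfl fun s hs => ?_
  rw [if_pos]
  refine (Finset.sum_le_sum_of_subset_of_nonneg (Finset.Icc_subset_Icc_right ?_)
    fun _ _ _ => sq_nonneg _).trans h
  have := (Finset.mem_Icc.1 hs).2
  omega

lemma prod_one_add_mul_I_eq (X : ℕ → ℝ) (n : ℕ) (h : ∀ s ∈ Finset.Icc 1 n, |X s| ≤ 1 / 2) :
    ∃ ρ : ℂ, ‖ρ‖ ≤ ∑ s ∈ Finset.Icc 1 n, |X s| * X s ^ 2 ∧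
      ∏ s ∈ Finset.Icc 1 n, (1 + (X s : ℂ) * Complex.I)
        = Complex.exp (((∑ s ∈ Finset.Icc 1 n, X s : ℝ) : ℂ) * Complex.I)
          * Complex.exp (((∑ s ∈ Finset.Icc 1 n, X s ^ 2 : ℝ) : ℂ) / 2 + ρ) := by
  refine ⟨∑ s ∈ Finset.Icc 1 n, (Complex.log (1 + X s * Complex.I) - X s * Complex.I
    - ((X s ^ 2 / 2 : ℝ) : ℂ)), (norm_sum_le _ _).trans (Finset.sum_le_sum fun s hs =>
      norm_log_one_add_mul_I_sub_le (h s hs)), ?_⟩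
  rw [← Complex.exp_add]
  have he : ((∑ s ∈ Finset.Icc 1 n, X s : ℝ) : ℂ) * Complex.I
      + (((∑ s ∈ Finset.Icc 1 n, X s ^ 2 : ℝ) : ℂ) / 2
      + ∑ s ∈ Finset.Icc 1 n, (Complex.log (1 + X s * Complex.I) - X s * Complex.I
        - ((X s ^ 2 / 2 : ℝ) : ℂ))) = ∑ s ∈ Finset.Icc 1 n, Complex.log (1 + X s * Complex.I) := by
    push_cast
    rw [Finset.sum_sub_distrib, Finset.sum_sub_distrib, Finset.sum_mul, Finset.sum_div]
    ring
  rw [he, Complex.exp_sum]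
  refine Finset.prod_congr rfl fun s hs => (Complex.exp_log ?_).symm
  intro h0
  have := congrArg Complex.re h0
  simp at this

lemma measurable_stoppedProd {Ω : Type*} {m : MeasurableSpace Ω} {X : ℕ → Ω → ℝ} (b : ℝ) (k : ℕ)
    (hX : ∀ s ≤ k, Measurable[m] (X s)) :
    Measurable[m] fun ω => stoppedProd (fun s => X s ω) b k := by
  unfold stoppedProd
  refine Finset.measurable_fun_prod _ fun s hs => ?_
  have hs' := (Finset.mem_Icc.1 hs)
  refine Measurable.const_add (Measurable.mul_const (Complex.measurable_ofReal.comp ?_) _) _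
  refine Measurable.ite (measurableSet_le ?_ measurable_const) (hX s hs'.2) measurable_const
  exact Finset.measurable_fun_sum _ fun r hr =>
    (hX r (by have := (Finset.mem_Icc.1 hr).2; omega)).pow_const 2

lemma integrable_stoppedProd [IsProbabilityMeasure P] {X : ℕ → Ω → ℝ} {b : ℝ} (hb : 0 ≤ b)
    (hX : ∀ s, Measurable (X s)) (hX2 : ∀ s, Integrable (fun ω => X s ω ^ 2) P) (k : ℕ) :
    MemLp (fun ω => stoppedProd (fun s => X s ω) b k) 2 P := by
  rw [memLp_two_iff_integrable_sq_norm
    (measurable_stoppedProd b k fun s _ => hX s).aestronglyMeasurable]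
  refine Integrable.mono' (((integrable_const (1 : ℝ)).add
    (integrable_finsetSum (Finset.Icc 1 k) fun r _ => hX2 r)).const_mul (Real.exp b))
    ((measurable_stoppedProd b k fun s _ => hX s).norm.pow_const 2).aestronglyMeasurable
    (ae_of_all _ fun ω => ?_)
  rw [Real.norm_eq_abs, abs_of_nonneg (sq_nonneg _)]
  exact norm_stoppedProd_sq_le _ hb k

/-- The increment of the product is iξX_{k+1}, where ξ depends on the past and vanishes once the
product is stopped; before that it is bounded by exp(b). The orthogonality hypothesis, stated for
bounded real multipliers, applies to its real and imaginary parts. -/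
lemma integral_stoppedProd_eq_one [IsProbabilityMeasure P] {X : ℕ → Ω → ℝ} {b : ℝ} (hb : 0 ≤ b)
    (m : ℕ → MeasurableSpace Ω) (hm : ∀ t, m t ≤ ‹MeasurableSpace Ω›)
    (hX : ∀ s t, s < t → Measurable[m t] (X s)) (hX2 : ∀ s, Integrable (fun ω => X s ω ^ 2) P)
    (hmds : ∀ t, 1 ≤ t → ∀ ξ : Ω → ℝ, Measurable[m t] ξ → (∃ C, ∀ ω, |ξ ω| ≤ C) →
      ∫ ω, ξ ω * X t ω ∂P = 0) (k : ℕ) :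
    ∫ ω, stoppedProd (fun s => X s ω) b k ∂P = 1 := by
  have hXm : ∀ s, Measurable (X s) := fun s => (hX s (s + 1) (by omega)).mono (hm _) le_rfl
  have hX1 : ∀ s, MemLp (X s) 2 P := fun s =>
    (memLp_two_iff_integrable_sq (hXm s).aestronglyMeasurable).2 (hX2 s)
  induction k with
  | zero => simp [stoppedProd]
  | succ k ih =>
    set ξ : Ω → ℂ := fun ω => if ∑ r ∈ Finset.Icc 1 k, X r ω ^ 2 ≤ b then
      stoppedProd (fun s => X s ω) b k else 0 with hξ
    have hξm : Measurable[m (k + 1)] ξ := by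
      refine Measurable.ite (measurableSet_le ?_ measurable_const)
        (measurable_stoppedProd b k fun s hs => hX s _ (by omega)) measurable_const
      exact Finset.measurable_fun_sum _ fun r hr =>
        (hX r _ (by have := (Finset.mem_Icc.1 hr).2; omega)).pow_const 2
    have hξb : ∀ ω, ‖ξ ω‖ ≤ Real.exp b := by
      intro ω
      simp only [hξ]
      split_ifs with h
      · have h1 := (norm_stoppedProd_sq_le_exp (fun s => X s ω) b k).trans (Real.exp_le_exp.2 h)
        have h2 := Real.one_le_exp hb
        nlinarith [norm_nonneg (stoppedProd (fun s => X s ω) b k)]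
      · simpa using (Real.exp_pos b).le
    have hre := hmds (k + 1) (by omega) (fun ω => (ξ ω).re) (Complex.measurable_re.comp hξm)
      ⟨Real.exp b, fun ω => (Complex.abs_re_le_norm _).trans (hξb ω)⟩
    have him := hmds (k + 1) (by omega) (fun ω => (ξ ω).im) (Complex.measurable_im.comp hξm)
      ⟨Real.exp b, fun ω => (Complex.abs_im_le_norm _).trans (hξb ω)⟩
    have hX1i : Integrable (X (k + 1)) P := (hX1 (k + 1)).integrable one_le_two
    have hξX : Integrable (fun ω => ξ ω * (X (k + 1) ω : ℂ)) P :=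
      hX1i.ofReal.bdd_mul (hξm.mono (hm _) le_rfl).aestronglyMeasurable (ae_of_all _ hξb)
    have h0 : ∫ ω, ξ ω * (X (k + 1) ω : ℂ) ∂P = 0 := by
      apply Complex.ext
      · have := integral_re hξX
        simp only [RCLike.re_eq_complex_re] at this
        rw [← this, Complex.zero_re, ← hre]
        exact integral_congr_ae (ae_of_all _ fun ω => by simp)
      · have := integral_im hξX
        simp only [RCLike.im_eq_complex_im] at this
        rw [← this, Complex.zero_im, ← him]
        exact integral_congr_ae (ae_of_all _ fun ω => by simp)
    have he : ∀ ω, stoppedProd (fun s => X s ω) b (k + 1)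
        = stoppedProd (fun s => X s ω) b k + ξ ω * (X (k + 1) ω : ℂ) * Complex.I := by
      intro ω
      rw [stoppedProd_succ]
      simp only [hξ]
      split_ifs
      · ring
      · simp
    simp_rw [he]
    rw [integral_add ((integrable_stoppedProd hb hXm hX2 k).integrable one_le_two)
      (hξX.mul_const _), ih, integral_mul_const, h0]
    simp

/-- The central limit theorem for square integrable stationary ergodic martingale differences, in
terms of characteristic functions. -/
theorem tendsto_integral_exp_martingale [IsProbabilityMeasure P] [IsProbabilityMeasure μ]
    (hT : Ergodic T μ)
    (hτ : ∀ t, MeasurePreserving (τ t) P μ) (hTτ : ∀ t ω, τ (t + 1) ω = T (τ t ω))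
    {φ : S → ℝ} (hφ : MemLp φ 2 μ)
    (m : ℕ → MeasurableSpace Ω) (hm : ∀ t, m t ≤ ‹MeasurableSpace Ω›)
    (hadapt : ∀ s t, s < t → Measurable[m t] fun ω => φ (τ s ω))
    (hmds : ∀ t, 1 ≤ t → ∀ ξ : Ω → ℝ, Measurable[m t] ξ → (∃ C, ∀ ω, |ξ ω| ≤ C) →
      ∫ ω, ξ ω * φ (τ t ω) ∂P = 0) :
    Tendsto (fun n : ℕ => ∫ ω, Complex.exp
      ((((Real.sqrt n)⁻¹ * ∑ t ∈ Finset.Icc 1 n, φ (τ t ω) : ℝ) : ℂ) * Complex.I) ∂P) atTop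
      (𝓝 (Complex.exp (-((∫ s, φ s ^ 2 ∂μ : ℝ) : ℂ) / 2))) := by
  set σ : ℝ := ∫ s, φ s ^ 2 ∂μ with hσ
  have hσ0 : 0 ≤ σ := integral_nonneg fun _ => sq_nonneg _
  -- The stopping level σ + 1 is strictly above the limit σ of the quadratic variation, so that no
  -- factor is stopped with probability tending to one.
  have hb : (0 : ℝ) ≤ σ + 1 := by linarith
  set X : ℕ → ℕ → Ω → ℝ := fun n t ω => (Real.sqrt n)⁻¹ * φ (τ t ω) with hX
  have hφτ : ∀ t, Integrable (fun ω => φ (τ t ω) ^ 2) P := fun t =>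
    (hτ t).integrable_comp_of_integrable (g := fun s => φ s ^ 2) hφ.integrable_sq
  have hXad : ∀ n s t, s < t → Measurable[m t] (X n s) := fun n s t h =>
    (hadapt s t h).const_mul _
  have hXm : ∀ n s, Measurable (X n s) := fun n s => (hXad n s (s + 1) (by omega)).mono (hm _) le_rfl
  have hX2e : ∀ n t ω, X n t ω ^ 2 = (n : ℝ)⁻¹ * φ (τ t ω) ^ 2 := by
    intro n t ω
    simp only [hX]
    rw [mul_pow, inv_pow, Real.sq_sqrt (Nat.cast_nonneg n)]
  have hX2 : ∀ n s, Integrable (fun ω => X n s ω ^ 2) P := by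
    intro n s
    simp only [hX2e]
    exact (hφτ s).const_mul _
  have hXmds : ∀ n t, 1 ≤ t → ∀ ξ : Ω → ℝ, Measurable[m t] ξ → (∃ C, ∀ ω, |ξ ω| ≤ C) →
      ∫ ω, ξ ω * X n t ω ∂P = 0 := by
    intro n t ht ξ hξ hξb
    have h := hmds t ht ξ hξ hξb
    have : ∀ ω, ξ ω * X n t ω = (Real.sqrt n)⁻¹ * (ξ ω * φ (τ t ω)) := fun ω => by
      simp only [hX]; ring
    simp only [this]
    rw [integral_const_mul, h, mul_zero]
  set D : ℕ → Ω → ℂ := fun n ω => stoppedProd (fun s => X n s ω) (σ + 1) n with hD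
  have hD1 : ∀ n, ∫ ω, D n ω ∂P = 1 := fun n =>
    integral_stoppedProd_eq_one hb m hm (hXad n) (hX2 n) (hXmds n) n
  have hDL : ∀ n, MemLp (D n) 2 P := fun n => integrable_stoppedProd hb (hXm n) (hX2 n) n
  set E : ℕ → Ω → ℂ := fun n ω =>
    Complex.exp (((∑ t ∈ Finset.Icc 1 n, X n t ω : ℝ) : ℂ) * Complex.I) with hE
  have hEm : ∀ n, Measurable (E n) := fun n =>
    Complex.measurable_exp.comp ((Complex.measurable_ofReal.comp
      (Finset.measurable_fun_sum _ fun t _ => hXm n t)).mul_const _)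
  have hE1 : ∀ n ω, ‖E n ω‖ = 1 := fun n ω => Complex.norm_exp_ofReal_mul_I _
  have hEL : ∀ n, MemLp (E n) 2 P := fun n =>
    MemLp.of_bound (hEm n).aestronglyMeasurable 1 (ae_of_all _ fun ω => (hE1 n ω).le)
  set c : ℂ := Complex.exp (-(σ : ℂ) / 2) with hc
  have hc1 : ‖c‖ ≤ 1 := by
    rw [hc, Complex.norm_exp]
    have : (-(σ : ℂ) / 2).re = -σ / 2 := by simp
    rw [this]
    exact Real.exp_le_one_iff.2 (by linarith)
  -- Since E D = 1, the error E[exp(iS)] - c equals E[exp(iS) - cD]. The integrand tends to zero in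
  -- probability, because D is exp(iS + σ/2 + o(1)), and it is bounded in L²; hence its mean tends
  -- to zero.
  set V : ℕ → Ω → ℝ := fun n ω => ‖E n ω - c * D n ω‖ with hV
  have hVL : ∀ n, MemLp (V n) 2 P := fun n => ((hEL n).sub ((hDL n).const_mul c)).norm
  have hQ : Tendsto (fun x : ℕ × Ω => ∑ t ∈ Finset.Icc 1 x.1, X x.1 t x.2 ^ 2) (whp P) (𝓝 σ) := by
    refine (tendsto_average_whp_of_integrable hT hτ hTτ hφ.integrable_sq).congr fun x => ?_
    simp only [hX2e, Finset.mul_sum]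
  have hVlim : Tendsto (fun x : ℕ × Ω => V x.1 x.2) (whp P) (𝓝 0) := by
    -- The Lindeberg condition: the maximum of n terms φ² is o(n), as φ² is integrable.
    have hmax : ∀ ε : ℝ, 0 < ε → ∀ᶠ x in whp P, ∀ t ∈ Finset.Icc 1 x.1, |X x.1 t x.2| ≤ ε := by
      intro ε hε
      filter_upwards [eventually_whp_forall_le hτ hφ.integrable_sq (ε := ε ^ 2) (by positivity)]
        with x hx t ht
      refine abs_le_of_sq_le_sq ?_ hε.le
      have hn : (0 : ℝ) < x.1 := by
        have := Finset.mem_Icc.1 ht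
        exact_mod_cast (by omega : 0 < x.1)
      rw [hX2e, inv_mul_le_iff₀ hn]
      linarith [hx t ht]
    have hex : ∀ x : ℕ × Ω, ∃ ρ : ℂ, (∀ t ∈ Finset.Icc 1 x.1, |X x.1 t x.2| ≤ 1 / 2) →
        ‖ρ‖ ≤ ∑ s ∈ Finset.Icc 1 x.1, |X x.1 s x.2| * X x.1 s x.2 ^ 2 ∧
        ∏ s ∈ Finset.Icc 1 x.1, (1 + (X x.1 s x.2 : ℂ) * Complex.I)
          = E x.1 x.2 * Complex.exp
            (((∑ s ∈ Finset.Icc 1 x.1, X x.1 s x.2 ^ 2 : ℝ) : ℂ) / 2 + ρ) := by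
      intro x
      by_cases h : ∀ t ∈ Finset.Icc 1 x.1, |X x.1 t x.2| ≤ 1 / 2
      · obtain ⟨ρ, hρ⟩ := prod_one_add_mul_I_eq (fun t => X x.1 t x.2) x.1 h
        exact ⟨ρ, fun _ => hρ⟩
      · exact ⟨0, fun h' => absurd h' h⟩
    choose ρ hρ using hex
    have hρ0 : Tendsto ρ (whp P) (𝓝 0) := by
      rw [Metric.tendsto_nhds]
      intro ε hε
      filter_upwards [hmax (min (1 / 2) (ε / (σ + 2))) (by positivity),
        hQ.eventually_lt_const (show σ < σ + 1 by linarith)] with x h1 h2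
      have h3 := (hρ x fun t ht => (h1 t ht).trans (min_le_left _ _)).1
      rw [dist_zero_right]
      calc ‖ρ x‖ ≤ _ := h3
        _ ≤ ∑ s ∈ Finset.Icc 1 x.1, ε / (σ + 2) * X x.1 s x.2 ^ 2 :=
          Finset.sum_le_sum fun s hs => mul_le_mul_of_nonneg_right
            ((h1 s hs).trans (min_le_right _ _)) (sq_nonneg _)
        _ = ε / (σ + 2) * ∑ s ∈ Finset.Icc 1 x.1, X x.1 s x.2 ^ 2 := by rw [Finset.mul_sum]
        _ ≤ ε / (σ + 2) * (σ + 1) := mul_le_mul_of_nonneg_left h2.le (by positivity)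
        _ < ε := by
          rw [div_mul_eq_mul_div, div_lt_iff₀ (by linarith)]
          nlinarith
    have hlim : Tendsto (fun x : ℕ × Ω => ‖1 - c * Complex.exp
        (((∑ s ∈ Finset.Icc 1 x.1, X x.1 s x.2 ^ 2 : ℝ) : ℂ) / 2 + ρ x)‖) (whp P) (𝓝 0) := by
      have h1 : Tendsto (fun x : ℕ × Ω => ((∑ s ∈ Finset.Icc 1 x.1, X x.1 s x.2 ^ 2 : ℝ) : ℂ) / 2
          + ρ x) (whp P) (𝓝 ((σ : ℂ) / 2 + 0)) :=
        (((Complex.continuous_ofReal.tendsto σ).comp hQ).div_const 2).add hρ0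
      have h2 := (((Complex.continuous_exp.tendsto _).comp h1).const_mul c).const_sub 1
      have h3 := h2.norm
      have h4 : c * Complex.exp ((σ : ℂ) / 2 + 0) = 1 := by
        rw [hc, ← Complex.exp_add]
        simp [neg_div]
      rw [h4, sub_self, norm_zero] at h3
      exact h3
    refine hlim.congr' ?_
    filter_upwards [hmax (1 / 2) (by norm_num),
      hQ.eventually_le_const (show σ < σ + 1 by linarith)] with x h1 h2
    have h3 := (hρ x h1).2
    simp only [hV, hD]
    rw [stoppedProd_eq_prod _ h2, h3]
    have : E x.1 x.2 - c * (E x.1 x.2 * Complex.exp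
        (((∑ s ∈ Finset.Icc 1 x.1, X x.1 s x.2 ^ 2 : ℝ) : ℂ) / 2 + ρ x))
        = E x.1 x.2 * (1 - c * Complex.exp
          (((∑ s ∈ Finset.Icc 1 x.1, X x.1 s x.2 ^ 2 : ℝ) : ℂ) / 2 + ρ x)) := by ring
    rw [this, norm_mul, hE1, one_mul]
  -- The bound is uniform in n because the expected quadratic variation is at most σ.
  have hVC : ∀ n, ∫ ω, V n ω ^ 2 ∂P ≤ 2 * (1 + Real.exp (σ + 1) * (1 + σ)) := by
    intro n
    have hle : ∀ ω, V n ω ^ 2 ≤ 2 * (1 + Real.exp (σ + 1) *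
        (1 + ∑ r ∈ Finset.Icc 1 n, X n r ω ^ 2)) := by
      intro ω
      have h1 : V n ω ≤ 1 + ‖D n ω‖ := by
        refine (norm_sub_le _ _).trans ?_
        rw [hE1, norm_mul]
        have := mul_le_mul_of_nonneg_right hc1 (norm_nonneg (D n ω))
        linarith
      have h2 := norm_stoppedProd_sq_le (fun s => X n s ω) hb n
      have h0 : 0 ≤ V n ω := norm_nonneg _
      have h3 : V n ω ^ 2 ≤ (1 + ‖D n ω‖) ^ 2 := pow_le_pow_left₀ h0 h1 2
      have h4 := sq_nonneg (1 - ‖D n ω‖)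
      have h5 : ‖D n ω‖ ^ 2 ≤ Real.exp (σ + 1) * (1 + ∑ r ∈ Finset.Icc 1 n, X n r ω ^ 2) := h2
      nlinarith
    have hsi : Integrable (fun ω => ∑ r ∈ Finset.Icc 1 n, X n r ω ^ 2) P :=
      integrable_finsetSum _ fun r _ => hX2 n r
    have hsum : ∫ ω, ∑ r ∈ Finset.Icc 1 n, X n r ω ^ 2 ∂P ≤ σ := by
      rw [integral_finsetSum _ fun r _ => hX2 n r]
      have : ∀ r, ∫ ω, X n r ω ^ 2 ∂P = (n : ℝ)⁻¹ * σ := by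
        intro r
        simp only [hX2e]
        rw [integral_const_mul]
        have h1 := integral_map (hτ r).aemeasurable (f := fun s => φ s ^ 2)
          ((hτ r).map_eq.symm ▸ hφ.integrable_sq.aestronglyMeasurable)
        rw [(hτ r).map_eq] at h1
        rw [hσ, h1]
      simp only [this, Finset.sum_const, Nat.card_Icc, Nat.add_sub_cancel, nsmul_eq_mul]
      rcases eq_or_ne n 0 with rfl | hn
      · simpa using hσ0
      · have : (n : ℝ) ≠ 0 := by exact_mod_cast hn
        field_simp
        exact le_rfl
    have hci : Integrable (fun ω => 2 * (1 + Real.exp (σ + 1) *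
        (1 + ∑ r ∈ Finset.Icc 1 n, X n r ω ^ 2))) P :=
      ((integrable_const _).add (((integrable_const _).add hsi).const_mul _)).const_mul _
    have hsi1 : Integrable (fun ω => 1 + ∑ r ∈ Finset.Icc 1 n, X n r ω ^ 2) P :=
      (integrable_const _).add hsi
    refine (integral_mono (hVL n).integrable_sq hci hle).trans ?_
    rw [integral_const_mul, integral_add (integrable_const _) (hsi1.const_mul _),
      integral_const_mul, integral_add (integrable_const _) hsi]
    simp only [integral_const, probReal_univ, smul_eq_mul, mul_one]
    have := Real.exp_pos (σ + 1)
    gcongr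
  have hVint := tendsto_integral_zero_of_whp hVL (fun n ω => norm_nonneg _) hVC hVlim
  rw [tendsto_iff_norm_sub_tendsto_zero]
  refine squeeze_zero (fun _ => norm_nonneg _) (fun n => ?_) hVint
  have h1 : ∫ ω, (E n ω - c * D n ω) ∂P = ∫ ω, E n ω ∂P - c := by
    rw [integral_sub ((hEL n).integrable one_le_two) (((hDL n).integrable one_le_two).const_mul c),
      integral_const_mul, hD1, mul_one]
  have h2 : ∫ ω, Complex.exp
      ((((Real.sqrt n)⁻¹ * ∑ t ∈ Finset.Icc 1 n, φ (τ t ω) : ℝ) : ℂ) * Complex.I) ∂P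
      = ∫ ω, E n ω ∂P := by
    simp only [hE, hX, Finset.mul_sum]
  rw [h2, ← h1]
  exact norm_integral_le_integral_norm _

end MartingaleCLT

/-! ### Second order Taylor expansion -/

section Taylor

variable {E : Type*} [NormedAddCommGroup E] [NormedSpace ℝ E]

/-- Taylor's formula of order two at `a`, with a bound of the remainder by the variation of the
second derivative from a bilinear map `L`. -/
lemma abs_taylor_two_le {g : E → ℝ} {a b : E} (hg : ∀ z ∈ segment ℝ a b, ContDiffAt ℝ 2 g z)
    (L : E →L[ℝ] E →L[ℝ] ℝ) {M : ℝ}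
    (hM : ∀ z ∈ segment ℝ a b,
      |fderiv ℝ (fderiv ℝ g) z (b - a) (b - a) - L (b - a) (b - a)| ≤ M) :
    |g b - g a - fderiv ℝ g a (b - a) - 1 / 2 * L (b - a) (b - a)| ≤ M := by
  set v := b - a with hv
  have hM0 : 0 ≤ M := (abs_nonneg _).trans (hM a (left_mem_segment ℝ a b))
  have hseg : ∀ s ∈ Set.Icc (0 : ℝ) 1, a + s • v ∈ segment ℝ a b := by
    intro s hs
    rw [segment_eq_image']
    exact ⟨s, hs, rfl⟩
  have hline : ∀ s : ℝ, HasDerivAt (fun s : ℝ => a + s • v) v s := fun s => by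
    simpa using ((hasDerivAt_id s).smul_const v).const_add a
  have hd1 : ∀ s ∈ Set.Icc (0 : ℝ) 1,
      HasDerivAt (fun s : ℝ => g (a + s • v)) (fderiv ℝ g (a + s • v) v) s := fun s hs =>
    (((hg _ (hseg s hs)).differentiableAt (by norm_num)).hasFDerivAt).comp_hasDerivAt s (hline s)
  have hd2 : ∀ s ∈ Set.Icc (0 : ℝ) 1,
      HasDerivAt (fun s : ℝ => fderiv ℝ g (a + s • v) v)
        (fderiv ℝ (fderiv ℝ g) (a + s • v) v v) s := by
    intro s hs
    have h1 : DifferentiableAt ℝ (fderiv ℝ g) (a + s • v) :=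
      ((hg _ (hseg s hs)).fderiv_right (m := 1) (by norm_num)).differentiableAt (by norm_num)
    have h2 := h1.hasFDerivAt.comp_hasDerivAt s (hline s)
    exact h2.clm_apply (hasDerivAt_const s v) |>.congr_deriv (by simp)
  -- The mean value inequality is used twice on [0, 1], first for the derivative along the segment
  -- and then for the function, each time after subtracting the expected polynomial. The factor 1/2
  -- that could be gained in the remainder is dropped.
  have hb1 : ∀ s ∈ Set.Icc (0 : ℝ) 1,
      |fderiv ℝ g (a + s • v) v - fderiv ℝ g a v - s * L v v| ≤ M := by
    intro s hs
    have h := Convex.norm_image_sub_le_of_norm_hasDerivWithin_le (𝕜 := ℝ)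
      (f := fun r : ℝ => fderiv ℝ g (a + r • v) v - r * L v v)
      (f' := fun r => fderiv ℝ (fderiv ℝ g) (a + r • v) v v - 1 * L v v) (C := M)
      (s := Set.Icc 0 1) (x := 0) (y := s)
      (fun r hr => ((hd2 r hr).sub ((hasDerivAt_id r).mul_const _)).hasDerivWithinAt)
      (fun r hr => by
        rw [one_mul]
        exact hM _ (hseg r hr))
      (convex_Icc 0 1) ⟨le_rfl, zero_le_one⟩ hs
    simp only [zero_smul, add_zero, zero_mul, sub_zero, Real.norm_eq_abs] at h
    have h2 : M * |s| ≤ M := by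
      rw [abs_of_nonneg hs.1]
      exact mul_le_of_le_one_right hM0 hs.2
    refine le_trans (le_of_eq ?_) (h.trans h2)
    congr 1
    ring
  have h := norm_image_sub_le_of_norm_deriv_le_segment_01' (C := M)
    (f := fun s : ℝ => g (a + s • v) - s * fderiv ℝ g a v - s ^ 2 / 2 * L v v)
    (f' := fun s => fderiv ℝ g (a + s • v) v - 1 * fderiv ℝ g a v - s * L v v)
    (fun s hs => by
      have h1 : HasDerivAt (fun s : ℝ => s ^ 2 / 2) s s := by
        have := (hasDerivAt_pow 2 s).div_const 2
        simpa using this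
      exact (((hd1 s hs).sub ((hasDerivAt_id s).mul_const _)).sub
        (h1.mul_const _)).hasDerivWithinAt)
    (fun s hs => by
      rw [one_mul]
      exact hb1 s ⟨hs.1, hs.2.le⟩)
  simp only [one_smul, zero_smul, add_zero, Real.norm_eq_abs] at h
  refine le_trans (le_of_eq ?_) h
  congr 1
  have : a + v = b := by rw [hv]; abel
  rw [this]
  ring

lemma eventually_norm_sub_lt_of_contDiffAt {F : Type*} [NormedAddCommGroup F] [NormedSpace ℝ F]
    {g : E → F} {a : E} (hg : ContDiffAt ℝ 0 g a) {ε : ℝ} (hε : 0 < ε) :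
    ∀ᶠ z in 𝓝 a, ‖g z - g a‖ < ε :=
  (tendsto_iff_norm_sub_tendsto_zero.1 hg.continuousAt.tendsto).eventually_lt_const hε

lemma tendsto_taylor_two_div {g : E → ℝ} {a : E} (hg : ContDiffAt ℝ 2 g a) :
    Tendsto (fun z => (g z - g a - fderiv ℝ g a (z - a)
      - 1 / 2 * fderiv ℝ (fderiv ℝ g) a (z - a) (z - a)) / ‖z - a‖ ^ 2) (𝓝 a) (𝓝 0) := by
  rw [Metric.tendsto_nhds]
  intro ε hε
  have h1' := eventually_norm_sub_lt_of_contDiffAt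
    ((hg.fderiv_right (m := 1) (by norm_num)).fderiv_right (m := 0) (by norm_num)) (half_pos hε)
  have h2 := (hg.eventually (by simp)).and h1'
  obtain ⟨δ, hδ, h3⟩ := Metric.eventually_nhds_iff_ball.1 h2
  filter_upwards [Metric.ball_mem_nhds a hδ] with z hz
  have hseg : segment ℝ a z ⊆ Metric.ball a δ :=
    (convex_ball a δ).segment_subset (Metric.mem_ball_self hδ) hz
  have h4 := abs_taylor_two_le (b := z) (fun w hw => (h3 w (hseg hw)).1)
    (fderiv ℝ (fderiv ℝ g) a) (M := ε / 2 * ‖z - a‖ ^ 2) (fun w hw => by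
      have h5 := (h3 w (hseg hw)).2
      have h6 := (fderiv ℝ (fderiv ℝ g) w - fderiv ℝ (fderiv ℝ g) a).le_opNorm₂ (z - a) (z - a)
      simp only [sub_apply, Real.norm_eq_abs] at h6
      refine h6.trans ?_
      rw [mul_assoc, ← sq]
      gcongr)
  rw [Real.dist_eq, sub_zero, abs_div, abs_of_nonneg (sq_nonneg ‖z - a‖)]
  -- At z = a the quotient is 0/0 = 0, so the full neighbourhood filter can be used.
  rcases eq_or_ne ‖z - a‖ 0 with h0 | h0
  · simp [h0, hε]
  · have h7 : 0 < ‖z - a‖ ^ 2 := by positivity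
    rw [div_lt_iff₀ h7]
    nlinarith

end Taylor

/-! ### Measurable local moduli of continuity -/

section Modulus

variable {X : Type*} [MeasurableSpace X] {E : Type*} [PseudoMetricSpace E] [SecondCountableTopology E]

/-- A family of functions that vanishes at `θ₀` continuously, uniformly bounded for each value of
the second argument, is dominated near `θ₀` by measurable functions that tend to zero. -/
lemma exists_measurable_modulus {A : Set E} {θ₀ : E} {φ : E → X → ℝ} {G : Set X} {W : X → ℝ}
    (hG : MeasurableSet G)
    (hm : ∀ θ ∈ A, Measurable (φ θ)) (hc : ∀ x, ContinuousOn (fun θ => φ θ x) A)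
    (hW : ∀ x ∈ G, ∀ θ ∈ A, |φ θ x| ≤ W x) (hW0 : ∀ x, 0 ≤ W x)
    (hlim : ∀ x, Tendsto (fun θ => φ θ x) (𝓝[A] θ₀) (𝓝 0)) :
    ∃ ω : ℕ → X → ℝ, (∀ k, Measurable (ω k)) ∧ (∀ k x, 0 ≤ ω k x) ∧ (∀ k x, ω k x ≤ W x) ∧
      (∀ x, Tendsto (fun k => ω k x) atTop (𝓝 0)) ∧
      ∀ k : ℕ, ∀ x ∈ G, ∀ θ ∈ A, dist θ θ₀ < 1 / ((k : ℝ) + 1) → |φ θ x| ≤ ω k x := by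
  -- A supremum over the whole ball need not be measurable. It is taken over a countable dense
  -- subset, and continuity in θ extends the bound to the ball.
  have hsep : ∀ k : ℕ, ∃ T : Set E, T.Countable ∧ T ⊆ A ∩ Metric.ball θ₀ (1 / ((k : ℝ) + 1)) ∧
      A ∩ Metric.ball θ₀ (1 / ((k : ℝ) + 1)) ⊆ closure T := fun k => by
    obtain ⟨T, hTA, hTc, hTd⟩ := TopologicalSpace.IsSeparable.exists_countable_dense_subset
      (TopologicalSpace.IsSeparable.of_separableSpace (A ∩ Metric.ball θ₀ (1 / ((k : ℝ) + 1))))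
    exact ⟨T, hTc, hTA, hTd⟩
  choose T hTc hTA hTd using hsep
  have hbdd : ∀ k x, BddAbove (Set.range fun θ : T k => G.indicator (fun x => |φ θ x|) x) := by
    intro k x
    refine ⟨W x, ?_⟩
    rintro _ ⟨θ, rfl⟩
    by_cases hx : x ∈ G
    · simp only [Set.indicator_of_mem hx]
      exact hW x hx _ (hTA k θ.2).1
    · simp only [Set.indicator_of_notMem hx]
      exact hW0 x
  have hnn : ∀ k x, 0 ≤ ⨆ θ : T k, G.indicator (fun x => |φ θ x|) x := fun k x =>
    Real.iSup_nonneg fun θ => Set.indicator_nonneg (fun _ _ => abs_nonneg _) _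
  refine ⟨fun k x => ⨆ θ : T k, G.indicator (fun x => |φ θ x|) x, fun k => ?_, hnn, fun k x => ?_,
    fun x => ?_, fun k x hx θ hθ hd => ?_⟩
  · have := (hTc k).to_subtype
    refine Measurable.iSup fun θ => Measurable.indicator ?_ hG
    exact (hm _ (hTA k θ.2).1).abs
  · refine Real.iSup_le (fun θ => ?_) (hW0 x)
    by_cases hx : x ∈ G
    · simp only [Set.indicator_of_mem hx]
      exact hW x hx _ (hTA k θ.2).1
    · simp only [Set.indicator_of_notMem hx]
      exact hW0 x
  · rw [Metric.tendsto_atTop]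
    intro ε hε
    have h1 := Metric.tendsto_nhds.1 (hlim x) (ε / 2) (by positivity)
    obtain ⟨δ, hδ, h2⟩ := Metric.mem_nhdsWithin_iff.1 h1
    obtain ⟨N, hN⟩ := exists_nat_one_div_lt hδ
    refine ⟨N, fun k hk => ?_⟩
    rw [Real.dist_eq, sub_zero, abs_of_nonneg (hnn k x)]
    refine lt_of_le_of_lt (Real.iSup_le (fun θ => ?_) (by positivity)) (half_lt_self hε)
    refine (Set.indicator_le_self' (fun _ _ => abs_nonneg _) x).trans ?_
    have h3 := hTA k θ.2
    have h4 : (θ : E) ∈ Metric.ball θ₀ δ := by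
      refine Metric.mem_ball.2 ((Metric.mem_ball.1 h3.2).trans_le (le_trans ?_ hN.le))
      exact Nat.one_div_le_one_div hk
    have h5 : dist (φ θ x) 0 < ε / 2 := h2 ⟨h4, h3.1⟩
    rw [Real.dist_eq, sub_zero] at h5
    exact h5.le
  · have hθ' : θ ∈ A ∩ Metric.ball θ₀ (1 / ((k : ℝ) + 1)) := ⟨hθ, hd⟩
    have hcw : ContinuousWithinAt (fun θ => |φ θ x|) (T k) θ :=
      ((hc x).abs θ hθ).mono fun z hz => (hTA k hz).1
    refine hcw.closure_le (hTd k hθ') continuousWithinAt_const fun z hz => ?_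
    have := le_ciSup (hbdd k x) ⟨z, hz⟩
    simpa only [Set.indicator_of_mem hx] using this

end Modulus

/-! ### The observed past and the weight of the unobserved times -/

section Truncation

/-- The past in which the observations before time `1` are replaced by zero, when the present is
the time `t`. -/
def trunc (t : ℕ) (y : ℕ → ℕ) : ℕ → ℕ := fun k => if k + 2 ≤ t then y k else 0

/-- The contribution of the times before `1` to the Lipschitz sum, when the present is `t`. -/
noncomputable def tailSum (α : ℕ → ℝ≥0) (t : ℕ) (y : ℕ → ℕ) : ℝ≥0∞ :=
  ∑' k : ℕ, (α (k + 1) : ℝ≥0∞) * (if k + 2 ≤ t then 0 else (y k : ℝ≥0∞))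

variable {α : ℕ → ℝ≥0} {y : ℕ → ℕ}

lemma measurable_trunc (t : ℕ) : Measurable (trunc t) := by
  refine measurable_pi_lambda _ fun k => ?_
  unfold trunc
  split_ifs
  · exact measurable_pi_apply k
  · exact measurable_const

lemma measurable_tailSum (α : ℕ → ℝ≥0) (t : ℕ) : Measurable (tailSum α t) := by
  refine Measurable.tsum fun k => Measurable.const_mul ?_ _
  split_ifs
  · exact measurable_const
  · exact (measurable_from_nat (f := fun n : ℕ => (n : ℝ≥0∞))).comp (measurable_pi_apply k)

lemma tailSum_le_tailSum_zero (α : ℕ → ℝ≥0) (t : ℕ) (y : ℕ → ℕ) :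
    tailSum α t y ≤ tailSum α 0 y := by
  refine ENNReal.tsum_le_tsum fun k => ?_
  gcongr
  simp only [nonpos_iff_eq_zero, Nat.add_eq_zero_iff, OfNat.ofNat_ne_zero, and_false, if_false]
  split_ifs <;> simp

lemma tendsto_tailSum (hy : tailSum α 0 y ≠ ∞) :
    Tendsto (fun t => (tailSum α t y).toReal) atTop (𝓝 0) := by
  have h0 : tailSum α 0 y = ∑' k : ℕ, (α (k + 1) : ℝ≥0∞) * (y k : ℝ≥0∞) := by
    simp [tailSum]
  have hs : Summable fun k : ℕ => ((α (k + 1) : ℝ≥0∞) * (y k : ℝ≥0∞)).toReal :=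
    ENNReal.summable_toReal (h0 ▸ hy)
  have h := tendsto_tsum_of_dominated_convergence (𝓕 := atTop)
    (f := fun (t : ℕ) (k : ℕ) =>
      ((α (k + 1) : ℝ≥0∞) * (if k + 2 ≤ t then 0 else (y k : ℝ≥0∞))).toReal)
    (g := fun _ => (0 : ℝ)) hs (fun k => by
      refine tendsto_const_nhds.congr' ?_
      filter_upwards [eventually_ge_atTop (k + 2)] with t ht
      simp [ht]) (Eventually.of_forall fun t k => by
      rw [Real.norm_eq_abs, abs_of_nonneg ENNReal.toReal_nonneg]
      split_ifs
      · simp only [mul_zero, ENNReal.toReal_zero, ENNReal.toReal_nonneg]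
      · exact le_rfl)
  rw [tsum_zero] at h
  refine h.congr fun t => ?_
  rw [tailSum, ENNReal.tsum_toReal_eq]
  intro k
  split_ifs
  · simp
  · exact ENNReal.mul_ne_top ENNReal.coe_ne_top (ENNReal.natCast_ne_top _)

lemma tailSum_toReal_le (hy : tailSum α 0 y ≠ ∞) (t : ℕ) :
    (tailSum α t y).toReal ≤ (tailSum α 0 y).toReal :=
  ENNReal.toReal_mono hy (tailSum_le_tailSum_zero α t y)

end Truncation

/-! ### The parametric family: envelope, linearization, measurability -/

/-- A parametric family of functions of the past that is smooth in the parameter, with Lipschitz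
derivatives with respect to the past, and bounded from below. -/
structure IsRegularFamily {d : ℕ} (f : Param d → (ℕ → ℕ) → ℝ) (Θ : Set (Param d)) (θ₀ : Param d)
    (α : ℕ → ℝ≥0) (c C : ℝ) : Prop where
  measurable : ∀ θ, Measurable (f θ)
  isCompact : IsCompact Θ
  mem : θ₀ ∈ Θ
  contDiffAt : ∀ y, ∀ θ ∈ Θ, ContDiffAt ℝ 2 (fun ϑ => f ϑ y) θ
  lipschitz : ∀ i : Fin 3, DerivLipschitz f Θ i α
  pos : 0 < c
  lower : ∀ θ ∈ Θ, ∀ y, c ≤ f θ y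
  bound : ∀ i : Fin 3, ∀ θ ∈ Θ, ‖iteratedFDeriv ℝ i (fun ϑ => f ϑ 0) θ‖ ≤ C

/-- The dominating function of the family and of its first two derivatives. -/
noncomputable def envelope (α : ℕ → ℝ≥0) (C : ℝ) (y : ℕ → ℕ) : ℝ := C + (tailSum α 0 y).toReal

lemma DerivLipschitz.mono {d : ℕ} {f : Param d → (ℕ → ℕ) → ℝ} {Θ : Set (Param d)} {i : ℕ}
    {α β : ℕ → ℝ≥0} (h : DerivLipschitz f Θ i α) (hαβ : ∀ k, α k ≤ β k) :
    DerivLipschitz f Θ i β := fun y y' θ hθ =>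
  (h y y' θ hθ).trans (ENNReal.tsum_le_tsum fun k => by
    gcongr
    exact hαβ _)

/-- Compactness of Θ bounds the derivatives at the zero past. The sum of the three coefficient
sequences serves for all orders of differentiation at once, so that a single tail sum and a single
envelope control everything. -/
lemma exists_isRegularFamily {d : ℕ} {f : Param d → (ℕ → ℕ) → ℝ} {Θ : Set (Param d)}
    {θ₀ : Param d} {α : Fin 3 → ℕ → ℝ≥0} {c : ℝ} (hf : ∀ θ, Measurable (f θ)) (hΘ : IsCompact Θ)
    (hθ₀ : θ₀ ∈ Θ) (hsmooth : ∀ y, ∀ θ ∈ Θ, ContDiffAt ℝ 2 (fun ϑ => f ϑ y) θ)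
    (hlip : ∀ i : Fin 3, DerivLipschitz f Θ i (α i)) (hc : 0 < c) (hlow : ∀ θ ∈ Θ, ∀ y, c ≤ f θ y) :
    ∃ C, IsRegularFamily f Θ θ₀ (fun k => ∑ i, α i k) c C := by
  have hb : ∀ i : Fin 3, ∃ C : ℝ, ∀ θ ∈ Θ, ‖iteratedFDeriv ℝ i (fun ϑ => f ϑ 0) θ‖ ≤ C := by
    intro i
    refine hΘ.exists_bound_of_continuousOn fun θ hθ => ?_
    refine ((hsmooth 0 θ hθ).continuousAt_iteratedFDeriv (k := i) ?_).continuousWithinAt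
    have : (i : ℕ) ≤ 2 := by omega
    exact_mod_cast this
  choose C hC using hb
  refine ⟨∑ i, |C i|, hf, hΘ, hθ₀, hsmooth, fun i => (hlip i).mono fun k => ?_, hc, hlow,
    fun i θ hθ => ?_⟩
  · exact Finset.single_le_sum (f := fun i => α i k) (fun _ _ => zero_le) (Finset.mem_univ i)
  · exact ((hC i θ hθ).trans (le_abs_self _)).trans
      (Finset.single_le_sum (f := fun i => |C i|) (fun _ _ => abs_nonneg _) (Finset.mem_univ i))

namespace IsRegularFamily

variable {d : ℕ} {f : Param d → (ℕ → ℕ) → ℝ} {Θ : Set (Param d)} {θ₀ : Param d} {α : ℕ → ℝ≥0}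
  {c C : ℝ} {y : ℕ → ℕ}

lemma C_nonneg (R : IsRegularFamily f Θ θ₀ α c C) : 0 ≤ C :=
  (norm_nonneg _).trans (R.bound 0 θ₀ R.mem)

lemma envelope_nonneg (R : IsRegularFamily f Θ θ₀ α c C) (y : ℕ → ℕ) : 0 ≤ envelope α C y :=
  add_nonneg R.C_nonneg ENNReal.toReal_nonneg

lemma tailSum_le_envelope (R : IsRegularFamily f Θ θ₀ α c C) (hy : tailSum α 0 y ≠ ∞) (t : ℕ) :
    (tailSum α t y).toReal ≤ envelope α C y :=
  (tailSum_toReal_le hy t).trans (le_add_of_nonneg_left R.C_nonneg)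

lemma norm_iteratedFDeriv_le (R : IsRegularFamily f Θ θ₀ α c C) (hy : tailSum α 0 y ≠ ∞)
    (i : Fin 3) {θ : Param d} (hθ : θ ∈ Θ) :
    ‖iteratedFDeriv ℝ i (fun ϑ => f ϑ y) θ‖ ≤ envelope α C y := by
  have h := R.lipschitz i y 0 θ hθ
  have he : ∑' k : ℕ, (α (k + 1) : ℝ≥0∞) * ‖(y k : ℝ) - ((0 : ℕ → ℕ) k : ℝ)‖ₑ = tailSum α 0 y := by
    simp [tailSum]
  rw [he] at h
  have h2 := ENNReal.toReal_mono hy h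
  rw [toReal_enorm] at h2
  have h3 := norm_le_norm_add_norm_sub (iteratedFDeriv ℝ i (fun ϑ => f ϑ 0) θ)
    (iteratedFDeriv ℝ i (fun ϑ => f ϑ y) θ)
  rw [norm_sub_rev] at h3
  have h4 := R.bound i θ hθ
  unfold envelope
  linarith

lemma norm_iteratedFDeriv_trunc_sub_le (R : IsRegularFamily f Θ θ₀ α c C)
    (hy : tailSum α 0 y ≠ ∞) (i : Fin 3) (t : ℕ) {θ : Param d} (hθ : θ ∈ Θ) :
    ‖iteratedFDeriv ℝ i (fun ϑ => f ϑ (trunc t y)) θ - iteratedFDeriv ℝ i (fun ϑ => f ϑ y) θ‖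
      ≤ (tailSum α t y).toReal := by
  have h := R.lipschitz i (trunc t y) y θ hθ
  have he : ∑' k : ℕ, (α (k + 1) : ℝ≥0∞) * ‖(trunc t y k : ℝ) - (y k : ℝ)‖ₑ = tailSum α t y := by
    refine tsum_congr fun k => ?_
    simp only [trunc]
    split_ifs <;> simp
  rw [he] at h
  have h2 := ENNReal.toReal_mono
    ((tailSum_le_tailSum_zero α t y).trans_lt (lt_top_iff_ne_top.2 hy)).ne h
  rwa [toReal_enorm] at h2

lemma tailSum_trunc_le (α : ℕ → ℝ≥0) (t : ℕ) (y : ℕ → ℕ) :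
    tailSum α 0 (trunc t y) ≤ tailSum α 0 y := by
  refine ENNReal.tsum_le_tsum fun k => ?_
  gcongr
  simp only [nonpos_iff_eq_zero, Nat.add_eq_zero_iff, OfNat.ofNat_ne_zero, and_false, if_false]
  unfold trunc
  split_ifs <;> simp

lemma tailSum_trunc_ne_top (hy : tailSum α 0 y ≠ ∞) (t : ℕ) : tailSum α 0 (trunc t y) ≠ ∞ :=
  ((tailSum_trunc_le α t y).trans_lt (lt_top_iff_ne_top.2 hy)).ne

lemma envelope_trunc_le (hy : tailSum α 0 y ≠ ∞) (t : ℕ) :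
    envelope α C (trunc t y) ≤ envelope α C y :=
  add_le_add le_rfl (ENNReal.toReal_mono hy (tailSum_trunc_le α t y))

lemma nonneg (R : IsRegularFamily f Θ θ₀ α c C) {θ : Param d} (hθ : θ ∈ Θ) (y : ℕ → ℕ) :
    0 < f θ y := R.pos.trans_le (R.lower θ hθ y)

lemma le_envelope (R : IsRegularFamily f Θ θ₀ α c C) (hy : tailSum α 0 y ≠ ∞) {θ : Param d}
    (hθ : θ ∈ Θ) : f θ y ≤ envelope α C y := by
  have h := R.norm_iteratedFDeriv_le hy 0 hθ
  rw [Fin.val_zero, norm_iteratedFDeriv_zero] at h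
  exact (le_abs_self _).trans h

lemma abs_trunc_sub_le (R : IsRegularFamily f Θ θ₀ α c C) (hy : tailSum α 0 y ≠ ∞) (t : ℕ)
    {θ : Param d} (hθ : θ ∈ Θ) : |f θ (trunc t y) - f θ y| ≤ (tailSum α t y).toReal := by
  have h := (ContinuousMultilinearMap.le_opNorm _ (0 : Fin 0 → Param d)).trans
    (mul_le_mul_of_nonneg_right (R.norm_iteratedFDeriv_trunc_sub_le hy 0 t hθ)
    (Finset.prod_nonneg fun i _ => norm_nonneg _))
  simpa using h

lemma norm_gradient (g : Param d → ℝ) (θ : Param d) : ‖∇ g θ‖ = ‖fderiv ℝ g θ‖ := by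
  rw [gradient, LinearIsometryEquiv.norm_map]

lemma norm_gradient_le (R : IsRegularFamily f Θ θ₀ α c C) (hy : tailSum α 0 y ≠ ∞) :
    ‖∇ (fun ϑ => f ϑ y) θ₀‖ ≤ envelope α C y := by
  have h := R.norm_iteratedFDeriv_le hy 1 R.mem
  rwa [Fin.val_one, norm_iteratedFDeriv_one, ← norm_gradient] at h

lemma norm_gradient_trunc_sub_le (R : IsRegularFamily f Θ θ₀ α c C) (hy : tailSum α 0 y ≠ ∞)
    (t : ℕ) : ‖∇ (fun ϑ => f ϑ (trunc t y)) θ₀ - ∇ (fun ϑ => f ϑ y) θ₀‖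
      ≤ (tailSum α t y).toReal := by
  have h : ‖fderiv ℝ (fun ϑ => f ϑ (trunc t y)) θ₀ - fderiv ℝ (fun ϑ => f ϑ y) θ₀‖
      ≤ (tailSum α t y).toReal := by
    refine ContinuousLinearMap.opNorm_le_bound _ ENNReal.toReal_nonneg fun v => ?_
    have h := (ContinuousMultilinearMap.le_opNorm _ (fun _ : Fin 1 => v)).trans
      (mul_le_mul_of_nonneg_right (R.norm_iteratedFDeriv_trunc_sub_le hy 1 t R.mem)
      (Finset.prod_nonneg fun i _ => norm_nonneg _))
    simpa [sub_apply, iteratedFDeriv_one_apply] using h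
  rw [gradient, gradient, ← map_sub, LinearIsometryEquiv.norm_map]
  exact h

lemma abs_second_le (R : IsRegularFamily f Θ θ₀ α c C) (hy : tailSum α 0 y ≠ ∞) {θ : Param d}
    (hθ : θ ∈ Θ) (v : Param d) :
    |fderiv ℝ (fderiv ℝ fun ϑ => f ϑ y) θ v v| ≤ envelope α C y * ‖v‖ ^ 2 := by
  have h := (ContinuousMultilinearMap.le_opNorm _ (fun _ : Fin 2 => v)).trans
      (mul_le_mul_of_nonneg_right (R.norm_iteratedFDeriv_le hy 2 hθ)
      (Finset.prod_nonneg fun i _ => norm_nonneg _))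
  simpa [iteratedFDeriv_two_apply, Fin.prod_univ_two, ← sq] using h

lemma abs_second_trunc_sub_le (R : IsRegularFamily f Θ θ₀ α c C) (hy : tailSum α 0 y ≠ ∞) (t : ℕ)
    {θ : Param d} (hθ : θ ∈ Θ) (v : Param d) :
    |fderiv ℝ (fderiv ℝ fun ϑ => f ϑ (trunc t y)) θ v v
      - fderiv ℝ (fderiv ℝ fun ϑ => f ϑ y) θ v v| ≤ (tailSum α t y).toReal * ‖v‖ ^ 2 := by
  have h := (ContinuousMultilinearMap.le_opNorm _ (fun _ : Fin 2 => v)).trans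
      (mul_le_mul_of_nonneg_right (R.norm_iteratedFDeriv_trunc_sub_le hy 2 t hθ)
      (Finset.prod_nonneg fun i _ => norm_nonneg _))
  simpa [sub_apply, iteratedFDeriv_two_apply, Fin.prod_univ_two,
    ← sq] using h

end IsRegularFamily

/-- The parameters that can be joined to `θ₀` inside `Θ`. -/
def segSet {d : ℕ} (Θ : Set (Param d)) (θ₀ : Param d) : Set (Param d) :=
  {θ | θ ∈ Θ ∧ segment ℝ θ₀ θ ⊆ Θ}

/-- The error of the first order expansion of the family at `θ₀`. -/
noncomputable def linErr {d : ℕ} (f : Param d → (ℕ → ℕ) → ℝ) (θ₀ θ : Param d) (y : ℕ → ℕ) : ℝ :=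
  f θ y - f θ₀ y - inner ℝ (∇ (fun ϑ => f ϑ y) θ₀) (θ - θ₀)

/-- The second derivative of the family at `θ₀`, as a quadratic form. -/
noncomputable def quad {d : ℕ} (f : Param d → (ℕ → ℕ) → ℝ) (θ₀ v : Param d) (y : ℕ → ℕ) : ℝ :=
  fderiv ℝ (fderiv ℝ fun ϑ => f ϑ y) θ₀ v v

namespace IsRegularFamily

variable {d : ℕ} {f : Param d → (ℕ → ℕ) → ℝ} {Θ : Set (Param d)} {θ₀ : Param d} {α : ℕ → ℝ≥0}
  {c C : ℝ} {y : ℕ → ℕ}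

lemma abs_linErr_le (R : IsRegularFamily f Θ θ₀ α c C) (hy : tailSum α 0 y ≠ ∞) {θ : Param d}
    (hθ : θ ∈ segSet Θ θ₀) : |linErr f θ₀ θ y| ≤ envelope α C y * ‖θ - θ₀‖ ^ 2 := by
  have h := abs_taylor_two_le (g := fun ϑ => f ϑ y) (a := θ₀) (b := θ)
    (fun z hz => R.contDiffAt y z (hθ.2 hz)) 0 (M := envelope α C y * ‖θ - θ₀‖ ^ 2)
    (fun z hz => by simpa using R.abs_second_le hy (hθ.2 hz) (θ - θ₀))
  simpa [linErr, inner_gradient_left] using h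

/-- Taylor's formula is applied to the difference of the two functions of θ, whose second derivative
is bounded by the tail sum. Bounding the two errors separately would lose the factor that tends to
zero. -/
lemma abs_linErr_trunc_sub_le (R : IsRegularFamily f Θ θ₀ α c C) (hy : tailSum α 0 y ≠ ∞)
    (t : ℕ) {θ : Param d} (hθ : θ ∈ segSet Θ θ₀) :
    |linErr f θ₀ θ (trunc t y) - linErr f θ₀ θ y| ≤ (tailSum α t y).toReal * ‖θ - θ₀‖ ^ 2 := by
  have hsub : ∀ z ∈ Θ, ∀ v, fderiv ℝ (fderiv ℝ (fun ϑ => f ϑ (trunc t y) - f ϑ y)) z v v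
      = fderiv ℝ (fderiv ℝ fun ϑ => f ϑ (trunc t y)) z v v
        - fderiv ℝ (fderiv ℝ fun ϑ => f ϑ y) z v v := by
    intro z hz v
    have h := iteratedFDeriv_sub_apply (i := 2) (x := z) (f := fun ϑ => f ϑ (trunc t y))
      (g := fun ϑ => f ϑ y) (R.contDiffAt _ z hz) (R.contDiffAt y z hz)
    have h2 := congrArg (fun L => L fun _ : Fin 2 => v) h
    simp only [sub_apply, iteratedFDeriv_two_apply] at h2
    exact h2
  have h := abs_taylor_two_le (g := fun ϑ => f ϑ (trunc t y) - f ϑ y) (a := θ₀) (b := θ)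
    (fun z hz => (R.contDiffAt _ z (hθ.2 hz)).sub (R.contDiffAt y z (hθ.2 hz))) 0
    (M := (tailSum α t y).toReal * ‖θ - θ₀‖ ^ 2)
    (fun z hz => by
      rw [hsub z (hθ.2 hz)]
      simpa using R.abs_second_trunc_sub_le hy t (hθ.2 hz) (θ - θ₀))
  have hd : ∀ y, DifferentiableAt ℝ (fun ϑ => f ϑ y) θ₀ := fun y =>
    (R.contDiffAt y θ₀ R.mem).differentiableAt (by norm_num)
  rw [fderiv_fun_sub (hd _) (hd _)] at h
  refine le_trans (le_of_eq ?_) h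
  simp only [linErr, inner_gradient_left, sub_apply, zero_apply]
  congr 1
  ring

lemma tendsto_linErr_div (R : IsRegularFamily f Θ θ₀ α c C) (y : ℕ → ℕ) :
    Tendsto (fun θ => (linErr f θ₀ θ y - 1 / 2 * quad f θ₀ (θ - θ₀) y) / ‖θ - θ₀‖ ^ 2)
      (𝓝 θ₀) (𝓝 0) := by
  simpa only [linErr, inner_gradient_left, quad] using
    tendsto_taylor_two_div (R.contDiffAt y θ₀ R.mem)

lemma tendsto_path (v : Param d) :
    Tendsto (fun n : ℕ => θ₀ + ((n : ℝ) + 1)⁻¹ • v) atTop (𝓝 θ₀) := by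
  have h := (tendsto_inv_atTop_zero.comp (tendsto_natCast_atTop_atTop.comp
    (tendsto_add_atTop_nat 1)) : Tendsto (fun n : ℕ => ((n + 1 : ℕ) : ℝ)⁻¹) atTop (𝓝 0))
  have h2 := (h.smul_const v).const_add θ₀
  simpa using h2

/-- A directional derivative is the limit of difference quotients with steps 1/(n+1), each
measurable in the past. -/
lemma measurable_inner_gradient (R : IsRegularFamily f Θ θ₀ α c C) (v : Param d) :
    Measurable fun y => inner ℝ (∇ (fun ϑ => f ϑ y) θ₀) v := by
  refine measurable_of_tendsto_metrizable
    (f := fun (n : ℕ) y => ((n : ℝ) + 1) * (f (θ₀ + ((n : ℝ) + 1)⁻¹ • v) y - f θ₀ y))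
    (fun n => ((R.measurable _).sub (R.measurable _)).const_mul _) ?_
  rw [tendsto_pi_nhds]
  intro y
  have hd := ((R.contDiffAt y θ₀ R.mem).differentiableAt (by norm_num)).hasFDerivAt
  have hl : HasDerivAt (fun s : ℝ => f (θ₀ + s • v) y) (fderiv ℝ (fun ϑ => f ϑ y) θ₀ v) 0 := by
    have hl0 : HasDerivAt (fun s : ℝ => θ₀ + s • v) v 0 := by
      simpa using ((hasDerivAt_id (0 : ℝ)).smul_const v).const_add θ₀
    have hd' : HasFDerivAt (fun ϑ => f ϑ y) (fderiv ℝ (fun ϑ => f ϑ y) θ₀) (θ₀ + (0 : ℝ) • v) := by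
      simpa using hd
    exact hd'.comp_hasDerivAt 0 hl0
  have ht := hl.tendsto_slope_zero.comp (f := fun n : ℕ => ((n : ℝ) + 1)⁻¹) (x := atTop) (by
    rw [tendsto_nhdsWithin_iff]
    refine ⟨?_, Eventually.of_forall fun n => ?_⟩
    · have h := (tendsto_inv_atTop_zero.comp (tendsto_natCast_atTop_atTop.comp
        (tendsto_add_atTop_nat 1)) : Tendsto (fun n : ℕ => ((n + 1 : ℕ) : ℝ)⁻¹) atTop (𝓝 0))
      exact h.congr fun n => by simp
    · have : ((n : ℝ) + 1)⁻¹ ≠ 0 := by positivity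
      simpa using this)
  rw [inner_gradient_left]
  refine ht.congr fun n => ?_
  simp

lemma measurable_gradient (R : IsRegularFamily f Θ θ₀ α c C) :
    Measurable fun y => ∇ (fun ϑ => f ϑ y) θ₀ := by
  have h : Measurable fun y => WithLp.toLp 2 fun i =>
      inner ℝ (∇ (fun ϑ => f ϑ y) θ₀) (EuclideanSpace.single i (1 : ℝ)) :=
    (WithLp.measurable_toLp 2 _).comp
      (measurable_pi_lambda _ fun i => R.measurable_inner_gradient _)
  convert h using 1
  ext y i
  change _ = inner ℝ (∇ (fun ϑ => f ϑ y) θ₀) (EuclideanSpace.single i (1 : ℝ))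
  rw [EuclideanSpace.inner_single_right]
  simp

lemma measurable_linErr (R : IsRegularFamily f Θ θ₀ α c C) (θ : Param d) :
    Measurable (linErr f θ₀ θ) :=
  ((R.measurable _).sub (R.measurable _)).sub (R.measurable_inner_gradient _)

/-- The quadratic form is the limit of 2(n+1)² times the linearization error at θ₀ + v/(n+1), which
is measurable in the past. The case v = 0 is separate because the expansion is normalized by the
norm of the increment. -/
lemma measurable_quad (R : IsRegularFamily f Θ θ₀ α c C) (v : Param d) :
    Measurable (quad f θ₀ v) := by
  rcases eq_or_ne v 0 with rfl | hv
  · have : quad f θ₀ 0 = fun _ => 0 := by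
      ext y
      simp [quad]
    rw [this]
    exact measurable_const
  refine measurable_of_tendsto_metrizable
    (f := fun (n : ℕ) y => 2 * (((n : ℝ) + 1) ^ 2 * linErr f θ₀ (θ₀ + ((n : ℝ) + 1)⁻¹ • v) y))
    (fun n => ((R.measurable_linErr _).const_mul _).const_mul _) ?_
  rw [tendsto_pi_nhds]
  intro y
  have h := ((R.tendsto_linErr_div y).comp (tendsto_path v)).mul_const (2 * ‖v‖ ^ 2)
  have h2 := h.add_const (quad f θ₀ v y)
  rw [zero_mul, zero_add] at h2
  refine h2.congr fun n => ?_
  have hn : ((n : ℝ) + 1) ≠ 0 := by positivity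
  have hv' : ‖v‖ ≠ 0 := norm_ne_zero_iff.2 hv
  have hq : quad f θ₀ (((n : ℝ) + 1)⁻¹ • v) y = (((n : ℝ) + 1)⁻¹) ^ 2 * quad f θ₀ v y := by
    simp only [quad, map_smul, smul_apply, smul_eq_mul]
    ring
  have hnorm : ‖((n : ℝ) + 1)⁻¹ • v‖ = ((n : ℝ) + 1)⁻¹ * ‖v‖ := by
    rw [norm_smul, Real.norm_eq_abs, abs_of_pos (by positivity)]
  simp only [Function.comp_apply, add_sub_cancel_left, hq, hnorm]
  field_simp
  ring

/-- Polarization of the second derivative. -/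
lemma quad_eq_sum (R : IsRegularFamily f Θ θ₀ α c C) (v : Param d) (y : ℕ → ℕ) :
    quad f θ₀ v y = ∑ i, ∑ j, v i * v j * ((quad f θ₀ (EuclideanSpace.single i (1 : ℝ)
      + EuclideanSpace.single j 1) y - quad f θ₀ (EuclideanSpace.single i (1 : ℝ)) y
      - quad f θ₀ (EuclideanSpace.single j (1 : ℝ)) y) / 2) := by
  have hs : IsSymmSndFDerivAt ℝ (fun ϑ => f ϑ y) θ₀ :=
    (R.contDiffAt y θ₀ R.mem).isSymmSndFDerivAt (by simp)
  set B := fderiv ℝ (fderiv ℝ fun ϑ => f ϑ y) θ₀ with hB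
  have hv : v = ∑ i, v i • EuclideanSpace.single i (1 : ℝ) := by
    ext j
    simp [Finset.sum_apply, Pi.single_apply]
  have hpol : ∀ a b : Param d, (quad f θ₀ (a + b) y - quad f θ₀ a y - quad f θ₀ b y) / 2
      = B a b := by
    intro a b
    have := hs a b
    simp only [quad, ← hB, map_add, add_apply] at this ⊢
    rw [this]
    ring
  simp only [hpol]
  have : quad f θ₀ v y = B v v := rfl
  rw [this]
  conv_lhs => rw [hv]
  simp only [map_sum, map_smul, smul_apply, sum_apply, smul_eq_mul,
    Finset.mul_sum, mul_assoc]
  rw [Finset.sum_comm]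
  refine Finset.sum_congr rfl fun i _ => Finset.sum_congr rfl fun j _ => ?_
  ring

lemma exists_modulus_linErr (R : IsRegularFamily f Θ θ₀ α c C) :
    ∃ ω : ℕ → (ℕ → ℕ) → ℝ, (∀ k, Measurable (ω k)) ∧ (∀ k y, 0 ≤ ω k y) ∧
      (∀ k y, ω k y ≤ 2 * envelope α C y) ∧ (∀ y, Tendsto (fun k => ω k y) atTop (𝓝 0)) ∧
      ∀ k : ℕ, ∀ y, tailSum α 0 y ≠ ∞ → ∀ θ ∈ segSet Θ θ₀, dist θ θ₀ < 1 / ((k : ℝ) + 1) →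
        |linErr f θ₀ θ y - 1 / 2 * quad f θ₀ (θ - θ₀) y| ≤ ω k y * ‖θ - θ₀‖ ^ 2 := by
  -- The point θ₀ is removed so that the quotient by ‖θ - θ₀‖² is continuous in θ on the set. At θ₀
  -- itself both sides of the final bound vanish.
  obtain ⟨ω, h1, h2, h3, h4, h5⟩ := exists_measurable_modulus (A := segSet Θ θ₀ \ {θ₀}) (θ₀ := θ₀)
    (φ := fun θ y => (linErr f θ₀ θ y - 1 / 2 * quad f θ₀ (θ - θ₀) y) / ‖θ - θ₀‖ ^ 2)
    (G := {y | tailSum α 0 y ≠ ∞}) (W := fun y => 2 * envelope α C y)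
    ((measurable_tailSum α 0) (measurableSet_singleton ∞).compl)
    (fun θ _ => ((R.measurable_linErr θ).sub ((R.measurable_quad _).const_mul _)).div_const _)
    (fun y θ hθ => by
      have hc : ContinuousAt (fun ϑ => f ϑ y) θ := (R.contDiffAt y θ hθ.1.1).continuousAt
      have hne : ‖θ - θ₀‖ ^ 2 ≠ 0 := by
        have : θ - θ₀ ≠ 0 := sub_ne_zero.2 (by simpa using hθ.2)
        positivity
      refine ContinuousAt.continuousWithinAt ?_
      unfold linErr quad
      refine ContinuousAt.div ?_ (by fun_prop) hne
      refine ContinuousAt.sub (ContinuousAt.sub (ContinuousAt.sub hc continuousAt_const)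
        (by fun_prop)) (by fun_prop))
    (fun y hy θ hθ => by
      have hne : 0 < ‖θ - θ₀‖ ^ 2 := by
        have : θ - θ₀ ≠ 0 := sub_ne_zero.2 (by simpa using hθ.2)
        positivity
      rw [abs_div, abs_of_pos hne, div_le_iff₀ hne]
      have h1 := R.abs_linErr_le hy hθ.1
      have h2 := R.abs_second_le hy R.mem (θ - θ₀)
      have h3 := abs_sub (linErr f θ₀ θ y) (1 / 2 * quad f θ₀ (θ - θ₀) y)
      rw [abs_mul, abs_of_pos (by norm_num : (0 : ℝ) < 1 / 2)] at h3
      have h4 : |quad f θ₀ (θ - θ₀) y| ≤ envelope α C y * ‖θ - θ₀‖ ^ 2 := h2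
      nlinarith [R.envelope_nonneg y])
    (fun y => mul_nonneg zero_le_two (R.envelope_nonneg y))
    (fun y => (R.tendsto_linErr_div y).mono_left nhdsWithin_le_nhds)
  refine ⟨ω, h1, h2, h3, h4, fun k y hy θ hθ hd => ?_⟩
  rcases eq_or_ne θ θ₀ with rfl | hne
  · simp [linErr, quad]
  · have h6 := h5 k y hy θ ⟨hθ, hne⟩ hd
    have hne' : 0 < ‖θ - θ₀‖ ^ 2 := by
      have : θ - θ₀ ≠ 0 := sub_ne_zero.2 hne
      positivity
    rwa [abs_div, abs_of_pos hne', div_le_iff₀ hne'] at h6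

lemma exists_modulus (R : IsRegularFamily f Θ θ₀ α c C) {θ₁ : Param d} (hθ₁ : θ₁ ∈ Θ) :
    ∃ ω : ℕ → (ℕ → ℕ) → ℝ, (∀ k, Measurable (ω k)) ∧ (∀ k y, 0 ≤ ω k y) ∧
      (∀ k y, ω k y ≤ envelope α C y) ∧ (∀ y, Tendsto (fun k => ω k y) atTop (𝓝 0)) ∧
      ∀ k : ℕ, ∀ y, tailSum α 0 y ≠ ∞ → ∀ θ ∈ Θ, dist θ θ₁ < 1 / ((k : ℝ) + 1) →
        |f θ y - f θ₁ y| ≤ ω k y := by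
  exact exists_measurable_modulus (A := Θ) (θ₀ := θ₁) (φ := fun θ y => f θ y - f θ₁ y)
    (G := {y | tailSum α 0 y ≠ ∞}) (W := envelope α C)
    ((measurable_tailSum α 0) (measurableSet_singleton ∞).compl)
    (fun θ _ => (R.measurable θ).sub (R.measurable _))
    (fun y θ hθ => ((R.contDiffAt y θ hθ).continuousAt.sub continuousAt_const).continuousWithinAt)
    (fun y hy θ hθ => by
      have h1 := R.le_envelope hy hθ
      have h2 := R.le_envelope hy hθ₁
      have h3 := R.nonneg hθ y
      have h4 := R.nonneg hθ₁ y
      rw [abs_le]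
      constructor <;> linarith)
    (fun y => R.envelope_nonneg y)
    (fun y => by
      have := ((R.contDiffAt y θ₁ hθ₁).continuousAt.sub continuousAt_const :
        ContinuousAt (fun θ => f θ y - f θ₁ y) θ₁)
      have h2 : Tendsto (fun θ => f θ y - f θ₁ y) (𝓝 θ₁) (𝓝 (f θ₁ y - f θ₁ y)) := this.tendsto
      rw [sub_self] at h2
      exact h2.mono_left nhdsWithin_le_nhds)

end IsRegularFamily

/-! ### The process seen from time t, as a point of the path space -/

section Path

/-- The left shift on two-sided paths. -/
def shift (s : ℤ → ℕ) : ℤ → ℕ := fun t => s (t + 1)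

/-- The values of a path before time zero. -/
def pastOf (s : ℤ → ℕ) : ℕ → ℕ := fun k => s (-1 - k)

variable {Ω : Type*} (Y : ℤ → Ω → ℕ)

/-- The path of the process seen from time `t`. -/
def pathAt (t : ℕ) (ω : Ω) : ℤ → ℕ := fun j => Y (t + j) ω

/-- The law of the process on two-sided paths. -/
noncomputable def pathLaw [MeasurableSpace Ω] (P : Measure Ω) : Measure (ℤ → ℕ) :=
  P.map fun ω t => Y t ω

variable {Y}

lemma measurable_pastOf : Measurable pastOf :=
  measurable_pi_lambda _ fun _ => measurable_pi_apply _

lemma pathAt_succ (t : ℕ) (ω : Ω) : pathAt Y (t + 1) ω = shift (pathAt Y t ω) := by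
  ext j
  simp only [pathAt, shift]
  congr 1
  push_cast
  ring

lemma past_eq (t : ℕ) (ω : Ω) : past Y t ω = pastOf (pathAt Y t ω) := by
  ext k
  simp only [past, pastOf, pathAt]
  congr 1
  ring

lemma obsPast_eq (t : ℕ) (ω : Ω) : obsPast Y t ω = trunc t (pastOf (pathAt Y t ω)) := by
  ext k
  simp only [obsPast, pastOf, pathAt, trunc]
  have h2 : (t : ℤ) - 1 - k = t + (-1 - k) := by ring
  -- Entry k is the value at time t - 1 - k, which is observed when this time is at least 1.
  have h1 : (1 ≤ (t : ℤ) + (-1 - k)) ↔ k + 2 ≤ t := by omega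
  simp only [h2, h1]

lemma pathAt_zero_apply (t : ℕ) (ω : Ω) : pathAt Y t ω 0 = Y t ω := by
  simp [pathAt]

variable [MeasurableSpace Ω] {P : Measure Ω}

lemma IsStationaryErgodic.measurable (h : IsStationaryErgodic Y P) (t : ℤ) : Measurable (Y t) :=
  h.1 t

lemma IsStationaryErgodic.ergodic (h : IsStationaryErgodic Y P) : Ergodic shift (pathLaw Y P) :=
  h.2

lemma IsStationaryErgodic.measurable_path (h : IsStationaryErgodic Y P) :
    Measurable fun ω t => Y t ω := measurable_pi_lambda _ h.1

lemma isProbabilityMeasure_pathLaw [IsProbabilityMeasure P] (h : IsStationaryErgodic Y P) :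
    IsProbabilityMeasure (pathLaw Y P) :=
  Measure.isProbabilityMeasure_map h.measurable_path.aemeasurable

lemma IsStationaryErgodic.measurePreserving_pathAt (h : IsStationaryErgodic Y P) (t : ℕ) :
    MeasurePreserving (pathAt Y t) P (pathLaw Y P) := by
  induction t with
  | zero =>
    refine ⟨measurable_pi_lambda _ fun _ => h.1 _, ?_⟩
    rw [pathLaw]
    congr 1
    ext ω j
    simp [pathAt]
  | succ t ih =>
    have := h.ergodic.toMeasurePreserving.comp ih
    convert this using 1
    ext ω j
    simp [pathAt_succ]

lemma IsStationaryErgodic.pastSigma_le (h : IsStationaryErgodic Y P) (t : ℤ) :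
    pastSigma Y t ≤ ‹MeasurableSpace Ω› :=
  iSup_le fun s => (h.1 s).comap_le

end Path

/-! ### Measurability with respect to the past -/

section PastSigma

variable {Ω : Type*} {Y : ℤ → Ω → ℕ}

lemma measurable_pastSigma {s t : ℤ} (hst : s < t) : Measurable[pastSigma Y t] (Y s) := by
  have h1 : MeasurableSpace.comap (Y s) inferInstance ≤ pastSigma Y t :=
    le_iSup (fun s : {s : ℤ // s < t} => MeasurableSpace.comap (Y s) inferInstance) ⟨s, hst⟩
  exact (comap_measurable (Y s)).mono h1 le_rfl

lemma measurable_pastOf_pathAt {s t : ℕ} (hst : s ≤ t) :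
    Measurable[pastSigma Y t] fun ω => pastOf (pathAt Y s ω) :=
  @measurable_pi_lambda _ _ _ (pastSigma Y t) _ _ fun k =>
    measurable_pastSigma (show (s : ℤ) + (-1 - k) < t by omega)

lemma measurable_pathAt_zero {s t : ℕ} (hst : s < t) :
    Measurable[pastSigma Y t] fun ω => pathAt Y s ω 0 :=
  measurable_pastSigma (show (s : ℤ) + 0 < t by omega)

end PastSigma

/-! ### Conditional expectations against unbounded multipliers -/

section CondExp

variable {Ω : Type*} {m m0 : MeasurableSpace Ω} {P : Measure Ω} [IsProbabilityMeasure P]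

lemma integral_mul_eq_integral_mul_condExp (hm : m ≤ m0) {X g : Ω → ℝ}
    (hX : Integrable X P) (hg : Measurable[m] g) (hXg : Integrable (fun ω => g ω * X ω) P) :
    ∫ ω, g ω * X ω ∂P = ∫ ω, g ω * (P[X | m]) ω ∂P := by
  have h := condExp_mul_of_stronglyMeasurable_left (μ := P) (m := m) hg.stronglyMeasurable hXg hX
  calc ∫ ω, g ω * X ω ∂P = ∫ ω, (P[g * X | m]) ω ∂P := (integral_condExp hm).symm
    _ = ∫ ω, g ω * (P[X | m]) ω ∂P := integral_congr_ae h

/-- If `X ≥ 0` and `E(X | m) g` is integrable for an `m`-measurable `g ≥ 0`, so is `X g`. -/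
lemma integrable_mul_of_integrable_mul_condExp (hm : m ≤ m0) {X g : Ω → ℝ}
    (hX : Integrable X P) (hX0 : ∀ ω, 0 ≤ X ω) (hg : Measurable[m] g) (hg0 : ∀ ω, 0 ≤ g ω)
    (h : Integrable (fun ω => g ω * (P[X | m]) ω) P) : Integrable (fun ω => g ω * X ω) P := by
  have hgm : Measurable g := hg.mono hm le_rfl
  have hc0 : 0 ≤ᵐ[P] P[X | m] := condExp_nonneg (ae_of_all _ hX0)
  have hgX : AEStronglyMeasurable (fun ω => g ω * X ω) P := hgm.aestronglyMeasurable.mul hX.1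
  refine ⟨hgX, ?_⟩
  -- Truncating g at k makes the product integrable, so g can be taken out of the conditional
  -- expectation; positivity and monotone convergence remove the truncation.
  have hk : ∀ k : ℕ, ∫⁻ ω, ‖min (g ω) k * X ω‖ₑ ∂P ≤ ∫⁻ ω, ‖g ω * (P[X | m]) ω‖ₑ ∂P := by
    intro k
    have hmk : Measurable[m] fun ω => min (g ω) (k : ℝ) := hg.min measurable_const
    have hbd : ∀ ω, ‖min (g ω) (k : ℝ)‖ ≤ k := fun ω => by
      rw [Real.norm_eq_abs, abs_of_nonneg (le_min (hg0 ω) (Nat.cast_nonneg k))]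
      exact min_le_right _ _
    have hint : Integrable (fun ω => min (g ω) (k : ℝ) * X ω) P :=
      hX.bdd_mul (hmk.mono hm le_rfl).aestronglyMeasurable (ae_of_all _ hbd)
    have hint2 : Integrable (fun ω => min (g ω) (k : ℝ) * (P[X | m]) ω) P :=
      integrable_condExp.bdd_mul (hmk.mono hm le_rfl).aestronglyMeasurable (ae_of_all _ hbd)
    have he := integral_mul_eq_integral_mul_condExp hm hX hmk hint
    have h1 : ∫⁻ ω, ‖min (g ω) k * X ω‖ₑ ∂P = ENNReal.ofReal (∫ ω, min (g ω) k * X ω ∂P) := by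
      rw [ofReal_integral_eq_lintegral_ofReal hint (ae_of_all _ fun ω =>
        mul_nonneg (le_min (hg0 ω) (Nat.cast_nonneg k)) (hX0 ω))]
      refine lintegral_congr fun ω => ?_
      rw [Real.enorm_eq_ofReal (mul_nonneg (le_min (hg0 ω) (Nat.cast_nonneg k)) (hX0 ω))]
    rw [h1, he, ofReal_integral_eq_lintegral_ofReal hint2 (by
      filter_upwards [hc0] with ω hω
      exact mul_nonneg (le_min (hg0 ω) (Nat.cast_nonneg k)) hω)]
    refine lintegral_mono_ae ?_
    filter_upwards [hc0] with ω hω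
    rw [Real.enorm_eq_ofReal (mul_nonneg (hg0 ω) hω)]
    exact ENNReal.ofReal_le_ofReal (mul_le_mul_of_nonneg_right (min_le_left _ _) hω)
  have hlim : Tendsto (fun k : ℕ => ∫⁻ ω, ‖min (g ω) k * X ω‖ₑ ∂P) atTop
      (𝓝 (∫⁻ ω, ‖g ω * X ω‖ₑ ∂P)) := by
    refine lintegral_tendsto_of_tendsto_of_monotone
      (fun k => ((hgm.min measurable_const).aemeasurable.mul hX.aemeasurable).enorm)
      (ae_of_all _ fun ω a b hab => ?_) (ae_of_all _ fun ω => ?_)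
    · beta_reduce
      rw [Real.enorm_eq_ofReal (mul_nonneg (le_min (hg0 ω) (Nat.cast_nonneg a)) (hX0 ω)),
        Real.enorm_eq_ofReal (mul_nonneg (le_min (hg0 ω) (Nat.cast_nonneg b)) (hX0 ω))]
      exact ENNReal.ofReal_le_ofReal (mul_le_mul_of_nonneg_right
        (min_le_min le_rfl (by exact_mod_cast hab)) (hX0 ω))
    · refine tendsto_const_nhds.congr' ?_
      obtain ⟨N, hN⟩ := exists_nat_ge (g ω)
      filter_upwards [eventually_ge_atTop N] with k hk
      rw [min_eq_left (hN.trans (by exact_mod_cast hk))]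
  exact (le_of_tendsto' hlim hk).trans_lt h.2

end CondExp

/-! ### The count model: second moments of the observations and of the envelope -/

/-- A count series whose conditional mean is driven by a regular family. -/
structure IsCountModel {Ω : Type*} [MeasurableSpace Ω] {d : ℕ} (P : Measure Ω) (Y : ℤ → Ω → ℕ)
    (f : Param d → (ℕ → ℕ) → ℝ) (Θ : Set (Param d)) (θ₀ : Param d) (α : ℕ → ℝ≥0) (c C : ℝ) :
    Prop where
  regular : IsRegularFamily f Θ θ₀ α c C
  summable : Summable fun k => α (k + 1)
  stationary : IsStationaryErgodic Y P
  od : IsODProcess f Y P θ₀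
  moments : HasMoments Y P

namespace IsCountModel

variable {Ω : Type*} [MeasurableSpace Ω] {d : ℕ} {P : Measure Ω}
  {Y : ℤ → Ω → ℕ} {f : Param d → (ℕ → ℕ) → ℝ} {Θ : Set (Param d)} {θ₀ : Param d} {α : ℕ → ℝ≥0}
  {c C : ℝ}

lemma integral_pathLaw (H : IsCountModel P Y f Θ θ₀ α c C) (t : ℕ) {g : (ℤ → ℕ) → ℝ}
    (hg : AEStronglyMeasurable g (pathLaw Y P)) :
    ∫ s, g s ∂(pathLaw Y P) = ∫ ω, g (pathAt Y t ω) ∂P := by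
  have hτ := H.stationary.measurePreserving_pathAt t
  have h1 := integral_map hτ.aemeasurable (hτ.map_eq.symm ▸ hg)
  rw [hτ.map_eq] at h1
  exact h1

lemma condExp_obs (H : IsCountModel P Y f Θ θ₀ α c C) (t : ℕ) :
    P[(fun ω => (Y t ω : ℝ)) | pastSigma Y t] =ᵐ[P] fun ω => f θ₀ (pastOf (pathAt Y t ω)) := by
  obtain ⟨p, hp⟩ := H.od
  refine (hp t).2.trans (Eventually.of_forall fun ω => ?_)
  simp only [lam, past_eq]

variable [IsProbabilityMeasure P]

lemma exists_lintegral_sq_le (H : IsCountModel P Y f Θ θ₀ α c C) :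
    ∃ K : ℝ≥0∞, K ≠ ∞ ∧ ∀ j, ∫⁻ s, (s j : ℝ≥0∞) ^ 2 ∂(pathLaw Y P) ≤ K := by
  obtain ⟨K, ε, hε, h⟩ := H.moments
  refine ⟨1 + K, by simp, fun j => ?_⟩
  have hm : Measurable fun s : ℤ → ℕ => (s j : ℝ≥0∞) ^ 2 :=
    ((measurable_from_nat (f := fun n : ℕ => (n : ℝ≥0∞))).comp (measurable_pi_apply j)).pow_const 2
  rw [pathLaw, lintegral_map hm H.stationary.measurable_path]
  calc ∫⁻ ω, (Y j ω : ℝ≥0∞) ^ 2 ∂P ≤ ∫⁻ ω, (1 + (Y j ω : ℝ≥0∞) ^ (1 + ε)) ∂P := by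
        refine lintegral_mono fun ω => ?_
        -- A count is zero or at least one, hence y² ≤ y^{1+ε} + 1 as 2 ≤ 1 + ε.
        rcases Nat.eq_zero_or_pos (Y j ω) with h0 | h0
        · simp [h0]
        · refine le_trans ?_ le_add_self
          rw [← ENNReal.rpow_two]
          exact ENNReal.rpow_le_rpow_of_exponent_le (by exact_mod_cast h0) (by linarith)
    _ = 1 + ∫⁻ ω, (Y j ω : ℝ≥0∞) ^ (1 + ε) ∂P := by
        rw [lintegral_add_left measurable_const]
        simp
    _ ≤ 1 + K := by
        gcongr
        exact (h j).le

lemma memLp_coord (H : IsCountModel P Y f Θ θ₀ α c C) (j : ℤ) :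
    MemLp (fun s : ℤ → ℕ => (s j : ℝ)) 2 (pathLaw Y P) := by
  obtain ⟨K, hK, h⟩ := H.exists_lintegral_sq_le
  have hm : Measurable fun s : ℤ → ℕ => (s j : ℝ) :=
    (measurable_from_nat (f := fun n : ℕ => (n : ℝ))).comp (measurable_pi_apply j)
  rw [memLp_two_iff_integrable_sq hm.aestronglyMeasurable]
  refine ⟨(hm.pow_const 2).aestronglyMeasurable, ?_⟩
  refine lt_of_le_of_lt (le_of_eq ?_) ((h j).trans_lt (lt_top_iff_ne_top.2 hK))
  refine lintegral_congr fun s => ?_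
  simp [Real.enorm_natCast]

/-- The square is expanded as a double series. As ab ≤ a² + b² and second moments are bounded
uniformly in time, its mean is at most 2K times the square of the sum of the coefficients. -/
lemma lintegral_tailSum_sq_lt_top (H : IsCountModel P Y f Θ θ₀ α c C) :
    ∫⁻ s, tailSum α 0 (pastOf s) ^ 2 ∂(pathLaw Y P) < ∞ := by
  obtain ⟨K, hK, h⟩ := H.exists_lintegral_sq_le
  have hA : ∑' k : ℕ, (α (k + 1) : ℝ≥0∞) ≠ ∞ := ENNReal.tsum_coe_ne_top_iff_summable.2 H.summable
  have hm : ∀ j, Measurable fun s : ℤ → ℕ => (s j : ℝ≥0∞) := fun j =>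
    (measurable_from_nat (f := fun n : ℕ => (n : ℝ≥0∞))).comp (measurable_pi_apply j)
  have hprod : ∀ s : ℤ → ℕ, tailSum α 0 (pastOf s) ^ 2 = ∑' k : ℕ, ∑' l : ℕ,
      (α (k + 1) : ℝ≥0∞) * (α (l + 1) : ℝ≥0∞) *
        ((s (-1 - k) : ℝ≥0∞) * (s (-1 - l) : ℝ≥0∞)) := by
    intro s
    have h0 : tailSum α 0 (pastOf s) = ∑' k : ℕ, (α (k + 1) : ℝ≥0∞) * (s (-1 - k) : ℝ≥0∞) := by
      simp [tailSum, pastOf]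
    rw [h0, sq, ← ENNReal.tsum_mul_right]
    refine tsum_congr fun k => ?_
    rw [← ENNReal.tsum_mul_left]
    refine tsum_congr fun l => ?_
    ring
  have hxy : ∀ a b : ℝ≥0∞, a * b ≤ a ^ 2 + b ^ 2 := by
    intro a b
    rcases le_total a b with hab | hab
    · calc a * b ≤ b * b := by gcongr
        _ ≤ a ^ 2 + b ^ 2 := by rw [← sq]; exact le_add_self
    · calc a * b ≤ a * a := by gcongr
        _ ≤ a ^ 2 + b ^ 2 := by rw [← sq]; exact le_self_add
  simp only [hprod]
  have hmm : ∀ k l : ℕ, Measurable fun s : ℤ → ℕ => (α (k + 1) : ℝ≥0∞) * (α (l + 1) : ℝ≥0∞) *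
        ((s (-1 - k) : ℝ≥0∞) * (s (-1 - l) : ℝ≥0∞)) := fun k l =>
    ((hm _).mul (hm _)).const_mul _
  rw [lintegral_tsum fun k => (Measurable.tsum fun l => hmm k l).aemeasurable]
  have hle : ∀ k : ℕ, ∫⁻ s, ∑' l : ℕ, (α (k + 1) : ℝ≥0∞) * (α (l + 1) : ℝ≥0∞) *
        ((s (-1 - k) : ℝ≥0∞) * (s (-1 - l) : ℝ≥0∞)) ∂(pathLaw Y P)
      ≤ ∑' l : ℕ, (α (k + 1) : ℝ≥0∞) * ((α (l + 1) : ℝ≥0∞) * (K + K)) := by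
    intro k
    rw [lintegral_tsum fun l => (hmm k l).aemeasurable]
    refine ENNReal.tsum_le_tsum fun l => ?_
    have hm2 : Measurable fun s : ℤ → ℕ => (s (-1 - k) : ℝ≥0∞) * (s (-1 - l) : ℝ≥0∞) :=
      (hm _).mul (hm _)
    rw [lintegral_const_mul _ hm2, mul_assoc]
    gcongr
    refine (lintegral_mono fun s => hxy _ _).trans ?_
    rw [lintegral_add_left ((hm _).pow_const 2)]
    exact add_le_add (h _) (h _)
  refine (ENNReal.tsum_le_tsum hle).trans_lt ?_
  simp_rw [ENNReal.tsum_mul_left, ENNReal.tsum_mul_right]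
  exact ENNReal.mul_lt_top (lt_top_iff_ne_top.2 hA)
    (ENNReal.mul_lt_top (lt_top_iff_ne_top.2 hA) (by simpa using lt_top_iff_ne_top.2 hK))

lemma ae_tailSum_ne_top (H : IsCountModel P Y f Θ θ₀ α c C) :
    ∀ᵐ s ∂(pathLaw Y P), tailSum α 0 (pastOf s) ≠ ∞ := by
  have h := ae_lt_top (((measurable_tailSum α 0).comp measurable_pastOf).pow_const 2)
    H.lintegral_tailSum_sq_lt_top.ne
  filter_upwards [h] with s hs
  intro h0
  simp [h0] at hs

lemma ae_forall_tailSum_ne_top (H : IsCountModel P Y f Θ θ₀ α c C) :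
    ∀ᵐ ω ∂P, ∀ t, tailSum α 0 (pastOf (pathAt Y t ω)) ≠ ∞ :=
  ae_all_iff.2 fun t =>
    (H.stationary.measurePreserving_pathAt t).quasiMeasurePreserving.ae H.ae_tailSum_ne_top

lemma measurable_envelope (α : ℕ → ℝ≥0) (C : ℝ) :
    Measurable fun s : ℤ → ℕ => envelope α C (pastOf s) :=
  (((measurable_tailSum α 0).comp measurable_pastOf).ennreal_toReal).const_add C

lemma memLp_envelope (H : IsCountModel P Y f Θ θ₀ α c C) :
    MemLp (fun s => envelope α C (pastOf s)) 2 (pathLaw Y P) := by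
  have := isProbabilityMeasure_pathLaw H.stationary
  have hm : Measurable fun s : ℤ → ℕ => (tailSum α 0 (pastOf s)).toReal :=
    ((measurable_tailSum α 0).comp measurable_pastOf).ennreal_toReal
  refine (memLp_const C).add ?_
  rw [memLp_two_iff_integrable_sq hm.aestronglyMeasurable]
  refine ⟨(hm.pow_const 2).aestronglyMeasurable, ?_⟩
  refine lt_of_le_of_lt (lintegral_mono fun s => ?_) H.lintegral_tailSum_sq_lt_top
  rw [Real.enorm_eq_ofReal (sq_nonneg _), ENNReal.ofReal_pow ENNReal.toReal_nonneg]
  gcongr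
  exact ENNReal.ofReal_toReal_le

lemma memLp_obs (H : IsCountModel P Y f Θ θ₀ α c C) (t : ℕ) :
    MemLp (fun ω => (Y t ω : ℝ)) 2 P := by
  have h := (H.memLp_coord 0).comp_measurePreserving (H.stationary.measurePreserving_pathAt t)
  refine h.ae_eq (ae_of_all _ fun ω => ?_)
  simp [pathAt]

/-- Bounded functions of the past are orthogonal to the innovations. -/
lemma integral_mul_innovation (H : IsCountModel P Y f Θ θ₀ α c C) (t : ℕ) {ξ : Ω → ℝ}
    (hξ : Measurable[pastSigma Y t] ξ) (hξY : Integrable (fun ω => ξ ω * (Y t ω : ℝ)) P) :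
    ∫ ω, ξ ω * (Y t ω : ℝ) ∂P = ∫ ω, ξ ω * f θ₀ (pastOf (pathAt Y t ω)) ∂P := by
  rw [integral_mul_eq_integral_mul_condExp (H.stationary.pastSigma_le t)
    ((H.memLp_obs t).integrable one_le_two) hξ hξY]
  refine integral_congr_ae ?_
  filter_upwards [H.condExp_obs t] with ω hω
  rw [hω]

end IsCountModel

/-! ### The score: second moments and central limit theorem -/

/-- The logarithmic gradient `λ⁻¹ ∂λ/∂θ` of the family at `θ₀`. -/
noncomputable def logGrad {d : ℕ} (f : Param d → (ℕ → ℕ) → ℝ) (θ₀ : Param d) (y : ℕ → ℕ) :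
    Param d := (f θ₀ y)⁻¹ • ∇ (fun ϑ => f ϑ y) θ₀

/-- The score at the true parameter, as a function of the path. -/
noncomputable def score {d : ℕ} (f : Param d → (ℕ → ℕ) → ℝ) (θ₀ : Param d) (s : ℤ → ℕ) :
    Param d := ((s 0 : ℝ) - f θ₀ (pastOf s)) • logGrad f θ₀ (pastOf s)

/-- The normalized score of the first `n` observations. -/
noncomputable def normScore {Ω : Type*} {d : ℕ} (f : Param d → (ℕ → ℕ) → ℝ) (Y : ℤ → Ω → ℕ)
    (θ₀ : Param d) (n : ℕ) (ω : Ω) : Param d :=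
  (Real.sqrt n)⁻¹ • ∑ t ∈ Finset.Icc 1 n, score f θ₀ (pathAt Y t ω)

lemma measurable_coord_zero : Measurable fun s : ℤ → ℕ => (s 0 : ℝ) :=
  (measurable_from_nat (f := fun n : ℕ => (n : ℝ))).comp (measurable_pi_apply 0)

lemma inner_eq_sum {d : ℕ} (x v : Param d) : inner ℝ x v = ∑ i, v i * x i := by
  simp [PiLp.inner_apply]

lemma inner_sq_eq_sum {d : ℕ} (x v : Param d) :
    inner ℝ x v ^ 2 = ∑ i, ∑ j, v i * v j * (x i * x j) := by
  rw [inner_eq_sum, sq, Finset.sum_mul_sum]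
  exact Finset.sum_congr rfl fun i _ => Finset.sum_congr rfl fun j _ => by ring

lemma dotProduct_mulVec_eq_sum {d : ℕ} (A : Matrix (Fin d) (Fin d) ℝ) (v : Param d) :
    v.ofLp ⬝ᵥ A.mulVec v.ofLp = ∑ i, ∑ j, v i * v j * A i j := by
  simp only [dotProduct, Matrix.mulVec, Finset.mul_sum]
  exact Finset.sum_congr rfl fun i _ => Finset.sum_congr rfl fun j _ => by ring

lemma logGrad_inner_sq {d : ℕ} (f : Param d → (ℕ → ℕ) → ℝ) (θ₀ v : Param d) (y : ℕ → ℕ) :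
    inner ℝ (logGrad f θ₀ y) v ^ 2
      = (f θ₀ y)⁻¹ ^ 2 * ∑ i, ∑ j, v i * v j *
        ((∇ (fun ϑ => f ϑ y) θ₀) i * (∇ (fun ϑ => f ϑ y) θ₀) j) := by
  rw [logGrad, inner_smul_left, mul_pow, inner_sq_eq_sum]
  simp

lemma past_one_eq {Ω : Type*} {Y : ℤ → Ω → ℕ} (ω : Ω) : past Y 1 ω = pastOf (pathAt Y 1 ω) := by
  simpa using past_eq (Y := Y) 1 ω

lemma IsRegularFamily.norm_logGrad_le {d : ℕ} {f : Param d → (ℕ → ℕ) → ℝ} {Θ : Set (Param d)}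
    {θ₀ : Param d} {α : ℕ → ℝ≥0} {c C : ℝ} {y : ℕ → ℕ} (R : IsRegularFamily f Θ θ₀ α c C)
    (hy : tailSum α 0 y ≠ ∞) : ‖logGrad f θ₀ y‖ ≤ c⁻¹ * envelope α C y := by
  rw [logGrad, norm_smul, norm_inv, Real.norm_eq_abs, abs_of_pos (R.nonneg R.mem y)]
  have := R.envelope_nonneg y
  have := R.pos
  gcongr
  · exact R.lower _ R.mem y
  · exact R.norm_gradient_le hy

namespace IsCountModel

variable {Ω : Type*} [MeasurableSpace Ω] {d : ℕ} {P : Measure Ω} [IsProbabilityMeasure P]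
  {Y : ℤ → Ω → ℕ} {f : Param d → (ℕ → ℕ) → ℝ} {Θ : Set (Param d)} {θ₀ : Param d} {α : ℕ → ℝ≥0}
  {c C : ℝ}

omit [IsProbabilityMeasure P] in
lemma measurable_logGrad (H : IsCountModel P Y f Θ θ₀ α c C) : Measurable (logGrad f θ₀) :=
  (H.regular.measurable θ₀).inv.smul H.regular.measurable_gradient

omit [IsProbabilityMeasure P] in
lemma measurable_score (H : IsCountModel P Y f Θ θ₀ α c C) : Measurable (score f θ₀) :=
  (measurable_coord_zero.sub ((H.regular.measurable θ₀).comp measurable_pastOf)).smul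
    (H.measurable_logGrad.comp measurable_pastOf)

/-- Conditioning on the past replaces Y by λ, and λ(λ⁻¹⟨∂λ, v⟩)² is the integrand of v'Jv.
Integrability transfers from λ to Y because Y ≥ 0. The weight Y, and not λ, is the one that appears
in the remainder of the logarithm. -/
lemma integrable_obs_mul_inner_sq (H : IsCountModel P Y f Θ θ₀ α c C)
    (hJ : ∀ i j, Integrable (entryJ f Y θ₀ i j) P) (v : Param d) :
    Integrable (fun s : ℤ → ℕ => (s 0 : ℝ) * inner ℝ (logGrad f θ₀ (pastOf s)) v ^ 2)
      (pathLaw Y P) ∧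
    ∫ s, (s 0 : ℝ) * inner ℝ (logGrad f θ₀ (pastOf s)) v ^ 2 ∂(pathLaw Y P)
      = v.ofLp ⬝ᵥ (matJ f Y P θ₀).mulVec v.ofLp := by
  set g : Ω → ℝ := fun ω => inner ℝ (logGrad f θ₀ (pastOf (pathAt Y 1 ω))) v ^ 2 with hg
  have hgm : Measurable[pastSigma Y 1] g := by
    have h : Measurable fun y => inner ℝ (logGrad f θ₀ y) v ^ 2 :=
      (H.measurable_logGrad.inner measurable_const).pow_const 2
    exact h.comp (measurable_pastOf_pathAt (s := 1) (t := 1) le_rfl)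
  have hlam : ∀ ω, g ω * f θ₀ (pastOf (pathAt Y 1 ω))
      = ∑ i, ∑ j, v i * v j * entryJ f Y θ₀ i j ω := by
    intro ω
    have hpos := H.regular.nonneg H.regular.mem (pastOf (pathAt Y 1 ω))
    simp only [hg, logGrad_inner_sq, entryJ, lam, gradLam, past_one_eq, Finset.mul_sum,
      Finset.sum_mul]
    refine Finset.sum_congr rfl fun i _ => Finset.sum_congr rfl fun j _ => ?_
    field_simp
  have hsum : Integrable (fun ω => ∑ i, ∑ j, v i * v j * entryJ f Y θ₀ i j ω) P :=
    integrable_finsetSum _ fun i _ => integrable_finsetSum _ fun j _ => (hJ i j).const_mul _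
  have hY1 : Integrable (fun ω => (Y (1 : ℕ) ω : ℝ)) P := (H.memLp_obs 1).integrable one_le_two
  have hle := H.stationary.pastSigma_le 1
  have hce := H.condExp_obs 1
  have hint : Integrable (fun ω => g ω * (Y (1 : ℕ) ω : ℝ)) P := by
    refine integrable_mul_of_integrable_mul_condExp hle hY1 (fun ω => Nat.cast_nonneg _) hgm
      (fun ω => sq_nonneg _) (hsum.congr ?_)
    filter_upwards [hce] with ω hω
    rw [← hlam, ← hω]
    rfl
  have heq := H.integral_mul_innovation 1 hgm hint
  have hmeas : AEStronglyMeasurable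
      (fun s : ℤ → ℕ => (s 0 : ℝ) * inner ℝ (logGrad f θ₀ (pastOf s)) v ^ 2) (pathLaw Y P) :=
    (measurable_coord_zero.mul (((H.measurable_logGrad.comp measurable_pastOf).inner
      measurable_const).pow_const 2)).aestronglyMeasurable
  have hτ := H.stationary.measurePreserving_pathAt 1
  have hcomp : ∀ ω, (pathAt Y 1 ω 0 : ℝ) * inner ℝ (logGrad f θ₀ (pastOf (pathAt Y 1 ω))) v ^ 2
      = g ω * (Y (1 : ℕ) ω : ℝ) := by
    intro ω
    rw [pathAt_zero_apply, mul_comm]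
  constructor
  · have h1 : Integrable ((fun s : ℤ → ℕ => (s 0 : ℝ) *
        inner ℝ (logGrad f θ₀ (pastOf s)) v ^ 2) ∘ pathAt Y 1) P :=
      hint.congr (ae_of_all _ fun ω => (hcomp ω).symm)
    exact (hτ.integrable_comp hmeas).1 h1
  · rw [H.integral_pathLaw 1 hmeas]
    simp only [hcomp]
    rw [heq]
    simp only [hlam]
    rw [integral_finsetSum _ fun i _ => integrable_finsetSum _ fun j _ => (hJ i j).const_mul _,
      dotProduct_mulVec_eq_sum]
    refine Finset.sum_congr rfl fun i _ => ?_
    rw [integral_finsetSum _ fun j _ => (hJ i j).const_mul _]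
    refine Finset.sum_congr rfl fun j _ => ?_
    rw [integral_const_mul]
    rfl

/-- Conditioning on the past replaces the squared innovation by the conditional variance, which
gives the integrand of v'Iv. Square integrability of the score thus follows from the finiteness of
I, with no further moment of Y. -/
lemma memLp_score (H : IsCountModel P Y f Θ θ₀ α c C)
    (hI : ∀ i j, Integrable (entryI f Y P θ₀ i j) P) (v : Param d) :
    MemLp (fun s => inner ℝ (score f θ₀ s) v) 2 (pathLaw Y P) ∧
    ∫ s, inner ℝ (score f θ₀ s) v ^ 2 ∂(pathLaw Y P)
      = v.ofLp ⬝ᵥ (matI f Y P θ₀).mulVec v.ofLp := by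
  set g : Ω → ℝ := fun ω => inner ℝ (logGrad f θ₀ (pastOf (pathAt Y 1 ω))) v ^ 2 with hg
  set X : Ω → ℝ := fun ω => ((Y 1 ω : ℝ) - (P[(fun ω => (Y 1 ω : ℝ)) | pastSigma Y 1]) ω) ^ 2
    with hX
  have hgm : Measurable[pastSigma Y 1] g := by
    have h : Measurable fun y => inner ℝ (logGrad f θ₀ y) v ^ 2 :=
      (H.measurable_logGrad.inner measurable_const).pow_const 2
    exact h.comp (measurable_pastOf_pathAt (s := 1) (t := 1) le_rfl)
  have hle := H.stationary.pastSigma_le 1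
  have hY2 : MemLp (fun ω => (Y 1 ω : ℝ)) 2 P := H.memLp_obs 1
  have hXi : Integrable X P := (hY2.sub (hY2.condExp one_le_two)).integrable_sq
  have hvar : P[X | pastSigma Y 1] = condVar (pastSigma Y 1) (fun ω' => (Y 1 ω' : ℝ)) P := rfl
  have hlam : ∀ ω, g ω * (P[X | pastSigma Y 1]) ω
      = ∑ i, ∑ j, v i * v j * entryI f Y P θ₀ i j ω := by
    intro ω
    have hpos := H.regular.nonneg H.regular.mem (pastOf (pathAt Y 1 ω))
    rw [hvar]
    simp only [hg, logGrad_inner_sq, entryI, lam, gradLam, past_one_eq, Finset.mul_sum,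
      Finset.sum_mul]
    refine Finset.sum_congr rfl fun i _ => Finset.sum_congr rfl fun j _ => ?_
    field_simp
  have hsum : Integrable (fun ω => ∑ i, ∑ j, v i * v j * entryI f Y P θ₀ i j ω) P :=
    integrable_finsetSum _ fun i _ => integrable_finsetSum _ fun j _ => (hI i j).const_mul _
  have hint : Integrable (fun ω => g ω * X ω) P :=
    integrable_mul_of_integrable_mul_condExp hle hXi (fun ω => sq_nonneg _) hgm
      (fun ω => sq_nonneg _) (hsum.congr (ae_of_all _ fun ω => (hlam ω).symm))
  have heq := integral_mul_eq_integral_mul_condExp hle hXi hgm hint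
  have hmeas : Measurable (fun s => inner ℝ (score f θ₀ s) v) :=
    H.measurable_score.inner measurable_const
  have hτ := H.stationary.measurePreserving_pathAt 1
  have hcomp : (fun ω => inner ℝ (score f θ₀ (pathAt Y 1 ω)) v ^ 2) =ᵐ[P] fun ω => g ω * X ω := by
    have hce : P[(fun ω => (Y 1 ω : ℝ)) | pastSigma Y 1]
      =ᵐ[P] fun ω => f θ₀ (pastOf (pathAt Y 1 ω)) := H.condExp_obs 1
    filter_upwards [hce] with ω hω
    have h0 : pathAt Y 1 ω 0 = Y 1 ω := pathAt_zero_apply 1 ω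
    simp only [hX, hg, hω, score, inner_smul_left, mul_pow, h0]
    simp [mul_comm]
  constructor
  · rw [memLp_two_iff_integrable_sq hmeas.aestronglyMeasurable]
    have h1 : Integrable ((fun s => inner ℝ (score f θ₀ s) v ^ 2) ∘ pathAt Y 1) P :=
      hint.congr hcomp.symm
    exact (hτ.integrable_comp (hmeas.pow_const 2).aestronglyMeasurable).1 h1
  · rw [H.integral_pathLaw 1 (hmeas.pow_const 2).aestronglyMeasurable, integral_congr_ae hcomp, heq]
    simp only [hlam]
    rw [integral_finsetSum _ fun i _ => integrable_finsetSum _ fun j _ => (hI i j).const_mul _,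
      dotProduct_mulVec_eq_sum]
    refine Finset.sum_congr rfl fun i _ => ?_
    rw [integral_finsetSum _ fun j _ => (hI i j).const_mul _]
    refine Finset.sum_congr rfl fun j _ => ?_
    rw [integral_const_mul]
    rfl

omit [IsProbabilityMeasure P] in
lemma measurable_normScore (H : IsCountModel P Y f Θ θ₀ α c C) (n : ℕ) :
    Measurable (normScore f Y θ₀ n) := by
  have h : Measurable fun ω => ∑ t ∈ Finset.Icc 1 n, score f θ₀ (pathAt Y t ω) :=
    Finset.measurable_fun_sum _ fun t _ => H.measurable_score.comp
      (H.stationary.measurePreserving_pathAt t).measurable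
  exact h.const_smul (Real.sqrt n)⁻¹

/-- The central limit theorem for the normalized score. -/
theorem tendsto_charFun_normScore (H : IsCountModel P Y f Θ θ₀ α c C)
    (hI : ∀ i j, Integrable (entryI f Y P θ₀ i j) P) (v : Param d) :
    Tendsto (fun n => charFun (P.map (normScore f Y θ₀ n)) v) atTop
      (𝓝 (Complex.exp (-((v.ofLp ⬝ᵥ (matI f Y P θ₀).mulVec v.ofLp : ℝ) : ℂ) / 2))) := by
  have := isProbabilityMeasure_pathLaw H.stationary
  obtain ⟨hL, hint⟩ := H.memLp_score hI v
  have h := tendsto_integral_exp_martingale (P := P) H.stationary.ergodic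
    H.stationary.measurePreserving_pathAt pathAt_succ hL (fun t => pastSigma Y t)
    (fun t => H.stationary.pastSigma_le t)
    (fun s t hst => ?_) (fun t _ ξ hξ hξb => ?_)
  · rw [hint] at h
    refine h.congr fun n => ?_
    rw [charFun_apply, integral_map (H.measurable_normScore n).aemeasurable
      (by fun_prop)]
    refine integral_congr_ae (ae_of_all _ fun ω => ?_)
    simp only [normScore, inner_smul_left, sum_inner]
    simp
  · have h1 : Measurable[pastSigma Y t] fun ω => logGrad f θ₀ (pastOf (pathAt Y s ω)) :=
      H.measurable_logGrad.comp (measurable_pastOf_pathAt hst.le)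
    have h2 : Measurable[pastSigma Y t] fun ω => f θ₀ (pastOf (pathAt Y s ω)) :=
      (H.regular.measurable θ₀).comp (measurable_pastOf_pathAt hst.le)
    have h3 : Measurable[pastSigma Y t] fun ω => (pathAt Y s ω 0 : ℝ) :=
      (measurable_from_nat (f := fun n : ℕ => (n : ℝ))).comp (measurable_pathAt_zero hst)
    exact ((h3.sub h2).smul h1).inner measurable_const
  -- The martingale property. The multiplier of the innovation is ξ times the logarithmic gradient,
  -- hence unbounded, but the envelope puts it in L² and this is enough for its products with Y and
  -- with λ to be integrable.
  · have hg : Measurable[pastSigma Y t] fun ω => inner ℝ (logGrad f θ₀ (pastOf (pathAt Y t ω))) v :=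
      (H.measurable_logGrad.comp (measurable_pastOf_pathAt le_rfl)).inner measurable_const
    have hle := H.stationary.pastSigma_le t
    have hτ := H.stationary.measurePreserving_pathAt t
    have hE : MemLp (fun ω => envelope α C (pastOf (pathAt Y t ω))) 2 P :=
      H.memLp_envelope.comp_measurePreserving hτ
    have hgL : MemLp (fun ω => inner ℝ (logGrad f θ₀ (pastOf (pathAt Y t ω))) v) 2 P := by
      refine (hE.const_mul (c⁻¹ * ‖v‖)).mono (hg.mono hle le_rfl).aestronglyMeasurable ?_
      filter_upwards [H.ae_forall_tailSum_ne_top] with ω hω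
      refine (norm_inner_le_norm _ _).trans ?_
      rw [Real.norm_eq_abs, abs_of_nonneg (by
        have := H.regular.envelope_nonneg (pastOf (pathAt Y t ω))
        have := H.regular.pos
        positivity), mul_right_comm]
      gcongr
      exact H.regular.norm_logGrad_le (hω t)
    have hfm : Measurable[pastSigma Y t] fun ω => f θ₀ (pastOf (pathAt Y t ω)) :=
      (H.regular.measurable θ₀).comp (measurable_pastOf_pathAt le_rfl)
    have hfL : MemLp (fun ω => f θ₀ (pastOf (pathAt Y t ω))) 2 P := by
      refine hE.mono (hfm.mono hle le_rfl).aestronglyMeasurable ?_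
      filter_upwards [H.ae_forall_tailSum_ne_top] with ω hω
      rw [Real.norm_eq_abs, Real.norm_eq_abs,
        abs_of_pos (H.regular.nonneg H.regular.mem _)]
      exact (H.regular.le_envelope (hω t) H.regular.mem).trans (le_abs_self _)
    obtain ⟨K, hK⟩ := hξb
    have hb : ∀ g : Ω → ℝ, Integrable g P → Integrable (fun ω => ξ ω * g ω) P := fun g hg =>
      hg.bdd_mul (hξ.mono hle le_rfl).aestronglyMeasurable (ae_of_all _ hK)
    have i1 : Integrable (fun ω => ξ ω * (inner ℝ (logGrad f θ₀ (pastOf (pathAt Y t ω))) v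
        * (Y t ω : ℝ))) P := hb _ (hgL.integrable_mul (H.memLp_obs t))
    have i2 : Integrable (fun ω => ξ ω * (inner ℝ (logGrad f θ₀ (pastOf (pathAt Y t ω))) v
        * f θ₀ (pastOf (pathAt Y t ω)))) P := hb _ (hgL.integrable_mul hfL)
    have key := H.integral_mul_innovation t (hξ.mul hg)
      (i1.congr (ae_of_all _ fun ω => by simp only [Pi.mul_apply]; ring))
    have e : ∀ ω, ξ ω * inner ℝ (score f θ₀ (pathAt Y t ω)) v
        = ξ ω * (inner ℝ (logGrad f θ₀ (pastOf (pathAt Y t ω))) v * (Y t ω : ℝ))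
          - ξ ω * (inner ℝ (logGrad f θ₀ (pastOf (pathAt Y t ω))) v
            * f θ₀ (pastOf (pathAt Y t ω))) := by
      intro ω
      simp only [score, inner_smul_left, pathAt_zero_apply]
      simp only [conj_trivial]
      ring
    simp only [e]
    rw [integral_sub i1 i2, sub_eq_zero]
    simpa only [mul_assoc, Pi.mul_apply] using key

end IsCountModel

/-! ### Sums with terms of order t^{-h}, h > 1/2 -/

section Rate

lemma sum_Icc_inv_sqrt_le (n : ℕ) : ∑ t ∈ Finset.Icc 1 n, (Real.sqrt t)⁻¹ ≤ 2 * Real.sqrt n := by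
  rw [sum_Icc_one_eq_sum_range]
  induction n with
  | zero => simp
  | succ n ih =>
    rw [Finset.sum_range_succ]
    have h1 : 0 ≤ Real.sqrt n := Real.sqrt_nonneg _
    have h2 : 0 < Real.sqrt ((n + 1 : ℕ) : ℝ) := Real.sqrt_pos.2 (by positivity)
    have h3 : Real.sqrt n ^ 2 = n := Real.sq_sqrt (Nat.cast_nonneg n)
    have h4 : Real.sqrt ((n + 1 : ℕ) : ℝ) ^ 2 = n + 1 := by
      rw [Real.sq_sqrt (by positivity)]
      push_cast
      ring
    have h5 : (Real.sqrt ((n + 1 : ℕ) : ℝ))⁻¹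
        ≤ 2 * (Real.sqrt ((n + 1 : ℕ) : ℝ) - Real.sqrt n) := by
      rw [inv_le_iff_one_le_mul₀ h2]
      nlinarith [sq_nonneg (Real.sqrt ((n + 1 : ℕ) : ℝ) - Real.sqrt n)]
    linarith

/-- If `√t a_t → 0`, then `n^{-1/2} ∑_{t ≤ n} a_t → 0`. -/
lemma tendsto_inv_sqrt_mul_sum {a : ℕ → ℝ} (ha : Tendsto (fun t : ℕ => Real.sqrt t * a t) atTop (𝓝 0)) :
    Tendsto (fun n : ℕ => (Real.sqrt n)⁻¹ * ∑ t ∈ Finset.Icc 1 n, a t) atTop (𝓝 0) := by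
  rw [Metric.tendsto_atTop] at ha
  have hs : Tendsto (fun n : ℕ => Real.sqrt n) atTop atTop :=
    Real.tendsto_sqrt_atTop.comp tendsto_natCast_atTop_atTop
  rw [Metric.tendsto_atTop]
  intro ε hε
  obtain ⟨N, hN⟩ := ha (ε / 4) (by positivity)
  -- The terms up to time N contribute a constant, eventually below (ε/2)√n; for the later ones |a
  -- t| ≤ (ε/4)/√t and ∑ 1/√t ≤ 2√n.
  set B := ∑ t ∈ Finset.range (N + 1), |a t| with hB
  have hev : ∀ᶠ n : ℕ in atTop, B < ε / 2 * Real.sqrt n ∧ 1 ≤ n := by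
    filter_upwards [(hs.const_mul_atTop (by positivity : 0 < ε / 2)).eventually_gt_atTop B,
      eventually_ge_atTop 1] with n h1 h2
    exact ⟨h1, h2⟩
  obtain ⟨M, hM⟩ := eventually_atTop.1 hev
  refine ⟨M, fun n hn => ?_⟩
  obtain ⟨h1, h2⟩ := hM n hn
  have hpos : 0 < Real.sqrt n := Real.sqrt_pos.2 (by exact_mod_cast h2)
  rw [dist_zero_right, Real.norm_eq_abs, abs_mul, abs_of_pos (inv_pos.2 hpos), inv_mul_lt_iff₀ hpos]
  have hterm : ∀ t ∈ Finset.Icc 1 n, |a t| ≤ (if t ∈ Finset.range (N + 1) then |a t| else 0)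
      + ε / 4 * (Real.sqrt t)⁻¹ := by
    intro t ht
    have ht1 : 0 < Real.sqrt t := Real.sqrt_pos.2 (by
      have := (Finset.mem_Icc.1 ht).1
      exact_mod_cast this)
    split_ifs with h
    · have : 0 ≤ ε / 4 * (Real.sqrt t)⁻¹ := by positivity
      linarith
    · have h3 := hN t (by simp at h; omega)
      rw [dist_zero_right, Real.norm_eq_abs, abs_mul, abs_of_pos ht1] at h3
      rw [zero_add, ← div_eq_mul_inv, le_div_iff₀ ht1]
      linarith
  calc |∑ t ∈ Finset.Icc 1 n, a t| ≤ ∑ t ∈ Finset.Icc 1 n, |a t| := Finset.abs_sum_le_sum_abs _ _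
    _ ≤ ∑ t ∈ Finset.Icc 1 n, ((if t ∈ Finset.range (N + 1) then |a t| else 0)
      + ε / 4 * (Real.sqrt t)⁻¹) := Finset.sum_le_sum hterm
    _ ≤ B + ε / 4 * (2 * Real.sqrt n) := by
      rw [Finset.sum_add_distrib, ← Finset.mul_sum]
      gcongr
      · rw [← Finset.sum_filter]
        refine Finset.sum_le_sum_of_subset_of_nonneg (fun t ht => ?_) fun _ _ _ => abs_nonneg _
        exact (Finset.mem_filter.1 ht).2
      · exact sum_Icc_inv_sqrt_le n
    _ < Real.sqrt n * ε := by linarith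

lemma tendsto_sqrt_mul_rpow {h : ℝ} (hh : 1 / 2 < h) (K : ℝ) :
    Tendsto (fun t : ℕ => Real.sqrt t * (K * (t : ℝ) ^ (-h))) atTop (𝓝 0) := by
  have h1 := ((tendsto_rpow_neg_atTop (y := h - 1 / 2) (by linarith)).comp
    tendsto_natCast_atTop_atTop).const_mul K
  rw [mul_zero] at h1
  refine h1.congr' ?_
  filter_upwards [eventually_ge_atTop 1] with t ht
  have ht' : (0 : ℝ) < t := by exact_mod_cast ht
  simp only [Function.comp_apply]
  rw [Real.sqrt_eq_rpow, mul_left_comm, ← Real.rpow_add ht']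
  ring_nf

variable {Ω : Type*} [MeasurableSpace Ω] {P : Measure Ω} [IsFiniteMeasure P]

/-- If `E D_t ≤ b_t` and `b_t y_t = O(t^{-h})` with `h > 1/2`, then `n^{-1/2} ∑_{t ≤ n} y_t D_t`
tends to zero in probability. -/
theorem tendsto_whp_inv_sqrt_mul_sum {h : ℝ} (hh : 1 / 2 < h) {D : ℕ → Ω → ℝ}
    (hD : ∀ t, Measurable (D t)) (hD0 : ∀ t ω, 0 ≤ D t ω) {y : ℕ → Ω → ℝ≥0}
    (hy : ∀ t, Measurable (y t)) {b : ℕ → ℝ≥0∞} (hDb : ∀ t, ∫⁻ ω, ‖D t ω‖ₑ ∂P ≤ b t)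
    (hb : ∀ᵐ ω ∂P, IsPowerBounded h fun t => b t * (y t ω : ℝ≥0∞)) :
    Tendsto (fun x : ℕ × Ω => (Real.sqrt x.1)⁻¹ * ∑ t ∈ Finset.Icc 1 x.1, (y t x.2 : ℝ) * D t x.2)
      (whp P) (𝓝 0) := by
  -- The random bound is made uniform on `E N`, and these events exhaust the probability. There, for
  -- t ≥ N, the product y_t D_t is at most N t^{-h} D_t / b_t, which no longer involves y_t and has
  -- mean at most N t^{-h}. The dependence between y_t and D_t therefore plays no role.
  set E : ℕ → Set Ω := fun N => {ω | ∀ t ≥ N, b t * (y t ω : ℝ≥0∞) ≤ N * (t : ℝ≥0∞) ^ (-h)} with hE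
  refine tendsto_whp_of_exhaust (fun N => {x : ℕ × Ω | x.2 ∈ E N}) (exhaust_of_monotone E
    (fun N N' hN ω hω t ht => (hω t (hN.trans ht)).trans (by gcongr)) (fun N => ?_) ?_) fun N => ?_
  · simp only [hE, Set.ofPred_forall]
    exact MeasurableSet.iInter fun t => MeasurableSet.iInter fun _ =>
      measurableSet_le ((hy t).coe_nnreal_ennreal.const_mul _) measurable_const
  · filter_upwards [hb] with ω hω
    obtain ⟨K, hK⟩ := hω
    obtain ⟨N, hN⟩ := eventually_atTop.1 hK
    obtain ⟨N', hN'⟩ := exists_nat_ge K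
    refine ⟨max N N', fun t ht => (hN t ((le_max_left _ _).trans ht)).trans ?_⟩
    gcongr
    calc (K : ℝ≥0∞) ≤ (N' : ℝ≥0) := ENNReal.coe_le_coe.2 hN'
      _ = (N' : ℝ≥0∞) := by simp
      _ ≤ _ := by exact_mod_cast le_max_right _ _
  · set W : ℕ → Ω → ℝ := fun t ω => ((N : ℝ≥0∞) * (t : ℝ≥0∞) ^ (-h) * (‖D t ω‖ₑ / b t)).toReal
      with hW
    have hWm : ∀ t, Measurable (W t) := fun t =>
      (((hD t).enorm.div_const _).const_mul _).ennreal_toReal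
    have hpow : ∀ t : ℕ, 1 ≤ t → (t : ℝ≥0∞) ^ (-h) = ENNReal.ofReal ((t : ℝ) ^ (-h)) := by
      intro t ht
      rw [← ENNReal.ofReal_rpow_of_pos (by exact_mod_cast ht)]
      simp
    have hDae : ∀ t, b t ≠ ∞ → ∀ᵐ ω ∂P, b t = 0 → D t ω = 0 := by
      intro t _
      by_cases h0 : b t = 0
      · have h1 := hDb t
        rw [h0, nonpos_iff_eq_zero, lintegral_eq_zero_iff (hD t).enorm] at h1
        filter_upwards [h1] with ω hω _
        simpa using hω
      · exact ae_of_all _ fun ω h => absurd h h0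
    have hall : ∀ᵐ ω ∂P, ∀ t, b t ≠ ∞ → b t = 0 → D t ω = 0 := by
      rw [ae_all_iff]
      intro t
      by_cases h : b t = ∞
      · exact ae_of_all _ fun ω h' => absurd h h'
      · filter_upwards [hDae t h] with ω hω _
        exact hω
    have hWle : ∀ t, 1 ≤ t → ∫⁻ ω, ‖W t ω‖ₑ ∂P ≤ ENNReal.ofReal (N * (t : ℝ) ^ (-h)) := by
      intro t ht
      calc ∫⁻ ω, ‖W t ω‖ₑ ∂P
          ≤ ∫⁻ ω, (N : ℝ≥0∞) * (t : ℝ≥0∞) ^ (-h) * (‖D t ω‖ₑ / b t) ∂P := by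
            refine lintegral_mono fun ω => ?_
            simp only [hW]
            rw [Real.enorm_eq_ofReal ENNReal.toReal_nonneg]
            exact ENNReal.ofReal_toReal_le
        _ = (N : ℝ≥0∞) * (t : ℝ≥0∞) ^ (-h) * ((∫⁻ ω, ‖D t ω‖ₑ ∂P) / b t) := by
            rw [lintegral_const_mul _ ((hD t).enorm.div_const _)]
            simp only [div_eq_mul_inv]
            rw [lintegral_mul_const _ (hD t).enorm]
        _ ≤ (N : ℝ≥0∞) * (t : ℝ≥0∞) ^ (-h) * 1 := by
            gcongr
            exact ENNReal.div_le_of_le_mul (by simpa using hDb t)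
        _ = _ := by
            rw [mul_one, hpow t ht, ENNReal.ofReal_mul (Nat.cast_nonneg _), ENNReal.ofReal_natCast]
    have hX1 : Tendsto (fun x : ℕ × Ω => (Real.sqrt x.1)⁻¹ * ∑ t ∈ Finset.Icc 1 x.1, W t x.2)
        (whp P) (𝓝 0) := by
      refine tendsto_whp_zero_of_lintegral
        (X := fun n ω => (Real.sqrt n)⁻¹ * ∑ t ∈ Finset.Icc 1 n, W t ω)
        (fun n => ((Finset.measurable_fun_sum _ fun t _ => hWm t).const_mul _).aemeasurable) ?_
      have hlim := ENNReal.tendsto_ofReal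
        (tendsto_inv_sqrt_mul_sum (tendsto_sqrt_mul_rpow hh N))
      rw [ENNReal.ofReal_zero] at hlim
      refine tendsto_of_tendsto_of_tendsto_of_le_of_le tendsto_const_nhds hlim
        (fun _ => zero_le) fun n => ?_
      have hnn : 0 ≤ (Real.sqrt n)⁻¹ := by positivity
      calc ∫⁻ ω, ‖(Real.sqrt n)⁻¹ * ∑ t ∈ Finset.Icc 1 n, W t ω‖ₑ ∂P
          ≤ ∫⁻ ω, ENNReal.ofReal (Real.sqrt n)⁻¹ * ∑ t ∈ Finset.Icc 1 n, ‖W t ω‖ₑ ∂P := by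
            refine lintegral_mono fun ω => ?_
            beta_reduce
            rw [enorm_mul, Real.enorm_eq_ofReal hnn]
            gcongr
            exact enorm_sum_le _ _
        _ = ENNReal.ofReal (Real.sqrt n)⁻¹ * ∑ t ∈ Finset.Icc 1 n, ∫⁻ ω, ‖W t ω‖ₑ ∂P := by
            rw [lintegral_const_mul _ (Finset.measurable_fun_sum _ fun t _ => (hWm t).enorm),
              lintegral_finsetSum _ fun t _ => (hWm t).enorm]
        _ ≤ ENNReal.ofReal (Real.sqrt n)⁻¹ *
            ∑ t ∈ Finset.Icc 1 n, ENNReal.ofReal (N * (t : ℝ) ^ (-h)) := by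
            gcongr with t ht
            exact hWle t (Finset.mem_Icc.1 ht).1
        _ = _ := by
            rw [ENNReal.ofReal_mul hnn, ENNReal.ofReal_sum_of_nonneg fun t _ => by positivity]
    have hX2 : Tendsto (fun x : ℕ × Ω => (Real.sqrt x.1)⁻¹ *
        ∑ t ∈ Finset.range N, (y t x.2 : ℝ) * D t x.2) (whp P) (𝓝 0) := by
      refine tendsto_whp_of_ae (X := fun n ω => (Real.sqrt n)⁻¹ *
        ∑ t ∈ Finset.range N, (y t ω : ℝ) * D t ω) (fun n => ((Finset.measurable_fun_sum _ fun t _ =>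
          (hy t).coe_nnreal_real.mul (hD t)).const_mul _).aestronglyMeasurable)
        (ae_of_all _ fun ω => ?_)
      have h1 : Tendsto (fun n : ℕ => (Real.sqrt n)⁻¹) atTop (𝓝 0) :=
        (Real.tendsto_sqrt_atTop.comp tendsto_natCast_atTop_atTop).inv_tendsto_atTop
      simpa using h1.mul_const (∑ t ∈ Finset.range N, (y t ω : ℝ) * D t ω)
    have hX := ((hX2.add hX1).mono_left (inf_le_left (b := 𝓟 {x : ℕ × Ω | x.2 ∈ E N})))
    rw [add_zero] at hX
    have hev : ∀ᶠ x : ℕ × Ω in whp P, ∀ t, b t ≠ ∞ → b t = 0 → D t x.2 = 0 :=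
      eventually_whp_of_ae (Eventually.of_forall fun _ => hall)
    refine tendsto_of_tendsto_of_tendsto_of_le_of_le' tendsto_const_nhds hX
      (Eventually.of_forall fun x => mul_nonneg (by positivity) (Finset.sum_nonneg fun t _ =>
        mul_nonneg (NNReal.coe_nonneg _) (hD0 _ _))) ?_
    filter_upwards [hev.filter_mono inf_le_left, mem_inf_of_right (mem_principal_self _)]
      with x hx hxE
    rw [← mul_add]
    refine mul_le_mul_of_nonneg_left ?_ (by positivity)
    have hterm : ∀ t ∈ Finset.Icc 1 x.1, (y t x.2 : ℝ) * D t x.2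
        ≤ (if t ∈ Finset.range N then (y t x.2 : ℝ) * D t x.2 else 0) + W t x.2 := by
      intro t ht
      have ht1 := (Finset.mem_Icc.1 ht).1
      split_ifs with hN
      · exact le_add_of_nonneg_right ENNReal.toReal_nonneg
      rw [zero_add]
      have hEt : b t * (y t x.2 : ℝ≥0∞) ≤ N * (t : ℝ≥0∞) ^ (-h) :=
        hxE t (by simpa using hN)
      have hfin : (N : ℝ≥0∞) * (t : ℝ≥0∞) ^ (-h) ≠ ∞ := by
        rw [hpow t ht1]
        exact ENNReal.mul_ne_top (ENNReal.natCast_ne_top _) ENNReal.ofReal_ne_top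
      -- The two degenerate values of b_t, for which D_t / b_t is useless: an infinite b_t forces
      -- y_t = 0 on the event, and b_t = 0 forces D_t = 0 almost surely.
      by_cases hbt : b t = ∞
      · have hy0 : y t x.2 = 0 := by
          by_contra hne
          rw [hbt, ENNReal.top_mul (by simpa using hne)] at hEt
          exact hfin (top_le_iff.1 hEt)
        rw [hy0, NNReal.coe_zero, zero_mul]
        exact ENNReal.toReal_nonneg
      by_cases hb0 : b t = 0
      · rw [hx t hbt hb0, mul_zero]
        exact ENNReal.toReal_nonneg
      have hle : (y t x.2 : ℝ≥0∞) * ‖D t x.2‖ₑ ≤ N * (t : ℝ≥0∞) ^ (-h) * (‖D t x.2‖ₑ / b t) := by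
        calc (y t x.2 : ℝ≥0∞) * ‖D t x.2‖ₑ = b t * (y t x.2 : ℝ≥0∞) * (‖D t x.2‖ₑ / b t) := by
              rw [mul_comm (b t), mul_assoc, ENNReal.mul_div_cancel hb0 hbt]
          _ ≤ _ := by gcongr
      have h2 := ENNReal.toReal_mono (ENNReal.mul_ne_top hfin (ENNReal.div_ne_top (by simp) hb0)) hle
      rw [ENNReal.toReal_mul, toReal_enorm, Real.norm_eq_abs, abs_of_nonneg (hD0 _ _)] at h2
      exact h2
    refine (Finset.sum_le_sum hterm).trans ?_
    rw [Finset.sum_add_distrib, ← Finset.sum_filter]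
    gcongr ?_ + _
    refine Finset.sum_le_sum_of_subset_of_nonneg (fun t ht => (Finset.mem_filter.1 ht).2)
      fun _ _ _ => mul_nonneg (NNReal.coe_nonneg _) (hD0 _ _)

end Rate

/-! ### Negligibility of the initial values in the score, and tightness of the score -/

namespace IsCountModel

variable {Ω : Type*} [MeasurableSpace Ω] {d : ℕ} {P : Measure Ω} [IsProbabilityMeasure P]
  {Y : ℤ → Ω → ℕ} {f : Param d → (ℕ → ℕ) → ℝ} {Θ : Set (Param d)} {θ₀ : Param d} {α : ℕ → ℝ≥0}
  {c C : ℝ}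

lemma _root_.CountSeries.IsPowerBounded.mono {h : ℝ} {x y : ℕ → ℝ≥0∞} (hx : IsPowerBounded h x)
    (hyx : ∀ t, y t ≤ x t) : IsPowerBounded h y := by
  obtain ⟨K, hK⟩ := hx
  exact ⟨K, hK.mono fun t ht => (hyx t).trans ht⟩

/-- The effect of the initial values on the gradients at the true parameter. -/
noncomputable def gradDiff (f : Param d → (ℕ → ℕ) → ℝ) (Y : ℤ → Ω → ℕ) (θ₀ : Param d) (t : ℕ)
    (ω : Ω) : ℝ :=
  ‖∇ (fun ϑ => f ϑ (trunc t (pastOf (pathAt Y t ω)))) θ₀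
    - ∇ (fun ϑ => f ϑ (pastOf (pathAt Y t ω))) θ₀‖

omit [IsProbabilityMeasure P] in
lemma measurable_gradDiff (H : IsCountModel P Y f Θ θ₀ α c C) (t : ℕ) :
    Measurable (gradDiff f Y θ₀ t) := by
  have hτ := (H.stationary.measurePreserving_pathAt t).measurable
  have hg := H.regular.measurable_gradient
  exact ((hg.comp ((measurable_trunc t).comp (measurable_pastOf.comp hτ))).sub
    (hg.comp (measurable_pastOf.comp hτ))).norm

omit [IsProbabilityMeasure P] in
lemma lintegral_gradDiff_le (H : IsCountModel P Y f Θ θ₀ α c C) (t : ℕ) :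
    ∫⁻ ω, ‖gradDiff f Y θ₀ t ω‖ₑ ∂P ≤ bCoef f Y P Θ t := by
  refine le_trans (le_of_eq ?_) (le_iSup₂ (f := fun θ (_ : θ ∈ Θ) =>
    ∫⁻ ω, ‖gradLamHat f Y t θ ω - gradLam f Y t θ ω‖ₑ ∂P) θ₀ H.regular.mem)
  simp only [gradLamHat, gradLam, lamHat, lam, obsPast_eq, past_eq, gradDiff, enorm_norm]

lemma tendsto_gradDiff (H : IsCountModel P Y f Θ θ₀ α c C) (hrate : InitialEffectRate f Y P Θ) :
    Tendsto (fun x : ℕ × Ω => (Real.sqrt x.1)⁻¹ * ∑ t ∈ Finset.Icc 1 x.1, gradDiff f Y θ₀ t x.2)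
      (whp P) (𝓝 0) := by
  obtain ⟨h, hh, h1, -, -⟩ := hrate
  have := tendsto_whp_inv_sqrt_mul_sum (P := P) hh H.measurable_gradDiff
    (fun _ _ => norm_nonneg _) (y := fun _ _ => 1) (fun _ => measurable_const)
    H.lintegral_gradDiff_le (ae_of_all _ fun ω => by simpa using h1)
  simpa using this

/-- The effect of the initial values on the logarithmic gradients at the true parameter. -/
noncomputable def logGradDiff (f : Param d → (ℕ → ℕ) → ℝ) (Y : ℤ → Ω → ℕ) (θ₀ : Param d) (t : ℕ)
    (ω : Ω) : ℝ :=
  ‖logGrad f θ₀ (trunc t (pastOf (pathAt Y t ω))) - logGrad f θ₀ (pastOf (pathAt Y t ω))‖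

/-- With g the gradient and l = g/f, one has l(y) - l(y') = f(y)⁻¹ [(g(y) - g(y')) - (f(y) - f(y'))
l(y')]. The two terms are shaped to match the rates assumed on b_t Y_t and on a_t d_t Y_t. -/
lemma _root_.CountSeries.IsRegularFamily.norm_logGrad_sub_le (R : IsRegularFamily f Θ θ₀ α c C)
    (y y' : ℕ → ℕ) :
    ‖logGrad f θ₀ y - logGrad f θ₀ y'‖ ≤ c⁻¹ * (‖∇ (fun ϑ => f ϑ y) θ₀ - ∇ (fun ϑ => f ϑ y') θ₀‖
      + |f θ₀ y - f θ₀ y'| * ‖logGrad f θ₀ y'‖) := by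
  have h1 := R.nonneg R.mem y
  have h2 := R.nonneg R.mem y'
  have e : logGrad f θ₀ y - logGrad f θ₀ y' = (f θ₀ y)⁻¹ •
      ((∇ (fun ϑ => f ϑ y) θ₀ - ∇ (fun ϑ => f ϑ y') θ₀)
        - (f θ₀ y - f θ₀ y') • logGrad f θ₀ y') := by
    simp only [logGrad, smul_sub, smul_smul, sub_mul, sub_smul]
    rw [inv_mul_cancel_left₀ h1.ne', mul_inv_cancel₀ h2.ne', mul_one]
    abel
  rw [e, norm_smul, norm_inv, Real.norm_eq_abs, abs_of_pos h1]
  have hc := R.pos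
  gcongr
  · exact R.lower _ R.mem y
  · refine (norm_sub_le _ _).trans (add_le_add le_rfl (le_of_eq ?_))
    rw [norm_smul, Real.norm_eq_abs]

/-- The gradient term has weight Y_t and mean at most b_t. The other term has weight |λ̂_t - λ_t|
Y_t, at most a_t Y_t, against ‖λ_t⁻¹ ∂λ_t‖, whose mean is at most d_t. Each assumed rate disposes of
one of them. -/
lemma tendsto_obs_mul_logGradDiff (H : IsCountModel P Y f Θ θ₀ α c C)
    (hrate : InitialEffectRate f Y P Θ) :
    Tendsto (fun x : ℕ × Ω => (Real.sqrt x.1)⁻¹ * ∑ t ∈ Finset.Icc 1 x.1,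
      (Y t x.2 : ℝ) * logGradDiff f Y θ₀ t x.2) (whp P) (𝓝 0) := by
  obtain ⟨h, hh, -, h2, h3⟩ := hrate
  have hYm : ∀ t : ℕ, Measurable fun ω => (Y t ω : ℝ≥0) := fun t =>
    (measurable_from_nat (f := fun n : ℕ => (n : ℝ≥0))).comp (H.stationary.measurable t)
  have T1 := tendsto_whp_inv_sqrt_mul_sum (P := P) hh H.measurable_gradDiff
    (fun _ _ => norm_nonneg _) (y := fun t ω => (Y t ω : ℝ≥0)) hYm
    H.lintegral_gradDiff_le (by simpa using h2)
  have hp : ∀ t : ℕ, Measurable fun ω => pastOf (pathAt Y t ω) := fun t =>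
    measurable_pastOf.comp (H.stationary.measurePreserving_pathAt t).measurable
  have hlam : ∀ t : ℕ, Measurable fun ω =>
      f θ₀ (trunc t (pastOf (pathAt Y t ω))) - f θ₀ (pastOf (pathAt Y t ω)) := fun t =>
    ((H.regular.measurable θ₀).comp ((measurable_trunc t).comp (hp t))).sub
      ((H.regular.measurable θ₀).comp (hp t))
  have T2 := tendsto_whp_inv_sqrt_mul_sum (P := P) hh
    (D := fun t ω => ‖logGrad f θ₀ (pastOf (pathAt Y t ω))‖)
    (fun t => (H.measurable_logGrad.comp (hp t)).norm)
    (fun _ _ => norm_nonneg _) (y := fun t ω => ‖f θ₀ (trunc t (pastOf (pathAt Y t ω)))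
      - f θ₀ (pastOf (pathAt Y t ω))‖₊ * (Y t ω : ℝ≥0))
    (fun t => (hlam t).nnnorm.mul (hYm t)) (b := fun t => dCoef f Y P Θ t)
    (fun t => by
      refine le_trans (le_of_eq ?_) ((le_max_right _ _).trans
        (le_iSup₂ (f := fun θ (_ : θ ∈ Θ) => max
          (∫⁻ ω, ‖(lamHat f Y t θ ω)⁻¹ • gradLamHat f Y t θ ω‖ₑ ∂P)
          (∫⁻ ω, ‖(lam f Y t θ ω)⁻¹ • gradLam f Y t θ ω‖ₑ ∂P)) θ₀ H.regular.mem))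
      simp only [gradLam, lam, past_eq, logGrad, enorm_norm])
    (by
      filter_upwards [h3] with ω hω
      refine hω.mono fun t => ?_
      have ha : ‖f θ₀ (trunc t (pastOf (pathAt Y t ω))) - f θ₀ (pastOf (pathAt Y t ω))‖ₑ
          ≤ aCoef f Y Θ t ω := by
        refine le_trans (le_of_eq ?_) (le_iSup₂ (f := fun θ (_ : θ ∈ Θ) =>
          ‖lamHat f Y t θ ω - lam f Y t θ ω‖ₑ) θ₀ H.regular.mem)
        simp only [lamHat, lam, obsPast_eq, past_eq]
      rw [ENNReal.coe_mul, ← enorm_eq_nnnorm, ← mul_assoc, mul_comm (dCoef f Y P Θ t)]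
      push_cast
      gcongr)
  have T := (T1.add T2).const_mul c⁻¹
  rw [add_zero, mul_zero] at T
  refine tendsto_of_tendsto_of_tendsto_of_le_of_le tendsto_const_nhds T
    (fun x => mul_nonneg (by positivity) (Finset.sum_nonneg fun t _ =>
      mul_nonneg (Nat.cast_nonneg _) (norm_nonneg _))) fun x => ?_
  beta_reduce
  rw [← mul_add, mul_left_comm, ← Finset.sum_add_distrib, Finset.mul_sum (a := c⁻¹)]
  refine mul_le_mul_of_nonneg_left (Finset.sum_le_sum fun t _ => ?_) (by positivity)
  refine (mul_le_mul_of_nonneg_left (H.regular.norm_logGrad_sub_le _ _)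
    (Nat.cast_nonneg _)).trans (le_of_eq ?_)
  simp only [NNReal.coe_mul, NNReal.coe_natCast, coe_nnnorm, Real.norm_eq_abs, gradDiff]
  ring

/-- The normalized scores are bounded in probability. -/
lemma exhaust_normScore (H : IsCountModel P Y f Θ θ₀ α c C)
    (hI : ∀ i j, Integrable (entryI f Y P θ₀ i j) P) (ε : ℝ≥0∞) (hε : 0 < ε) :
    ∃ K : ℕ, ∀ᶠ n : ℕ in atTop,
      P {ω | (n, ω) ∉ {x : ℕ × Ω | ‖normScore f Y θ₀ x.1 x.2‖ ≤ K}} ≤ ε := by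
  have hpm : ∀ n, IsProbabilityMeasure (P.map (normScore f Y θ₀ n)) := fun n =>
    Measure.isProbabilityMeasure_map (H.measurable_normScore n).aemeasurable
  -- Convergence of the characteristic functions to a function continuous at zero implies tightness,
  -- so the events ‖Z_n‖ ≤ K are exhausting.
  have ht : IsTightMeasureSet (Set.range fun n => P.map (normScore f Y θ₀ n)) := by
    refine isTightMeasureSet_of_tendsto_charFun (f := fun v : Param d =>
      Complex.exp (-((v.ofLp ⬝ᵥ (matI f Y P θ₀).mulVec v.ofLp : ℝ) : ℂ) / 2)) ?_ 
      (fun v => H.tendsto_charFun_normScore hI v)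
    have : Continuous fun v : Param d => v.ofLp ⬝ᵥ (matI f Y P θ₀).mulVec v.ofLp := by
      fun_prop
    fun_prop
  rw [isTightMeasureSet_iff_tendsto_measure_norm_gt] at ht
  have h2 := (ht.comp tendsto_natCast_atTop_atTop).eventually (eventually_le_nhds hε)
  obtain ⟨K, hK⟩ := h2.exists
  refine ⟨K, Eventually.of_forall fun n => ?_⟩
  have h3 := (le_iSup₂ (f := fun (μ : Measure (Param d))
    (_ : μ ∈ Set.range fun n => P.map (normScore f Y θ₀ n)) => μ {x | (K : ℝ) < ‖x‖}) _
    (Set.mem_range_self n)).trans hK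
  rw [Measure.map_apply (H.measurable_normScore n)
    (measurableSet_lt measurable_const measurable_norm)] at h3
  simpa [Set.preimage] using h3

end IsCountModel

/-! ### The Poisson quasi-likelihood and its separation of parameters -/

lemma abs_log_sub_log_le {c x y : ℝ} (hc : 0 < c) (hx : c ≤ x) (hy : c ≤ y) :
    |Real.log x - Real.log y| ≤ c⁻¹ * |x - y| := by
  have key : ∀ u v : ℝ, c ≤ u → c ≤ v → Real.log u - Real.log v ≤ c⁻¹ * |u - v| := by
    intro u v hu hv
    have hu0 := hc.trans_le hu
    have hv0 := hc.trans_le hv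
    rw [← Real.log_div hu0.ne' hv0.ne']
    refine (Real.log_le_sub_one_of_pos (div_pos hu0 hv0)).trans ?_
    have : u / v - 1 = v⁻¹ * (u - v) := by field_simp
    rw [this]
    calc v⁻¹ * (u - v) ≤ v⁻¹ * |u - v| := by gcongr; exact le_abs_self _
      _ ≤ c⁻¹ * |u - v| := by gcongr
  rw [abs_sub_le_iff]
  refine ⟨key x y hx hy, ?_⟩
  rw [abs_sub_comm]
  exact key y x hy hx

/-- The Poisson quasi-log-likelihood of an observation `a` with intensity `x`. -/
noncomputable def poissonLogLik (a x : ℝ) : ℝ := a * Real.log x - x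

lemma abs_poissonLogLik_sub_le {a c x y : ℝ} (hc : 0 < c) (ha : 0 ≤ a) (hx : c ≤ x) (hy : c ≤ y) :
    |poissonLogLik a x - poissonLogLik a y| ≤ (a * c⁻¹ + 1) * |x - y| := by
  have e : poissonLogLik a x - poissonLogLik a y
      = a * (Real.log x - Real.log y) - (x - y) := by
    unfold poissonLogLik
    ring
  rw [e]
  refine (abs_sub _ _).trans ?_
  rw [abs_mul, abs_of_nonneg ha, add_mul, one_mul, mul_assoc]
  gcongr
  exact abs_log_sub_log_le hc hx hy

lemma measurable_poissonLogLik {S : Type*} [MeasurableSpace S] {a x : S → ℝ} (ha : Measurable a)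
    (hx : Measurable x) : Measurable fun s => poissonLogLik (a s) (x s) :=
  (ha.mul (Real.measurable_log.comp hx)).sub hx

lemma quasiLogLik_eq {Ω : Type*} {d : ℕ} (f : Param d → (ℕ → ℕ) → ℝ) (Y : ℤ → Ω → ℕ) (n : ℕ)
    (θ : Param d) (ω : Ω) : quasiLogLik f Y n θ ω = ∑ t ∈ Finset.Icc 1 n,
      poissonLogLik (Y t ω) (f θ (trunc t (pastOf (pathAt Y t ω)))) := by
  simp only [quasiLogLik, lamHat, obsPast_eq, poissonLogLik]

namespace IsCountModel

variable {Ω : Type*} [MeasurableSpace Ω] {d : ℕ} {P : Measure Ω} [IsProbabilityMeasure P]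
  {Y : ℤ → Ω → ℕ} {f : Param d → (ℕ → ℕ) → ℝ} {Θ : Set (Param d)} {θ₀ : Param d} {α : ℕ → ℝ≥0}
  {c C : ℝ}

lemma tendsto_average (H : IsCountModel P Y f Θ θ₀ α c C) {g : ℕ → (ℤ → ℕ) → ℝ}
    {g' G : (ℤ → ℕ) → ℝ} (hg : ∀ t, Measurable (g t)) (hG : Integrable G (pathLaw Y P))
    (hle : ∀ s, tailSum α 0 (pastOf s) ≠ ∞ → ∀ t, |g t s| ≤ G s)
    (hlim : ∀ s, tailSum α 0 (pastOf s) ≠ ∞ → Tendsto (fun t => g t s) atTop (𝓝 (g' s))) :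
    Tendsto (fun x : ℕ × Ω => (x.1 : ℝ)⁻¹ * ∑ t ∈ Finset.Icc 1 x.1, g t (pathAt Y t x.2)) (whp P)
      (𝓝 (∫ s, g' s ∂(pathLaw Y P))) := by
  have := isProbabilityMeasure_pathLaw H.stationary
  refine tendsto_average_whp H.stationary.ergodic H.stationary.measurePreserving_pathAt
    pathAt_succ (fun t => (hg t).aestronglyMeasurable) hG (fun t => ?_) ?_
  · filter_upwards [H.ae_tailSum_ne_top] with s hs using hle s hs t
  · filter_upwards [H.ae_tailSum_ne_top] with s hs using hlim s hs

lemma eventually_tailSum_ne_top (H : IsCountModel P Y f Θ θ₀ α c C) :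
    ∀ᶠ x in whp P, ∀ t, tailSum α 0 (pastOf (pathAt Y t x.2)) ≠ ∞ :=
  eventually_whp_of_ae (Eventually.of_forall fun _ => H.ae_forall_tailSum_ne_top)

lemma memLp_weight (H : IsCountModel P Y f Θ θ₀ α c C) :
    MemLp (fun s : ℤ → ℕ => (s 0 : ℝ) * c⁻¹ + 1) 2 (pathLaw Y P) := by
  have := isProbabilityMeasure_pathLaw H.stationary
  exact ((H.memLp_coord 0).mul_const c⁻¹).add (memLp_const 1)

lemma integrable_weight_mul_envelope (H : IsCountModel P Y f Θ θ₀ α c C) :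
    Integrable (fun s : ℤ → ℕ => ((s 0 : ℝ) * c⁻¹ + 1) * envelope α C (pastOf s))
      (pathLaw Y P) :=
  H.memLp_weight.integrable_mul H.memLp_envelope

omit [IsProbabilityMeasure P] in
lemma measurable_model (H : IsCountModel P Y f Θ θ₀ α c C) (θ : Param d) :
    Measurable fun s : ℤ → ℕ => f θ (pastOf s) := (H.regular.measurable θ).comp measurable_pastOf

lemma integrable_poissonLogLik_sub (H : IsCountModel P Y f Θ θ₀ α c C) {θ : Param d} (hθ : θ ∈ Θ) :
    Integrable (fun s : ℤ → ℕ => poissonLogLik (s 0) (f θ (pastOf s))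
      - poissonLogLik (s 0) (f θ₀ (pastOf s))) (pathLaw Y P) := by
  refine (H.integrable_weight_mul_envelope.const_mul 2).mono
    ((measurable_poissonLogLik measurable_coord_zero (H.measurable_model θ)).sub
      (measurable_poissonLogLik measurable_coord_zero (H.measurable_model θ₀))).aestronglyMeasurable
    ?_
  filter_upwards [H.ae_tailSum_ne_top] with s hs
  have R := H.regular
  have h1 := abs_poissonLogLik_sub_le R.pos (Nat.cast_nonneg (s 0)) (R.lower θ hθ (pastOf s))
    (R.lower θ₀ R.mem (pastOf s))
  have hw : 0 ≤ (s 0 : ℝ) * c⁻¹ + 1 := by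
    have := R.pos
    positivity
  have h2 : |f θ (pastOf s) - f θ₀ (pastOf s)| ≤ envelope α C (pastOf s) := by
    rw [abs_sub_le_iff]
    have := R.le_envelope hs hθ
    have := R.le_envelope hs R.mem
    have := R.nonneg hθ (pastOf s)
    have := R.nonneg R.mem (pastOf s)
    constructor <;> linarith
  have h3 := R.envelope_nonneg (pastOf s)
  rw [Real.norm_eq_abs, Real.norm_eq_abs, abs_of_nonneg (by positivity : (0 : ℝ) ≤
    2 * (((s 0 : ℝ) * c⁻¹ + 1) * envelope α C (pastOf s)))]
  have h4 := mul_le_mul_of_nonneg_left h2 hw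
  have h5 := mul_nonneg hw h3
  linarith

/-- The limit criterion is maximal at the true parameter only. -/
lemma integral_poissonLogLik_sub_neg (H : IsCountModel P Y f Θ θ₀ α c C)
    (hident : Identifiable f Y P Θ) {θ : Param d} (hθ : θ ∈ Θ) (hne : θ ≠ θ₀) :
    ∫ s, (poissonLogLik (s 0) (f θ (pastOf s)) - poissonLogLik (s 0) (f θ₀ (pastOf s)))
      ∂(pathLaw Y P) < 0 := by
  have R := H.regular
  have hint := H.integrable_poissonLogLik_sub hθ
  have hτ := H.stationary.measurePreserving_pathAt 1
  rw [H.integral_pathLaw 1 hint.1]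
  set a : Ω → ℝ := fun ω => f θ (pastOf (pathAt Y 1 ω)) with ha
  set b : Ω → ℝ := fun ω => f θ₀ (pastOf (pathAt Y 1 ω)) with hb
  set g : Ω → ℝ := fun ω => Real.log (a ω) - Real.log (b ω) with hg
  have ham : Measurable[pastSigma Y 1] a :=
    (R.measurable θ).comp (measurable_pastOf_pathAt (s := 1) (t := 1) le_rfl)
  have hbm : Measurable[pastSigma Y 1] b :=
    (R.measurable θ₀).comp (measurable_pastOf_pathAt (s := 1) (t := 1) le_rfl)
  have hgm : Measurable[pastSigma Y 1] g :=
    (Real.measurable_log.comp ham).sub (Real.measurable_log.comp hbm)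
  have hle := H.stationary.pastSigma_le 1
  have hE : MemLp (fun ω => envelope α C (pastOf (pathAt Y 1 ω))) 2 P :=
    H.memLp_envelope.comp_measurePreserving hτ
  have habs : ∀ᵐ ω ∂P, |a ω| ≤ envelope α C (pastOf (pathAt Y 1 ω)) ∧
      |b ω| ≤ envelope α C (pastOf (pathAt Y 1 ω)) := by
    filter_upwards [H.ae_forall_tailSum_ne_top] with ω hω
    rw [abs_of_pos (R.nonneg hθ _), abs_of_pos (R.nonneg R.mem _)]
    exact ⟨R.le_envelope (hω 1) hθ, R.le_envelope (hω 1) R.mem⟩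
  have haL : MemLp a 2 P := hE.mono (ham.mono hle le_rfl).aestronglyMeasurable
    (habs.mono fun ω h => h.1.trans (le_abs_self _))
  have hbL : MemLp b 2 P := hE.mono (hbm.mono hle le_rfl).aestronglyMeasurable
    (habs.mono fun ω h => h.2.trans (le_abs_self _))
  have hgL : MemLp g 2 P := by
    refine ((haL.sub hbL).const_mul c⁻¹).mono (hgm.mono hle le_rfl).aestronglyMeasurable
      (ae_of_all _ fun ω => ?_)
    rw [Real.norm_eq_abs, Real.norm_eq_abs, abs_mul, abs_of_pos (inv_pos.2 R.pos)]
    exact abs_log_sub_log_le R.pos (R.lower θ hθ _) (R.lower θ₀ R.mem _)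
  have hgY : Integrable (fun ω => g ω * (Y (1 : ℕ) ω : ℝ)) P := hgL.integrable_mul (H.memLp_obs 1)
  have hgb : Integrable (fun ω => g ω * b ω) P := hgL.integrable_mul hbL
  have hab : Integrable (fun ω => a ω - b ω) P :=
    (haL.integrable one_le_two).sub (hbL.integrable one_le_two)
  have key := H.integral_mul_innovation 1 hgm hgY
  have e1 : ∀ ω, poissonLogLik (pathAt Y 1 ω 0) (f θ (pastOf (pathAt Y 1 ω)))
      - poissonLogLik (pathAt Y 1 ω 0) (f θ₀ (pastOf (pathAt Y 1 ω)))
      = g ω * (Y (1 : ℕ) ω : ℝ) - (a ω - b ω) := by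
    intro ω
    simp only [poissonLogLik, pathAt_zero_apply, hg, ha, hb]
    ring
  simp only [e1]
  rw [integral_sub hgY hab, key, ← integral_sub hgb hab]
  -- Once Y is replaced by its conditional mean b, the integrand is b log(a/b) - (a - b),
  -- nonpositive because log u ≤ u - 1. It vanishes only where a = b; a zero integral would thus
  -- contradict identifiability.
  have hneg : ∀ ω, 0 ≤ -(g ω * b ω - (a ω - b ω)) := by
    intro ω
    have h1 : 0 < a ω := R.nonneg hθ _
    have h2 : 0 < b ω := R.nonneg R.mem _
    have h3 := Real.log_le_sub_one_of_pos (div_pos h1 h2)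
    rw [Real.log_div h1.ne' h2.ne'] at h3
    have h4 := mul_le_mul_of_nonneg_right h3 h2.le
    have h5 : (a ω / b ω - 1) * b ω = a ω - b ω := by field_simp
    simp only [hg]
    linarith
  by_contra hcon
  have h0 : ∫ ω, -(g ω * b ω - (a ω - b ω)) ∂P = 0 := by
    refine le_antisymm ?_ (integral_nonneg hneg)
    rw [integral_neg]
    linarith
  rw [integral_eq_zero_iff_of_nonneg hneg (hgb.sub hab).neg] at h0
  refine hne (hident θ hθ θ₀ R.mem ⟨1, ?_⟩)
  filter_upwards [h0] with ω hω
  have hω' : -(g ω * b ω - (a ω - b ω)) = 0 := hω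
  have h1 : 0 < a ω := R.nonneg hθ _
  have h2 : 0 < b ω := R.nonneg R.mem _
  simp only [lam, past_one_eq]
  change a ω = b ω
  by_contra hne'
  have h3 := Real.log_lt_sub_one_of_pos (div_pos h1 h2)
    (fun h => hne' (by rwa [div_eq_one_iff_eq h2.ne'] at h))
  rw [Real.log_div h1.ne' h2.ne'] at h3
  have h4 := mul_lt_mul_of_pos_right h3 h2
  have h5 : (a ω / b ω - 1) * b ω = a ω - b ω := by field_simp
  simp only [hg] at hω'
  linarith

/-- Wald's argument. With the Lipschitz weight W = Y/c + 1, each summand near θ₁ is at most its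
value at θ₁ plus W times the modulus of continuity plus twice W times the tail sum (once for θ, once
for θ₀). The limiting contrast Δ at θ₁ is negative, and the radius is chosen so that the modulus
costs less than half of it on average. -/
lemma eventually_quasiLogLik_le_near (H : IsCountModel P Y f Θ θ₀ α c C)
    (hident : Identifiable f Y P Θ) {θ₁ : Param d} (hθ₁ : θ₁ ∈ Θ) (hne : θ₁ ≠ θ₀) :
    ∃ k : ℕ, ∃ ρ : ℝ, 0 < ρ ∧ ∀ᶠ x in whp P, ∀ θ ∈ Θ, dist θ θ₁ < 1 / ((k : ℝ) + 1) →
      quasiLogLik f Y x.1 θ x.2 ≤ quasiLogLik f Y x.1 θ₀ x.2 - ρ * x.1 := by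
  have R := H.regular
  obtain ⟨w, hwm, hw0, hwle, hwlim, hw⟩ := R.exists_modulus hθ₁
  set Δ := ∫ s, (poissonLogLik (s 0) (f θ₁ (pastOf s)) - poissonLogLik (s 0) (f θ₀ (pastOf s)))
      ∂(pathLaw Y P) with hΔ
  have hΔ0 : Δ < 0 := H.integral_poissonLogLik_sub_neg hident hθ₁ hne
  set W : (ℤ → ℕ) → ℝ := fun s => (s 0 : ℝ) * c⁻¹ + 1 with hW
  have hW0 : ∀ s, 0 ≤ W s := fun s => by
    have := R.pos
    simp only [hW]
    positivity
  have hWm : Measurable W := (measurable_coord_zero.mul_const _).add_const _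
  have hint := H.integrable_weight_mul_envelope
  have hlimk : Tendsto (fun k => ∫ s, W s * w k (pastOf s) ∂(pathLaw Y P)) atTop (𝓝 0) := by
    have := tendsto_integral_of_dominated_convergence (μ := pathLaw Y P)
      (F := fun k s => W s * w k (pastOf s)) (f := fun _ => 0)
      (fun s => W s * envelope α C (pastOf s))
      (fun k => (hWm.mul ((hwm k).comp measurable_pastOf)).aestronglyMeasurable) hint
      (fun k => ae_of_all _ fun s => by
        rw [Real.norm_eq_abs, abs_of_nonneg (mul_nonneg (hW0 s) (hw0 _ _))]
        exact mul_le_mul_of_nonneg_left (hwle _ _) (hW0 s))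
      (ae_of_all _ fun s => by simpa using (hwlim (pastOf s)).const_mul (W s))
    simpa using this
  obtain ⟨k, hk⟩ := (hlimk.eventually (gt_mem_nhds (show 0 < -Δ / 2 by linarith))).exists
  have hintk : Integrable (fun s => W s * w k (pastOf s)) (pathLaw Y P) := by
    refine hint.mono (hWm.mul ((hwm k).comp measurable_pastOf)).aestronglyMeasurable
      (ae_of_all _ fun s => ?_)
    rw [Real.norm_eq_abs, abs_of_nonneg (mul_nonneg (hW0 s) (hw0 _ _)), Real.norm_eq_abs]
    exact (mul_le_mul_of_nonneg_left (hwle _ _) (hW0 s)).trans (le_abs_self _)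
  have hL := H.integrable_poissonLogLik_sub hθ₁
  have hT := H.tendsto_average
    (g := fun t s => (poissonLogLik (s 0) (f θ₁ (pastOf s)) - poissonLogLik (s 0) (f θ₀ (pastOf s)))
      + W s * w k (pastOf s) + 2 * (W s * (tailSum α t (pastOf s)).toReal))
    (g' := fun s => (poissonLogLik (s 0) (f θ₁ (pastOf s))
      - poissonLogLik (s 0) (f θ₀ (pastOf s))) + W s * w k (pastOf s))
    (G := fun s => |poissonLogLik (s 0) (f θ₁ (pastOf s)) - poissonLogLik (s 0) (f θ₀ (pastOf s))|
      + W s * w k (pastOf s) + 2 * (W s * envelope α C (pastOf s)))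
    (fun t => (((measurable_poissonLogLik measurable_coord_zero (H.measurable_model θ₁)).sub
      (measurable_poissonLogLik measurable_coord_zero (H.measurable_model θ₀))).add
      (hWm.mul ((hwm k).comp measurable_pastOf))).add ((hWm.mul
        ((measurable_tailSum α t).comp measurable_pastOf).ennreal_toReal).const_mul 2))
    ((hL.abs.add hintk).add (hint.const_mul 2))
    (fun s hs t => by
      refine (abs_add_three _ _ _).trans ?_
      rw [abs_of_nonneg (mul_nonneg (hW0 s) (hw0 k _)), abs_of_nonneg (mul_nonneg zero_le_two
        (mul_nonneg (hW0 s) ENNReal.toReal_nonneg))]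
      gcongr
      · exact hW0 s
      · exact R.tailSum_le_envelope hs t)
    (fun s hs => by
      have := ((tendsto_tailSum hs).const_mul (W s)).const_mul 2
      simpa using this.const_add ((poissonLogLik (s 0) (f θ₁ (pastOf s))
        - poissonLogLik (s 0) (f θ₀ (pastOf s))) + W s * w k (pastOf s)))
  rw [integral_add hL hintk, ← hΔ] at hT
  have hev := hT.eventually (gt_mem_nhds (show Δ + ∫ s, W s * w k (pastOf s) ∂(pathLaw Y P) < Δ / 2
    by linarith))
  refine ⟨k, -Δ / 2, by linarith, ?_⟩
  filter_upwards [hev, H.eventually_tailSum_ne_top,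
    tendsto_fst_whp.eventually (eventually_ge_atTop 1)] with x hx hgood hn θ hθ hd
  have hnpos : (0 : ℝ) < x.1 := by exact_mod_cast hn
  rw [inv_mul_lt_iff₀ hnpos] at hx
  have hterm : ∀ t ∈ Finset.Icc 1 x.1,
      poissonLogLik (Y t x.2) (f θ (trunc t (pastOf (pathAt Y t x.2))))
        - poissonLogLik (Y t x.2) (f θ₀ (trunc t (pastOf (pathAt Y t x.2))))
      ≤ (poissonLogLik (pathAt Y t x.2 0) (f θ₁ (pastOf (pathAt Y t x.2)))
        - poissonLogLik (pathAt Y t x.2 0) (f θ₀ (pastOf (pathAt Y t x.2))))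
      + W (pathAt Y t x.2) * w k (pastOf (pathAt Y t x.2))
      + 2 * (W (pathAt Y t x.2) * (tailSum α t (pastOf (pathAt Y t x.2))).toReal) := by
    intro t _
    set s := pathAt Y t x.2 with hs
    have hs0 : (s 0 : ℝ) = Y t x.2 := by rw [hs, pathAt_zero_apply]
    have hg := hgood t
    rw [← hs0]
    have h1 := abs_poissonLogLik_sub_le R.pos (Nat.cast_nonneg (s 0))
      (R.lower θ hθ (trunc t (pastOf s))) (R.lower θ₁ hθ₁ (pastOf s))
    have h2 := abs_poissonLogLik_sub_le R.pos (Nat.cast_nonneg (s 0))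
      (R.lower θ₀ R.mem (trunc t (pastOf s))) (R.lower θ₀ R.mem (pastOf s))
    have h3 : |f θ (trunc t (pastOf s)) - f θ₁ (pastOf s)|
        ≤ (tailSum α t (pastOf s)).toReal + w k (pastOf s) :=
      (abs_sub_le _ (f θ (pastOf s)) _).trans
        (add_le_add (R.abs_trunc_sub_le hg t hθ) (hw k _ hg θ hθ hd))
    have h4 := R.abs_trunc_sub_le hg t R.mem
    have h5 := h1.trans (mul_le_mul_of_nonneg_left h3 (hW0 s))
    have h6 := h2.trans (mul_le_mul_of_nonneg_left h4 (hW0 s))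
    rw [abs_le] at h5 h6
    rw [mul_add] at h5
    linarith [h5.2, h6.1]
  have hsum := Finset.sum_le_sum hterm
  rw [Finset.sum_sub_distrib, ← quasiLogLik_eq, ← quasiLogLik_eq] at hsum
  linarith

/-- The quasi-likelihood separates the true parameter from distant ones. -/
theorem eventually_quasiLogLik_le (H : IsCountModel P Y f Θ θ₀ α c C)
    (hident : Identifiable f Y P Θ) {A : Set (Param d)} (hA : IsClosed A) (hA₀ : θ₀ ∉ A) :
    ∃ ρ : ℝ, 0 < ρ ∧ ∀ᶠ x in whp P, ∀ θ ∈ Θ ∩ A,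
      quasiLogLik f Y x.1 θ x.2 ≤ quasiLogLik f Y x.1 θ₀ x.2 - ρ * x.1 := by
  have hcpt : IsCompact (Θ ∩ A) := H.regular.isCompact.inter_right hA
  let p : Set (Param d) → Prop := fun S => ∃ ρ : ℝ, 0 < ρ ∧ ∀ᶠ x in whp P, ∀ θ ∈ S,
      quasiLogLik f Y x.1 θ x.2 ≤ quasiLogLik f Y x.1 θ₀ x.2 - ρ * x.1
  have h0 : p ∅ :=
    ⟨1, one_pos, Eventually.of_forall fun x θ hθ => absurd hθ (Set.notMem_empty θ)⟩
  have h1 : ∀ ⦃S T : Set (Param d)⦄, S ⊆ T → p T → p S := by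
    rintro S T hST ⟨ρ, hρ, h⟩
    exact ⟨ρ, hρ, h.mono fun x hx θ hθ => hx θ (hST hθ)⟩
  have h2 : ∀ ⦃S T : Set (Param d)⦄, p S → p T → p (S ∪ T) := by
    rintro S T ⟨ρ, hρ, h⟩ ⟨ρ', hρ', h'⟩
    refine ⟨min ρ ρ', lt_min hρ hρ', ?_⟩
    filter_upwards [h, h'] with x hx hx' θ hθ
    have hn : (0 : ℝ) ≤ x.1 := Nat.cast_nonneg _
    rcases hθ with hθ | hθ
    · exact (hx θ hθ).trans (sub_le_sub_left (mul_le_mul_of_nonneg_right (min_le_left _ _) hn) _)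
    · exact (hx' θ hθ).trans (sub_le_sub_left (mul_le_mul_of_nonneg_right (min_le_right _ _) hn) _)
  refine hcpt.induction_on h0 h1 h2 fun θ₁ hθ₁ => ?_
  obtain ⟨k, ρ, hρ, h⟩ := H.eventually_quasiLogLik_le_near hident hθ₁.1
    (fun h => hA₀ (h ▸ hθ₁.2))
  refine ⟨Θ ∩ A ∩ Metric.ball θ₁ (1 / ((k : ℝ) + 1)), inter_mem_nhdsWithin _
    (Metric.ball_mem_nhds _ (by positivity)), ρ, hρ, h.mono fun x hx θ hθ => ?_⟩
  exact hx θ hθ.1.1 hθ.2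

end IsCountModel

/-! ### The local expansion of the quasi-likelihood -/

/-- The remainder of the first order expansion of `log (1 + x)`. -/
noncomputable def logRem (x : ℝ) : ℝ := x - Real.log (1 + x)

lemma abs_param_apply_le {d : ℕ} (v : Param d) (i : Fin d) : |v i| ≤ ‖v‖ := by
  simpa using PiLp.norm_apply_le v i

/-- Writing f_θ = f_{θ₀}(1 + x) gives a(x - `logRem` x) - f_{θ₀} x, and f_{θ₀} x is then split into
its linear part and the linearization error. The identity is exact: the remainder of the logarithm
is kept whole because its sign is used later. -/
lemma IsRegularFamily.poissonLogLik_sub_eq {d : ℕ} {f : Param d → (ℕ → ℕ) → ℝ} {Θ : Set (Param d)}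
    {θ₀ : Param d} {α : ℕ → ℝ≥0} {c C : ℝ} (R : IsRegularFamily f Θ θ₀ α c C) {θ : Param d}
    (hθ : θ ∈ Θ) (a : ℝ) (q : ℕ → ℕ) :
    poissonLogLik a (f θ q) - poissonLogLik a (f θ₀ q)
      = inner ℝ (a • logGrad f θ₀ q - ∇ (fun ϑ => f ϑ q) θ₀) (θ - θ₀)
        + (a * (f θ₀ q)⁻¹ - 1) * linErr f θ₀ θ q
        - a * logRem ((f θ q - f θ₀ q) / f θ₀ q) := by
  have h0 := R.nonneg R.mem q
  have h1 := R.nonneg hθ q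
  have e : 1 + (f θ q - f θ₀ q) / f θ₀ q = f θ q / f θ₀ q := by
    field_simp
    ring
  simp only [poissonLogLik, logRem, e, Real.log_div h1.ne' h0.ne', inner_sub_left, inner_smul_left,
    logGrad, linErr, conj_trivial]
  field_simp
  ring

namespace IsCountModel

variable {Ω : Type*} [MeasurableSpace Ω] {d : ℕ} {P : Measure Ω} [IsProbabilityMeasure P]
  {Y : ℤ → Ω → ℕ} {f : Param d → (ℕ → ℕ) → ℝ} {Θ : Set (Param d)} {θ₀ : Param d} {α : ℕ → ℝ≥0}
  {c C : ℝ}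

lemma eventually_sum_le (H : IsCountModel P Y f Θ θ₀ α c C) {g : ℕ → (ℤ → ℕ) → ℝ}
    {g' G : (ℤ → ℕ) → ℝ} (hg : ∀ t, Measurable (g t)) (hG : Integrable G (pathLaw Y P))
    (hle : ∀ s, tailSum α 0 (pastOf s) ≠ ∞ → ∀ t, |g t s| ≤ G s)
    (hlim : ∀ s, tailSum α 0 (pastOf s) ≠ ∞ → Tendsto (fun t => g t s) atTop (𝓝 (g' s)))
    {r : ℝ} (hr : ∫ s, g' s ∂(pathLaw Y P) < r) :
    ∀ᶠ x in whp P, ∑ t ∈ Finset.Icc 1 x.1, g t (pathAt Y t x.2) ≤ r * x.1 := by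
  filter_upwards [(H.tendsto_average hg hG hle hlim).eventually (gt_mem_nhds hr),
    tendsto_fst_whp.eventually (eventually_ge_atTop 1)] with x hx hn
  have hnpos : (0 : ℝ) < x.1 := by exact_mod_cast hn
  rw [inv_mul_lt_iff₀ hnpos] at hx
  linarith

/-- Empirical quadratic forms converge uniformly. -/
lemma eventually_abs_sum_quadratic_le (H : IsCountModel P Y f Θ θ₀ α c C)
    {q : Fin d → Fin d → (ℤ → ℕ) → ℝ} (hq : ∀ i j, Integrable (q i j) (pathLaw Y P))
    {η : ℝ} (hη : 0 < η) :
    ∀ᶠ x in whp P, ∀ v : Param d,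
      |∑ t ∈ Finset.Icc 1 x.1, ∑ i, ∑ j, v i * v j * q i j (pathAt Y t x.2)
        - x.1 * ∑ i, ∑ j, v i * v j * ∫ s, q i j s ∂(pathLaw Y P)| ≤ η * (x.1 * ‖v‖ ^ 2) := by
  have := isProbabilityMeasure_pathLaw H.stationary
  -- Uniformity in v comes from finitely many entries: there are d² of them and |v_i v_j| ≤ ‖v‖².
  -- The added 1 covers d = 0.
  have hη' : 0 < η / (d * d + 1) := by positivity
  have hev : ∀ᶠ x in whp P, ∀ i j,
      |∑ t ∈ Finset.Icc 1 x.1, q i j (pathAt Y t x.2) - x.1 * ∫ s, q i j s ∂(pathLaw Y P)|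
        ≤ η / (d * d + 1) * x.1 := by
    rw [eventually_all]
    intro i
    rw [eventually_all]
    intro j
    have h := tendsto_average_whp_of_integrable (P := P) H.stationary.ergodic
      H.stationary.measurePreserving_pathAt pathAt_succ (hq i j)
    filter_upwards [h.eventually (Metric.ball_mem_nhds _ hη'),
      tendsto_fst_whp.eventually (eventually_ge_atTop 1)] with x hx hn
    have hnpos : (0 : ℝ) < x.1 := by exact_mod_cast hn
    rw [Real.dist_eq] at hx
    have e : ∑ t ∈ Finset.Icc 1 x.1, q i j (pathAt Y t x.2) - x.1 * ∫ s, q i j s ∂(pathLaw Y P)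
        = x.1 * ((x.1 : ℝ)⁻¹ * ∑ t ∈ Finset.Icc 1 x.1, q i j (pathAt Y t x.2)
          - ∫ s, q i j s ∂(pathLaw Y P)) := by
      rw [mul_sub, mul_inv_cancel_left₀ hnpos.ne']
    rw [e, abs_mul, abs_of_pos hnpos, mul_comm]
    exact mul_le_mul_of_nonneg_right hx.le hnpos.le
  filter_upwards [hev] with x hx v
  have e : ∑ t ∈ Finset.Icc 1 x.1, ∑ i, ∑ j, v i * v j * q i j (pathAt Y t x.2)
        - x.1 * ∑ i, ∑ j, v i * v j * ∫ s, q i j s ∂(pathLaw Y P)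
      = ∑ i, ∑ j, v i * v j * (∑ t ∈ Finset.Icc 1 x.1, q i j (pathAt Y t x.2)
        - x.1 * ∫ s, q i j s ∂(pathLaw Y P)) := by
    rw [Finset.sum_comm, Finset.mul_sum, ← Finset.sum_sub_distrib]
    refine Finset.sum_congr rfl fun i _ => ?_
    rw [Finset.sum_comm, Finset.mul_sum, ← Finset.sum_sub_distrib]
    refine Finset.sum_congr rfl fun j _ => ?_
    rw [← Finset.mul_sum]
    ring
  rw [e]
  have hb : ∀ i j, |v i * v j * (∑ t ∈ Finset.Icc 1 x.1, q i j (pathAt Y t x.2)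
        - x.1 * ∫ s, q i j s ∂(pathLaw Y P))| ≤ ‖v‖ * ‖v‖ * (η / (d * d + 1) * x.1) := by
    intro i j
    rw [abs_mul, abs_mul]
    gcongr
    · exact abs_param_apply_le v i
    · exact abs_param_apply_le v j
    · exact hx i j
  calc _ ≤ ∑ i : Fin d, ∑ j : Fin d, ‖v‖ * ‖v‖ * (η / (d * d + 1) * x.1) :=
        (Finset.abs_sum_le_sum_abs _ _).trans (Finset.sum_le_sum fun i _ =>
          (Finset.abs_sum_le_sum_abs _ _).trans (Finset.sum_le_sum fun j _ => hb i j))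
    _ = ((d * d : ℝ) / (d * d + 1)) * (η * (x.1 * ‖v‖ ^ 2)) := by
        simp only [Finset.sum_const, Finset.card_univ, Fintype.card_fin, nsmul_eq_mul]
        ring
    _ ≤ 1 * (η * (x.1 * ‖v‖ ^ 2)) := by
        gcongr
        rw [div_le_one (by positivity)]
        linarith
    _ = _ := one_mul _

/-- The off-diagonal entries are dominated by the diagonal ones, as 2|ab| ≤ a² + b². -/
lemma integrable_obs_mul_logGrad_mul (H : IsCountModel P Y f Θ θ₀ α c C)
    (hJ : ∀ i j, Integrable (entryJ f Y θ₀ i j) P) (i j : Fin d) :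
    Integrable (fun s : ℤ → ℕ => (s 0 : ℝ) *
      (logGrad f θ₀ (pastOf s) i * logGrad f θ₀ (pastOf s) j)) (pathLaw Y P) := by
  have h := fun i => (H.integrable_obs_mul_inner_sq hJ (EuclideanSpace.single i (1 : ℝ))).1
  have hm : ∀ i, Measurable fun s : ℤ → ℕ => logGrad f θ₀ (pastOf s) i := fun i =>
    (EuclideanSpace.proj (𝕜 := ℝ) i).continuous.measurable.comp
      (H.measurable_logGrad.comp measurable_pastOf)
  refine ((h i).add (h j)).mono
    (measurable_coord_zero.mul ((hm i).mul (hm j))).aestronglyMeasurable (ae_of_all _ fun s => ?_)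
  simp only [Pi.add_apply, EuclideanSpace.inner_single_right, conj_trivial, one_mul, ← mul_add]
  rw [Real.norm_eq_abs, Real.norm_eq_abs, abs_mul, abs_mul (s 0 : ℝ) (_ + _)]
  refine mul_le_mul_of_nonneg_left ?_ (abs_nonneg _)
  set a := logGrad f θ₀ (pastOf s) i
  set b := logGrad f θ₀ (pastOf s) j
  rw [abs_of_nonneg (by positivity : 0 ≤ a ^ 2 + b ^ 2), abs_le]
  constructor <;> nlinarith [sq_nonneg (a + b), sq_nonneg (a - b)]

/-- The empirical information converges to `J`, uniformly over directions. -/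
lemma eventually_abs_sum_inner_sq_sub_le (H : IsCountModel P Y f Θ θ₀ α c C)
    (hJ : ∀ i j, Integrable (entryJ f Y θ₀ i j) P) {η : ℝ} (hη : 0 < η) :
    ∀ᶠ x in whp P, ∀ v : Param d, |∑ t ∈ Finset.Icc 1 x.1,
        (Y (t : ℕ) x.2 : ℝ) * inner ℝ (logGrad f θ₀ (pastOf (pathAt Y t x.2))) v ^ 2
        - x.1 * (v.ofLp ⬝ᵥ (matJ f Y P θ₀).mulVec v.ofLp)| ≤ η * (x.1 * ‖v‖ ^ 2) := by
  have hint := H.integrable_obs_mul_logGrad_mul hJ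
  have e : ∀ (s : ℤ → ℕ) (v : Param d), (s 0 : ℝ) * inner ℝ (logGrad f θ₀ (pastOf s)) v ^ 2
      = ∑ i, ∑ j, v i * v j * ((s 0 : ℝ) *
        (logGrad f θ₀ (pastOf s) i * logGrad f θ₀ (pastOf s) j)) := by
    intro s v
    rw [inner_sq_eq_sum, Finset.mul_sum]
    refine Finset.sum_congr rfl fun i _ => ?_
    rw [Finset.mul_sum]
    exact Finset.sum_congr rfl fun j _ => by ring
  filter_upwards [H.eventually_abs_sum_quadratic_le hint hη] with x hx v
  have h2 := (H.integrable_obs_mul_inner_sq hJ v).2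
  simp only [e] at h2
  rw [integral_finsetSum _ fun i _ => integrable_finsetSum _ fun j _ => (hint i j).const_mul _] at h2
  simp_rw [integral_finsetSum Finset.univ fun j _ => (hint _ j).const_mul _, integral_const_mul]
    at h2
  have h3 := hx v
  rw [h2] at h3
  rw [Finset.sum_congr rfl fun t _ => (e (pathAt Y t x.2) v).symm] at h3
  simp only [pathAt_zero_apply] at h3
  exact h3

lemma memLp_two_of_abs_le (H : IsCountModel P Y f Θ θ₀ α c C) {g : (ℕ → ℕ) → ℝ} (hg : Measurable g)
    {K : ℝ} (hK : ∀ y, tailSum α 0 y ≠ ∞ → |g y| ≤ K * envelope α C y) :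
    MemLp (fun s => g (pastOf s)) 2 (pathLaw Y P) := by
  refine (H.memLp_envelope.const_mul K).mono (hg.comp measurable_pastOf).aestronglyMeasurable ?_
  filter_upwards [H.ae_tailSum_ne_top] with s hs
  exact (hK _ hs).trans (le_abs_self _)

/-- Functions of the past are orthogonal to the normalized innovations. -/
lemma integral_innovation_mul (H : IsCountModel P Y f Θ θ₀ α c C) {g : (ℕ → ℕ) → ℝ}
    (hg : Measurable g) {K : ℝ} (hK : ∀ y, tailSum α 0 y ≠ ∞ → |g y| ≤ K * envelope α C y) :
    Integrable (fun s : ℤ → ℕ => ((s 0 : ℝ) * (f θ₀ (pastOf s))⁻¹ - 1) * g (pastOf s))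
      (pathLaw Y P) ∧
    ∫ s, ((s 0 : ℝ) * (f θ₀ (pastOf s))⁻¹ - 1) * g (pastOf s) ∂(pathLaw Y P) = 0 := by
  have R := H.regular
  have := isProbabilityMeasure_pathLaw H.stationary
  set ξ : (ℕ → ℕ) → ℝ := fun y => (f θ₀ y)⁻¹ * g y with hξ
  have hξm : Measurable ξ := (R.measurable θ₀).inv.mul hg
  have hξL : MemLp (fun s => ξ (pastOf s)) 2 (pathLaw Y P) := by
    refine H.memLp_two_of_abs_le hξm (K := c⁻¹ * K) fun y hy => ?_
    have hpos := R.pos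
    have h1 := R.nonneg R.mem y
    have h2 := hK y hy
    simp only [hξ]
    rw [abs_mul, abs_of_pos (inv_pos.2 h1), mul_assoc]
    exact mul_le_mul (inv_anti₀ hpos (R.lower _ R.mem y)) h2 (abs_nonneg _) (by positivity)
  have hgL := H.memLp_two_of_abs_le hg hK
  have i1 : Integrable (fun s : ℤ → ℕ => ξ (pastOf s) * (s 0 : ℝ)) (pathLaw Y P) :=
    hξL.integrable_mul (H.memLp_coord 0)
  have i2 : Integrable (fun s : ℤ → ℕ => g (pastOf s)) (pathLaw Y P) := hgL.integrable one_le_two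
  have e : ∀ s : ℤ → ℕ, ((s 0 : ℝ) * (f θ₀ (pastOf s))⁻¹ - 1) * g (pastOf s)
      = ξ (pastOf s) * (s 0 : ℝ) - g (pastOf s) := by
    intro s
    simp only [hξ]
    ring
  simp only [e]
  refine ⟨i1.sub i2, ?_⟩
  have hτ := H.stationary.measurePreserving_pathAt 1
  have i1' : Integrable (fun ω => ξ (pastOf (pathAt Y 1 ω)) * (Y (1 : ℕ) ω : ℝ)) P := by
    have h1 : Integrable ((fun s : ℤ → ℕ => ξ (pastOf s) * (s 0 : ℝ)) ∘ pathAt Y 1) P :=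
      (hτ.integrable_comp i1.1).2 i1
    refine h1.congr (ae_of_all _ fun ω => ?_)
    simp only [Function.comp_apply, pathAt_zero_apply]
  have key := H.integral_mul_innovation 1
    (hξm.comp (measurable_pastOf_pathAt (s := 1) (t := 1) le_rfl)) i1'
  rw [integral_sub i1 i2, H.integral_pathLaw 1 i1.1, H.integral_pathLaw 1 i2.1, sub_eq_zero]
  simp only [pathAt_zero_apply]
  refine key.trans (integral_congr_ae (ae_of_all _ fun ω => ?_))
  have h1 := R.nonneg R.mem (pastOf (pathAt Y 1 ω))
  simp only [hξ, Function.comp_apply]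
  field_simp

/-- The weight Y/λ - 1 has zero conditional mean, so that the second derivative of λ, a function of
the past, drops out of the limit. Polarization makes this uniform in v; the polarized entries are at
most (4 + 1 + 1)/2 = 3 times the envelope. -/
lemma eventually_abs_sum_quad_le (H : IsCountModel P Y f Θ θ₀ α c C) {η : ℝ} (hη : 0 < η) :
    ∀ᶠ x in whp P, ∀ v : Param d, |∑ t ∈ Finset.Icc 1 x.1,
        ((Y (t : ℕ) x.2 : ℝ) * (f θ₀ (pastOf (pathAt Y t x.2)))⁻¹ - 1)
          * quad f θ₀ v (pastOf (pathAt Y t x.2))| ≤ η * (x.1 * ‖v‖ ^ 2) := by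
  have R := H.regular
  set b : Fin d → Fin d → (ℕ → ℕ) → ℝ := fun i j y =>
    (quad f θ₀ (EuclideanSpace.single i (1 : ℝ) + EuclideanSpace.single j 1) y
      - quad f θ₀ (EuclideanSpace.single i (1 : ℝ)) y
      - quad f θ₀ (EuclideanSpace.single j (1 : ℝ)) y) / 2 with hb
  have hbm : ∀ i j, Measurable (b i j) := fun i j =>
    (((R.measurable_quad _).sub (R.measurable_quad _)).sub (R.measurable_quad _)).div_const 2
  have hbK : ∀ i j y, tailSum α 0 y ≠ ∞ → |b i j y| ≤ 3 * envelope α C y := by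
    intro i j y hy
    have h1 := R.abs_second_le hy R.mem (EuclideanSpace.single i (1 : ℝ) + EuclideanSpace.single j 1)
    have h2 := R.abs_second_le hy R.mem (EuclideanSpace.single i (1 : ℝ))
    have h3 := R.abs_second_le hy R.mem (EuclideanSpace.single j (1 : ℝ))
    have h4 : ‖EuclideanSpace.single i (1 : ℝ) + EuclideanSpace.single j (1 : ℝ)‖ ≤ 2 := by
      refine (norm_add_le _ _).trans ?_
      simp only [PiLp.norm_single, norm_one]
      norm_num
    have h5 : ‖EuclideanSpace.single i (1 : ℝ) + EuclideanSpace.single j (1 : ℝ)‖ ^ 2 ≤ 4 := by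
      nlinarith [norm_nonneg (EuclideanSpace.single i (1 : ℝ) + EuclideanSpace.single j (1 : ℝ))]
    have h6 := h1.trans (mul_le_mul_of_nonneg_left h5 (R.envelope_nonneg y))
    simp only [PiLp.norm_single, norm_one, one_pow, mul_one] at h2 h3
    simp only [hb]
    change |quad f θ₀ _ y| ≤ _ at h6
    change |quad f θ₀ _ y| ≤ _ at h2
    change |quad f θ₀ _ y| ≤ _ at h3
    rw [abs_le] at h2 h3 h6 ⊢
    constructor <;> linarith [h2.1, h2.2, h3.1, h3.2, h6.1, h6.2]
  have hint := fun i j => H.integral_innovation_mul (hbm i j) (hbK i j)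
  filter_upwards [H.eventually_abs_sum_quadratic_le (fun i j => (hint i j).1) hη] with x hx v
  have h := hx v
  simp only [(hint _ _).2, mul_zero, Finset.sum_const_zero, sub_zero, pathAt_zero_apply] at h
  refine (le_of_eq (congrArg abs (Finset.sum_congr rfl fun t _ => ?_))).trans h
  rw [R.quad_eq_sum v, Finset.mul_sum]
  refine Finset.sum_congr rfl fun i _ => ?_
  rw [Finset.mul_sum]
  exact Finset.sum_congr rfl fun j _ => by ring

end IsCountModel

/-- The contribution of the remainders of the logarithm to the quasi-log-likelihood ratio. -/
noncomputable def remSum {Ω : Type*} {d : ℕ} (f : Param d → (ℕ → ℕ) → ℝ) (Y : ℤ → Ω → ℕ)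
    (θ₀ θ : Param d) (n : ℕ) (ω : Ω) : ℝ :=
  ∑ t ∈ Finset.Icc 1 n, (Y (t : ℕ) ω : ℝ) * logRem
    ((f θ (trunc t (pastOf (pathAt Y t ω))) - f θ₀ (trunc t (pastOf (pathAt Y t ω))))
      / f θ₀ (trunc t (pastOf (pathAt Y t ω))))

lemma sqrt_smul_normScore {Ω : Type*} {d : ℕ} (f : Param d → (ℕ → ℕ) → ℝ) (Y : ℤ → Ω → ℕ)
    (θ₀ : Param d) (n : ℕ) (ω : Ω) :
    Real.sqrt n • normScore f Y θ₀ n ω = ∑ t ∈ Finset.Icc 1 n, score f θ₀ (pathAt Y t ω) := by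
  rcases Nat.eq_zero_or_pos n with rfl | hn
  · simp
  · have : Real.sqrt n ≠ 0 := (Real.sqrt_pos.2 (by exact_mod_cast hn)).ne'
    rw [normScore, smul_smul, mul_inv_cancel₀ this, one_smul]

/-- The expansion of a single term of the quasi-log-likelihood. -/
lemma IsRegularFamily.abs_expansion_le {d : ℕ} {f : Param d → (ℕ → ℕ) → ℝ} {Θ : Set (Param d)}
    {θ₀ : Param d} {α : ℕ → ℝ≥0} {c C : ℝ} {y : ℕ → ℕ} (R : IsRegularFamily f Θ θ₀ α c C)
    (hy : tailSum α 0 y ≠ ∞) {θ : Param d} (hθ : θ ∈ segSet Θ θ₀) {a : ℝ} (ha : 0 ≤ a) (t : ℕ)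
    {w : ℝ} (hw : |linErr f θ₀ θ y - 1 / 2 * quad f θ₀ (θ - θ₀) y| ≤ w * ‖θ - θ₀‖ ^ 2) :
    |poissonLogLik a (f θ (trunc t y)) - poissonLogLik a (f θ₀ (trunc t y))
      - inner ℝ ((a - f θ₀ y) • logGrad f θ₀ y) (θ - θ₀)
      + a * logRem ((f θ (trunc t y) - f θ₀ (trunc t y)) / f θ₀ (trunc t y))
      - 1 / 2 * ((a * (f θ₀ y)⁻¹ - 1) * quad f θ₀ (θ - θ₀) y)|
    ≤ (a * ‖logGrad f θ₀ (trunc t y) - logGrad f θ₀ y‖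
        + ‖∇ (fun ϑ => f ϑ (trunc t y)) θ₀ - ∇ (fun ϑ => f ϑ y) θ₀‖) * ‖θ - θ₀‖
      + ((a * c⁻¹ + 1) * ((tailSum α t y).toReal + w)
        + a * |(f θ₀ (trunc t y))⁻¹ - (f θ₀ y)⁻¹| * envelope α C y) * ‖θ - θ₀‖ ^ 2 := by
  set q := trunc t y with hq
  set v := θ - θ₀ with hv
  have h0 := R.nonneg R.mem y
  have h1 := R.nonneg R.mem q
  have hc := R.pos
  have hE := R.envelope_nonneg y
  have hs : (a - f θ₀ y) • logGrad f θ₀ y = a • logGrad f θ₀ y - ∇ (fun ϑ => f ϑ y) θ₀ := by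
    rw [sub_smul]
    congr 1
    rw [logGrad, smul_smul, mul_inv_cancel₀ h0.ne', one_smul]
  -- Apart from the logarithmic remainder, the observed past is replaced by the full one. This
  -- leaves three errors: the change of the gradients, of first order in ‖v‖, the linearization
  -- error minus its quadratic part, and the change of 1/λ in front of the quadratic part.
  have e : poissonLogLik a (f θ q) - poissonLogLik a (f θ₀ q)
      - inner ℝ ((a - f θ₀ y) • logGrad f θ₀ y) v
      + a * logRem ((f θ q - f θ₀ q) / f θ₀ q)
      - 1 / 2 * ((a * (f θ₀ y)⁻¹ - 1) * quad f θ₀ v y)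
      = inner ℝ (a • (logGrad f θ₀ q - logGrad f θ₀ y)
          - (∇ (fun ϑ => f ϑ q) θ₀ - ∇ (fun ϑ => f ϑ y) θ₀)) v
        + ((a * (f θ₀ q)⁻¹ - 1) * (linErr f θ₀ θ q - 1 / 2 * quad f θ₀ v y)
          + a * ((f θ₀ q)⁻¹ - (f θ₀ y)⁻¹) * (1 / 2 * quad f θ₀ v y)) := by
    rw [R.poissonLogLik_sub_eq hθ.1, hs]
    simp only [inner_sub_left, smul_sub]
    ring
  rw [e]
  have b1 : |inner ℝ (a • (logGrad f θ₀ q - logGrad f θ₀ y)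
          - (∇ (fun ϑ => f ϑ q) θ₀ - ∇ (fun ϑ => f ϑ y) θ₀)) v|
      ≤ (a * ‖logGrad f θ₀ q - logGrad f θ₀ y‖
        + ‖∇ (fun ϑ => f ϑ q) θ₀ - ∇ (fun ϑ => f ϑ y) θ₀‖) * ‖v‖ := by
    refine (abs_real_inner_le_norm _ _).trans ?_
    gcongr
    refine (norm_sub_le _ _).trans ?_
    rw [norm_smul, Real.norm_eq_abs, abs_of_nonneg ha]
  have hW : |a * (f θ₀ q)⁻¹ - 1| ≤ a * c⁻¹ + 1 := by
    refine (abs_sub _ _).trans ?_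
    rw [abs_one, abs_of_nonneg (by positivity)]
    gcongr
    exact R.lower _ R.mem q
  have b2 : |linErr f θ₀ θ q - 1 / 2 * quad f θ₀ v y| ≤ ((tailSum α t y).toReal + w) * ‖v‖ ^ 2 := by
    rw [add_mul]
    exact (abs_sub_le _ (linErr f θ₀ θ y) _).trans
      (add_le_add (R.abs_linErr_trunc_sub_le hy t hθ) hw)
  have b3 : |1 / 2 * quad f θ₀ v y| ≤ envelope α C y * ‖v‖ ^ 2 := by
    have h := R.abs_second_le hy R.mem v
    change |quad f θ₀ v y| ≤ _ at h
    rw [abs_mul, abs_of_pos (by norm_num : (0 : ℝ) < 1 / 2)]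
    linarith [abs_nonneg (quad f θ₀ v y)]
  refine (abs_add_le _ _).trans (add_le_add b1 ((abs_add_le _ _).trans ?_))
  rw [add_mul]
  refine add_le_add ?_ ?_
  · rw [abs_mul, mul_assoc]
    exact mul_le_mul hW b2 (abs_nonneg _) (by positivity)
  · rw [abs_mul, abs_mul a, abs_of_nonneg ha, mul_assoc (a * _)]
    exact mul_le_mul_of_nonneg_left b3 (by positivity)

namespace IsCountModel

variable {Ω : Type*} [MeasurableSpace Ω] {d : ℕ} {P : Measure Ω} [IsProbabilityMeasure P]
  {Y : ℤ → Ω → ℕ} {f : Param d → (ℕ → ℕ) → ℝ} {Θ : Set (Param d)} {θ₀ : Param d} {α : ℕ → ℝ≥0}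
  {c C : ℝ}

lemma tendsto_inv_trunc (R : IsRegularFamily f Θ θ₀ α c C) {y : ℕ → ℕ} (hy : tailSum α 0 y ≠ ∞) :
    Tendsto (fun t => |(f θ₀ (trunc t y))⁻¹ - (f θ₀ y)⁻¹|) atTop (𝓝 0) := by
  have h1 : Tendsto (fun t => f θ₀ (trunc t y)) atTop (𝓝 (f θ₀ y)) := by
    rw [tendsto_iff_dist_tendsto_zero]
    exact squeeze_zero (fun _ => dist_nonneg) (fun t => R.abs_trunc_sub_le hy t R.mem)
      (tendsto_tailSum hy)
  have h2 := ((h1.inv₀ (R.nonneg R.mem y).ne').sub_const (f θ₀ y)⁻¹).abs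
  simpa using h2

/-- The sum of the coefficients of the second order error is `o(n)`. -/
lemma exists_eventually_sum_second_le (H : IsCountModel P Y f Θ θ₀ α c C)
    {w : ℕ → (ℕ → ℕ) → ℝ} (hwm : ∀ k, Measurable (w k)) (hw0 : ∀ k y, 0 ≤ w k y)
    (hwle : ∀ k y, w k y ≤ 2 * envelope α C y)
    (hwlim : ∀ y, Tendsto (fun k => w k y) atTop (𝓝 0)) {η : ℝ} (hη : 0 < η) :
    ∃ k, ∀ᶠ x in whp P, ∑ t ∈ Finset.Icc 1 x.1,
      (((Y (t : ℕ) x.2 : ℝ) * c⁻¹ + 1) * ((tailSum α t (pastOf (pathAt Y t x.2))).toReal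
        + w k (pastOf (pathAt Y t x.2)))
        + (Y (t : ℕ) x.2 : ℝ) * |(f θ₀ (trunc t (pastOf (pathAt Y t x.2))))⁻¹
          - (f θ₀ (pastOf (pathAt Y t x.2)))⁻¹| * envelope α C (pastOf (pathAt Y t x.2)))
      ≤ η * x.1 := by
  have R := H.regular
  have hc := R.pos
  set W : (ℤ → ℕ) → ℝ := fun s => (s 0 : ℝ) * c⁻¹ + 1 with hW
  have hW0 : ∀ s, 0 ≤ W s := fun s => by
    simp only [hW]
    positivity
  have hWm : Measurable W := (measurable_coord_zero.mul_const _).add_const _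
  have hint := H.integrable_weight_mul_envelope
  have hlimk : Tendsto (fun k => ∫ s, W s * w k (pastOf s) ∂(pathLaw Y P)) atTop (𝓝 0) := by
    have := tendsto_integral_of_dominated_convergence (μ := pathLaw Y P)
      (F := fun k s => W s * w k (pastOf s)) (f := fun _ => 0)
      (fun s => 2 * (W s * envelope α C (pastOf s)))
      (fun k => (hWm.mul ((hwm k).comp measurable_pastOf)).aestronglyMeasurable) (hint.const_mul 2)
      (fun k => ae_of_all _ fun s => by
        rw [Real.norm_eq_abs, abs_of_nonneg (mul_nonneg (hW0 s) (hw0 _ _)), mul_left_comm]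
        exact mul_le_mul_of_nonneg_left (hwle _ _) (hW0 s))
      (ae_of_all _ fun s => by simpa using (hwlim (pastOf s)).const_mul (W s))
    simpa using this
  obtain ⟨k, hk⟩ := (hlimk.eventually (gt_mem_nhds hη)).exists
  refine ⟨k, ?_⟩
  have hp := measurable_pastOf
  have hev := H.eventually_sum_le
    (g := fun t s => W s * ((tailSum α t (pastOf s)).toReal + w k (pastOf s))
      + (s 0 : ℝ) * |(f θ₀ (trunc t (pastOf s)))⁻¹ - (f θ₀ (pastOf s))⁻¹| * envelope α C (pastOf s))
    (g' := fun s => W s * w k (pastOf s))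
    -- The constant 5: the tail sum is at most one envelope, the modulus at most two, and Y times
    -- the change of 1/λ at most 2W.
    (G := fun s => 5 * (W s * envelope α C (pastOf s)))
    (fun t => (hWm.mul (((measurable_tailSum α t).comp hp).ennreal_toReal.add
      ((hwm k).comp hp))).add ((measurable_coord_zero.mul
        ((((R.measurable θ₀).comp ((measurable_trunc t).comp hp)).inv.sub
          ((R.measurable θ₀).comp hp).inv).norm)).mul (measurable_envelope α C)))
    (hint.const_mul 5)
    (fun s hs t => by
      have h1 := R.tailSum_le_envelope hs t
      have h2 := hwle k (pastOf s)
      have h3 := hw0 k (pastOf s)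
      have hE := R.envelope_nonneg (pastOf s)
      have h4 : |(f θ₀ (trunc t (pastOf s)))⁻¹ - (f θ₀ (pastOf s))⁻¹| ≤ 2 * c⁻¹ := by
        have i1 := inv_anti₀ hc (R.lower _ R.mem (trunc t (pastOf s)))
        have i2 := inv_anti₀ hc (R.lower _ R.mem (pastOf s))
        have j1 := inv_pos.2 (R.nonneg R.mem (trunc t (pastOf s)))
        have j2 := inv_pos.2 (R.nonneg R.mem (pastOf s))
        rw [abs_le]
        constructor <;> linarith
      have h5 : (0 : ℝ) ≤ (s 0 : ℝ) := Nat.cast_nonneg _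
      have h6 : (0 : ℝ) ≤ (tailSum α t (pastOf s)).toReal := ENNReal.toReal_nonneg
      have k1 := mul_le_mul_of_nonneg_left (add_le_add h1 h2) (hW0 s)
      have k2 : (s 0 : ℝ) * |(f θ₀ (trunc t (pastOf s)))⁻¹ - (f θ₀ (pastOf s))⁻¹|
          ≤ 2 * W s := by
        refine (mul_le_mul_of_nonneg_left h4 h5).trans ?_
        simp only [hW]
        linarith
      have k3 := mul_le_mul_of_nonneg_right k2 hE
      rw [abs_of_nonneg (add_nonneg (mul_nonneg (hW0 s) (add_nonneg h6 h3)) (by positivity))]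
      linarith)
    (fun s hs => by
      have t1 := (((tendsto_tailSum hs).add_const (w k (pastOf s))).const_mul (W s)).add
        (((tendsto_inv_trunc R hs).const_mul (s 0 : ℝ)).mul_const (envelope α C (pastOf s)))
      simpa using t1) hk
  simpa only [hW, pathAt_zero_apply] using hev

/-- The expansion of the quasi-log-likelihood ratio near the true parameter. -/
theorem eventually_abs_expansion_le (H : IsCountModel P Y f Θ θ₀ α c C)
    (hrate : InitialEffectRate f Y P Θ) {η : ℝ} (hη : 0 < η) :
    ∃ δ : ℝ, 0 < δ ∧ ∀ᶠ x in whp P, ∀ θ ∈ segSet Θ θ₀, dist θ θ₀ < δ →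
      |quasiLogLik f Y x.1 θ x.2 - quasiLogLik f Y x.1 θ₀ x.2
        - Real.sqrt x.1 * inner ℝ (normScore f Y θ₀ x.1 x.2) (θ - θ₀)
        + remSum f Y θ₀ θ x.1 x.2|
      ≤ η * (Real.sqrt x.1 * ‖θ - θ₀‖ + x.1 * ‖θ - θ₀‖ ^ 2) := by
  have R := H.regular
  obtain ⟨w, hwm, hw0, hwle, hwlim, hw⟩ := R.exists_modulus_linErr
  obtain ⟨k, hk⟩ := H.exists_eventually_sum_second_le hwm hw0 hwle hwlim (half_pos hη)
  refine ⟨1 / ((k : ℝ) + 1), by positivity, ?_⟩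
  filter_upwards [hk, H.eventually_tailSum_ne_top, H.eventually_abs_sum_quad_le hη,
    (H.tendsto_gradDiff hrate).eventually (gt_mem_nhds (half_pos hη)),
    (H.tendsto_obs_mul_logGradDiff hrate).eventually (gt_mem_nhds (half_pos hη)),
    tendsto_fst_whp.eventually (eventually_ge_atTop 1)] with x h1 hgood h2 h3 h4 hn θ hθ hd
  have hn0 : (0 : ℝ) < x.1 := by exact_mod_cast hn
  have hs0 : 0 < Real.sqrt x.1 := Real.sqrt_pos.2 hn0
  rw [inv_mul_lt_iff₀ hs0] at h3 h4
  set v := θ - θ₀ with hv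
  -- The centred quadratic terms are subtracted one by one and added back as a sum: they are
  -- negligible only through cancellation, whereas the other errors are bounded in absolute value.
  have e : quasiLogLik f Y x.1 θ x.2 - quasiLogLik f Y x.1 θ₀ x.2
        - Real.sqrt x.1 * inner ℝ (normScore f Y θ₀ x.1 x.2) v + remSum f Y θ₀ θ x.1 x.2
      = ∑ t ∈ Finset.Icc 1 x.1,
        (poissonLogLik (Y (t : ℕ) x.2) (f θ (trunc t (pastOf (pathAt Y t x.2))))
          - poissonLogLik (Y (t : ℕ) x.2) (f θ₀ (trunc t (pastOf (pathAt Y t x.2))))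
          - inner ℝ (((Y (t : ℕ) x.2 : ℝ) - f θ₀ (pastOf (pathAt Y t x.2))) •
              logGrad f θ₀ (pastOf (pathAt Y t x.2))) v
          + (Y (t : ℕ) x.2 : ℝ) * logRem
            ((f θ (trunc t (pastOf (pathAt Y t x.2))) - f θ₀ (trunc t (pastOf (pathAt Y t x.2))))
              / f θ₀ (trunc t (pastOf (pathAt Y t x.2))))
          - 1 / 2 * (((Y (t : ℕ) x.2 : ℝ) * (f θ₀ (pastOf (pathAt Y t x.2)))⁻¹ - 1)
              * quad f θ₀ v (pastOf (pathAt Y t x.2))))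
        + 1 / 2 * ∑ t ∈ Finset.Icc 1 x.1,
          (((Y (t : ℕ) x.2 : ℝ) * (f θ₀ (pastOf (pathAt Y t x.2)))⁻¹ - 1)
              * quad f θ₀ v (pastOf (pathAt Y t x.2))) := by
    rw [Finset.sum_sub_distrib, Finset.sum_add_distrib, Finset.sum_sub_distrib,
      Finset.sum_sub_distrib, ← quasiLogLik_eq, ← quasiLogLik_eq, ← sum_inner, ← Finset.mul_sum,
      remSum]
    have hsc : Real.sqrt x.1 * inner ℝ (normScore f Y θ₀ x.1 x.2) v
        = inner ℝ (∑ t ∈ Finset.Icc 1 x.1, ((Y (t : ℕ) x.2 : ℝ) - f θ₀ (pastOf (pathAt Y t x.2))) •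
              logGrad f θ₀ (pastOf (pathAt Y t x.2))) v := by
      have h5 := congrArg (fun z => inner ℝ z v) (sqrt_smul_normScore f Y θ₀ x.1 x.2)
      simp only [inner_smul_left, conj_trivial, score, pathAt_zero_apply] at h5
      exact h5
    rw [hsc]
    ring
  rw [e]
  refine (abs_add_le _ _).trans ?_
  have b1 := (Finset.abs_sum_le_sum_abs _ _).trans (Finset.sum_le_sum fun t (_ : t ∈ Finset.Icc 1 x.1) =>
    R.abs_expansion_le (hgood t) hθ (Nat.cast_nonneg (Y (t : ℕ) x.2)) t
      (hw k _ (hgood t) θ hθ hd))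
  rw [Finset.sum_add_distrib, ← Finset.sum_mul, ← Finset.sum_mul, Finset.sum_add_distrib] at b1
  have b2 := h2 v
  have hv0 := norm_nonneg v
  simp only [logGradDiff] at h4
  simp only [gradDiff] at h3
  have b3 := mul_le_mul_of_nonneg_right (add_le_add h4.le h3.le) hv0
  have b4 := mul_le_mul_of_nonneg_right h1 (sq_nonneg ‖v‖)
  rw [abs_mul, abs_of_pos (by norm_num : (0 : ℝ) < 1 / 2)]
  refine (add_le_add (b1.trans (add_le_add b3 b4)) (mul_le_mul_of_nonneg_left b2
    (by norm_num : (0 : ℝ) ≤ 1 / 2))).trans (le_of_eq ?_)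
  ring

end IsCountModel

/-! ### Bounds of the logarithmic remainder by the information -/

lemma logRem_nonneg {x : ℝ} (hx : -1 < x) : 0 ≤ logRem x := by
  have := Real.log_le_sub_one_of_pos (show 0 < 1 + x by linarith)
  unfold logRem
  linarith

lemma abs_logRem_sub_le {x : ℝ} (hx : |x| ≤ 1 / 2) : |logRem x - x ^ 2 / 2| ≤ 2 * |x| * x ^ 2 := by
  have h := Real.abs_log_sub_add_sum_range_le (x := -x) (by rw [abs_neg]; linarith) 2
  simp only [Finset.sum_range_succ, Finset.sum_range_zero, abs_neg, sub_neg_eq_add] at h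
  have e : logRem x - x ^ 2 / 2 = -(0 + (-x) ^ (0 + 1) / ((0 : ℕ) + 1 : ℝ)
      + (-x) ^ (1 + 1) / ((1 : ℕ) + 1 : ℝ) + Real.log (1 + x)) := by
    unfold logRem
    push_cast
    ring
  rw [e, abs_neg]
  refine h.trans ?_
  rw [div_le_iff₀ (by linarith)]
  have h2 : |x| ^ (2 + 1) = |x| * x ^ 2 := by
    rw [pow_succ, sq_abs, mul_comm]
  rw [h2]
  nlinarith [mul_nonneg (abs_nonneg x) (sq_nonneg x)]

namespace IsRegularFamily

variable {d : ℕ} {f : Param d → (ℕ → ℕ) → ℝ} {Θ : Set (Param d)} {θ₀ : Param d} {α : ℕ → ℝ≥0}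
  {c C : ℝ} {y : ℕ → ℕ}

lemma neg_one_lt_ratio (R : IsRegularFamily f Θ θ₀ α c C) {θ : Param d} (hθ : θ ∈ Θ) (q : ℕ → ℕ) :
    -1 < (f θ q - f θ₀ q) / f θ₀ q := by
  have h0 := R.nonneg R.mem q
  have h1 := R.nonneg hθ q
  rw [lt_div_iff₀ h0]
  linarith

lemma ratio_sub_eq (R : IsRegularFamily f Θ θ₀ α c C) (θ : Param d) (q : ℕ → ℕ) :
    (f θ q - f θ₀ q) / f θ₀ q - inner ℝ (logGrad f θ₀ q) (θ - θ₀)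
      = (f θ₀ q)⁻¹ * linErr f θ₀ θ q := by
  have h0 := R.nonneg R.mem q
  simp only [logGrad, inner_smul_left, linErr, conj_trivial]
  field_simp

lemma abs_inv_mul_linErr_trunc_le (R : IsRegularFamily f Θ θ₀ α c C) (hy : tailSum α 0 y ≠ ∞) (t : ℕ)
    {θ : Param d} (hθ : θ ∈ segSet Θ θ₀) :
    |(f θ₀ (trunc t y))⁻¹ * linErr f θ₀ θ (trunc t y)|
      ≤ c⁻¹ * envelope α C y * ‖θ - θ₀‖ ^ 2 := by
  have h0 := R.nonneg R.mem (trunc t y)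
  have hc := R.pos
  have h1 := R.abs_linErr_le (tailSum_trunc_ne_top hy t) hθ
  have h2 : envelope α C (trunc t y) ≤ envelope α C y := envelope_trunc_le hy t
  rw [abs_mul, abs_of_pos (inv_pos.2 h0), mul_assoc]
  refine mul_le_mul (inv_anti₀ hc (R.lower _ R.mem _)) (h1.trans ?_) (abs_nonneg _) (by positivity)
  gcongr

lemma abs_ratio_le (R : IsRegularFamily f Θ θ₀ α c C) (hy : tailSum α 0 y ≠ ∞) (t : ℕ)
    {θ : Param d} (hθ : θ ∈ segSet Θ θ₀) :
    |(f θ (trunc t y) - f θ₀ (trunc t y)) / f θ₀ (trunc t y)|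
      ≤ c⁻¹ * envelope α C y * (‖θ - θ₀‖ + ‖θ - θ₀‖ ^ 2) := by
  have h1 := R.abs_inv_mul_linErr_trunc_le hy t hθ
  rw [← R.ratio_sub_eq] at h1
  have h2 : |inner ℝ (logGrad f θ₀ (trunc t y)) (θ - θ₀)|
      ≤ c⁻¹ * envelope α C y * ‖θ - θ₀‖ := by
    refine (abs_real_inner_le_norm _ _).trans ?_
    have hc := R.pos
    have h3 := R.norm_logGrad_le (tailSum_trunc_ne_top hy t)
    have h4 : envelope α C (trunc t y) ≤ envelope α C y := envelope_trunc_le hy t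
    gcongr
    refine h3.trans ?_
    gcongr
  rw [mul_add]
  have h3 := abs_sub_le ((f θ (trunc t y) - f θ₀ (trunc t y)) / f θ₀ (trunc t y))
    (inner ℝ (logGrad f θ₀ (trunc t y)) (θ - θ₀)) 0
  rw [sub_zero, sub_zero] at h3
  linarith

lemma abs_ratio_sub_le (R : IsRegularFamily f Θ θ₀ α c C) (hy : tailSum α 0 y ≠ ∞) (t : ℕ)
    {θ : Param d} (hθ : θ ∈ segSet Θ θ₀) :
    |(f θ (trunc t y) - f θ₀ (trunc t y)) / f θ₀ (trunc t y)
      - inner ℝ (logGrad f θ₀ y) (θ - θ₀)|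
      ≤ ‖logGrad f θ₀ (trunc t y) - logGrad f θ₀ y‖ * ‖θ - θ₀‖
        + c⁻¹ * envelope α C y * ‖θ - θ₀‖ ^ 2 := by
  have h1 := R.abs_inv_mul_linErr_trunc_le hy t hθ
  rw [← R.ratio_sub_eq] at h1
  have h2 := abs_real_inner_le_norm (logGrad f θ₀ (trunc t y) - logGrad f θ₀ y) (θ - θ₀)
  rw [inner_sub_left] at h2
  have h3 := abs_sub_le ((f θ (trunc t y) - f θ₀ (trunc t y)) / f θ₀ (trunc t y))
    (inner ℝ (logGrad f θ₀ (trunc t y)) (θ - θ₀)) (inner ℝ (logGrad f θ₀ y) (θ - θ₀))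
  linarith

lemma norm_logGrad_trunc_sub_le (R : IsRegularFamily f Θ θ₀ α c C) (hy : tailSum α 0 y ≠ ∞)
    (t : ℕ) : ‖logGrad f θ₀ (trunc t y) - logGrad f θ₀ y‖
      ≤ c⁻¹ * (1 + c⁻¹ * envelope α C y) * (tailSum α t y).toReal := by
  have hc := R.pos
  have h1 := R.norm_logGrad_sub_le (trunc t y) y
  have h2 := R.norm_gradient_trunc_sub_le hy t
  have h3 := R.abs_trunc_sub_le hy t R.mem
  have h4 := R.norm_logGrad_le hy
  have h5 := R.envelope_nonneg y
  have h6 : (0 : ℝ) ≤ (tailSum α t y).toReal := ENNReal.toReal_nonneg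
  refine h1.trans ?_
  rw [mul_assoc]
  refine mul_le_mul_of_nonneg_left ?_ (by positivity)
  have h7 := mul_le_mul h3 h4 (norm_nonneg _) h6
  linarith

/-- The lower bound of the remainder when the envelope and the increment are small. -/
lemma half_inner_sq_sub_le_logRem (R : IsRegularFamily f Θ θ₀ α c C) (hy : tailSum α 0 y ≠ ∞)
    (t : ℕ) {θ : Param d} (hθ : θ ∈ segSet Θ θ₀) {B δ : ℝ} (hB : envelope α C y ≤ B)
    (hδ : ‖θ - θ₀‖ ≤ δ) (hδ1 : δ ≤ 1) (hBδ : 2 * (c⁻¹ * B) * δ ≤ 1 / 2) :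
    1 / 2 * inner ℝ (logGrad f θ₀ y) (θ - θ₀) ^ 2
      - ‖θ - θ₀‖ ^ 2 * (2 * (c⁻¹ * B) * (c⁻¹ * (1 + c⁻¹ * B)) * (tailSum α t y).toReal
        + (2 * (c⁻¹ * B) ^ 2 + 16 * (c⁻¹ * B) ^ 3) * δ)
      ≤ logRem ((f θ (trunc t y) - f θ₀ (trunc t y)) / f θ₀ (trunc t y)) := by
  have hc := R.pos
  have hE := R.envelope_nonneg y
  set x := (f θ (trunc t y) - f θ₀ (trunc t y)) / f θ₀ (trunc t y) with hx
  set z := inner ℝ (logGrad f θ₀ y) (θ - θ₀) with hz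
  set V := ‖θ - θ₀‖ with hV
  set b := c⁻¹ * B with hb
  set T := (tailSum α t y).toReal with hT
  have hT0 : 0 ≤ T := ENNReal.toReal_nonneg
  have hV0 : 0 ≤ V := norm_nonneg _
  have hbE : c⁻¹ * envelope α C y ≤ b := by
    simp only [hb]
    gcongr
  have hb0 : 0 ≤ b := le_trans (by positivity) hbE
  have h1 : |x| ≤ 2 * b * V := by
    refine (R.abs_ratio_le hy t hθ).trans ?_
    rw [← hV]
    have : V ^ 2 ≤ V := by nlinarith
    calc c⁻¹ * envelope α C y * (V + V ^ 2) ≤ b * (V + V) := by gcongr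
      _ = 2 * b * V := by ring
  have h2 : |x - z| ≤ V * (c⁻¹ * (1 + b) * T + b * δ) := by
    refine (R.abs_ratio_sub_le hy t hθ).trans ?_
    have h3 := R.norm_logGrad_trunc_sub_le hy t
    have h4 : ‖logGrad f θ₀ (trunc t y) - logGrad f θ₀ y‖ ≤ c⁻¹ * (1 + b) * T := by
      refine h3.trans ?_
      gcongr
    calc _ ≤ c⁻¹ * (1 + b) * T * V + b * (V * δ) := by
          rw [← hV, sq]
          gcongr
      _ = _ := by ring
  have h3 : |z| ≤ 2 * b * V := by
    refine (abs_real_inner_le_norm _ _).trans ?_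
    have := R.norm_logGrad_le hy
    rw [← hV]
    have h5 : ‖logGrad f θ₀ y‖ ≤ b := this.trans hbE
    nlinarith
  have hxs : |x| ≤ 1 / 2 := h1.trans ((mul_le_mul_of_nonneg_left hδ (by positivity)).trans hBδ)
  have h4 := (abs_le.1 (abs_logRem_sub_le hxs)).1
  have h5 : 2 * |x| * x ^ 2 ≤ V ^ 2 * (16 * b ^ 3 * δ) := by
    rw [← sq_abs x]
    calc 2 * |x| * |x| ^ 2 ≤ 2 * (2 * b * V) * (2 * b * V) ^ 2 := by gcongr
      _ = V ^ 2 * (16 * b ^ 3 * V) := by ring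
      _ ≤ _ := by gcongr
  have h6 : z ^ 2 - x ^ 2 ≤ V ^ 2 * (4 * b * (c⁻¹ * (1 + b) * T + b * δ)) := by
    calc z ^ 2 - x ^ 2 ≤ |(x - z) * (x + z)| := by
          rw [← neg_sub, ← abs_neg]
          refine le_trans (le_of_eq ?_) (le_abs_self _)
          ring
      _ ≤ V * (c⁻¹ * (1 + b) * T + b * δ) * (2 * b * V + 2 * b * V) := by
          rw [abs_mul]
          have : 0 ≤ δ := hV0.trans hδ
          exact mul_le_mul h2 ((abs_add_le _ _).trans (add_le_add h1 h3)) (abs_nonneg _)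
            (by positivity)
      _ = _ := by ring
  linarith

/-- The upper bound of the remainder when the product of the envelope and the increment is
small. -/
lemma logRem_le (R : IsRegularFamily f Θ θ₀ α c C) (hy : tailSum α 0 y ≠ ∞)
    (t : ℕ) {θ : Param d} (hθ : θ ∈ segSet Θ θ₀) {β : ℝ} (hβ : 0 < β) (hβ1 : β ≤ 1)
    (hx : c⁻¹ * envelope α C y * (‖θ - θ₀‖ + ‖θ - θ₀‖ ^ 2) ≤ β / 4) :
    logRem ((f θ (trunc t y) - f θ₀ (trunc t y)) / f θ₀ (trunc t y))
      ≤ 1 / 2 * (1 + 3 * β) * inner ℝ (logGrad f θ₀ y) (θ - θ₀) ^ 2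
        + 4 / β * ‖θ - θ₀‖ ^ 2 * (‖logGrad f θ₀ (trunc t y) - logGrad f θ₀ y‖ ^ 2
          + (c⁻¹ * envelope α C y * ‖θ - θ₀‖) ^ 2) := by
  have h1 := (R.abs_ratio_le hy t hθ).trans hx
  have h2 := R.abs_ratio_sub_le hy t hθ
  set x := (f θ (trunc t y) - f θ₀ (trunc t y)) / f θ₀ (trunc t y) with hx
  set z := inner ℝ (logGrad f θ₀ y) (θ - θ₀) with hz
  set V := ‖θ - θ₀‖ with hV
  set D := ‖logGrad f θ₀ (trunc t y) - logGrad f θ₀ y‖ with hD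
  set b := c⁻¹ * envelope α C y with hb
  have h4 := (abs_le.1 (abs_logRem_sub_le (x := x) (by linarith))).2
  have h5 : 2 * |x| * x ^ 2 ≤ β / 2 * x ^ 2 := by
    have := mul_le_mul_of_nonneg_right h1 (sq_nonneg x)
    linarith
  have h6 : logRem x ≤ (1 + β) / 2 * x ^ 2 := by linarith
  have h7 : (x - z) ^ 2 ≤ 2 * V ^ 2 * (D ^ 2 + (b * V) ^ 2) := by
    have h8 : (x - z) ^ 2 ≤ (D * V + b * V ^ 2) ^ 2 := by
      rw [← sq_abs (x - z)]
      exact pow_le_pow_left₀ (abs_nonneg _) h2 2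
    nlinarith [sq_nonneg (D * V - b * V ^ 2)]
  -- Young's inequality for x = z + (x - z). Together with the factor (1 + β)/2 from the logarithm,
  -- the coefficient (1 + β)² ≤ 1 + 3β appears, as β ≤ 1.
  have h9 : x ^ 2 ≤ (1 + β) * z ^ 2 + (1 + β⁻¹) * (x - z) ^ 2 := by
    have : (1 + β) * z ^ 2 + (1 + β⁻¹) * (x - z) ^ 2 - x ^ 2 = β⁻¹ * (β * z - (x - z)) ^ 2 := by
      field_simp
      ring
    have h10 : 0 ≤ β⁻¹ * (β * z - (x - z)) ^ 2 := by positivity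
    linarith
  have hβ' : 1 ≤ β⁻¹ := (one_le_inv₀ hβ).2 hβ1
  have hQ : 0 ≤ 2 * V ^ 2 * (D ^ 2 + (b * V) ^ 2) := by positivity
  calc logRem x ≤ (1 + β) / 2 * x ^ 2 := h6
    _ ≤ (1 + β) / 2 * ((1 + β) * z ^ 2
        + (1 + β⁻¹) * (2 * V ^ 2 * (D ^ 2 + (b * V) ^ 2))) := by
        have : 0 ≤ 1 + β⁻¹ := by linarith
        gcongr
        exact h9.trans (by gcongr)
    _ = 1 / 2 * (1 + β) ^ 2 * z ^ 2 + (1 + β) / 2 * (1 + β⁻¹) *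
        (2 * V ^ 2 * (D ^ 2 + (b * V) ^ 2)) := by ring
    _ ≤ 1 / 2 * (1 + 3 * β) * z ^ 2 + 2 * β⁻¹ * (2 * V ^ 2 * (D ^ 2 + (b * V) ^ 2)) := by
        have i1 : 1 / 2 * (1 + β) ^ 2 ≤ 1 / 2 * (1 + 3 * β) := by nlinarith
        have i2 : (1 + β) / 2 * (1 + β⁻¹) ≤ 2 * β⁻¹ := by
          have : (1 + β) / 2 * (1 + β⁻¹) ≤ 1 * (β⁻¹ + β⁻¹) := by
            gcongr
            linarith
          linarith
        exact add_le_add (mul_le_mul_of_nonneg_right i1 (sq_nonneg z))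
          (mul_le_mul_of_nonneg_right i2 hQ)
    _ = _ := by ring

end IsRegularFamily

lemma exists_abs_quadratic_le {d : ℕ} (A : Matrix (Fin d) (Fin d) ℝ) :
    ∃ N : ℝ, 0 ≤ N ∧ ∀ v : Param d, |v.ofLp ⬝ᵥ A.mulVec v.ofLp| ≤ N * ‖v‖ ^ 2 := by
  refine ⟨∑ i, ∑ j, |A i j|, by positivity, fun v => ?_⟩
  rw [dotProduct_mulVec_eq_sum, Finset.sum_mul]
  refine (Finset.abs_sum_le_sum_abs _ _).trans (Finset.sum_le_sum fun i _ => ?_)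
  rw [Finset.sum_mul]
  refine (Finset.abs_sum_le_sum_abs _ _).trans (Finset.sum_le_sum fun j _ => ?_)
  rw [abs_mul, abs_mul, mul_comm, sq]
  gcongr
  · exact abs_param_apply_le v i
  · exact abs_param_apply_le v j

namespace IsCountModel

variable {Ω : Type*} [MeasurableSpace Ω] {d : ℕ} {P : Measure Ω} [IsProbabilityMeasure P]
  {Y : ℤ → Ω → ℕ} {f : Param d → (ℕ → ℕ) → ℝ} {Θ : Set (Param d)} {θ₀ : Param d} {α : ℕ → ℝ≥0}
  {c C : ℝ}

lemma integrable_obs_mul_norm_sq (H : IsCountModel P Y f Θ θ₀ α c C)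
    (hJ : ∀ i j, Integrable (entryJ f Y θ₀ i j) P) :
    Integrable (fun s : ℤ → ℕ => (s 0 : ℝ) * ‖logGrad f θ₀ (pastOf s)‖ ^ 2) (pathLaw Y P) := by
  have h := integrable_finsetSum Finset.univ fun i _ => H.integrable_obs_mul_logGrad_mul hJ i i
  refine h.congr (ae_of_all _ fun s => ?_)
  beta_reduce
  rw [EuclideanSpace.real_norm_sq_eq, Finset.mul_sum]
  simp only [sq]

lemma integrable_coord_zero (H : IsCountModel P Y f Θ θ₀ α c C) :
    Integrable (fun s : ℤ → ℕ => (s 0 : ℝ)) (pathLaw Y P) := by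
  have := isProbabilityMeasure_pathLaw H.stationary
  exact (H.memLp_coord 0).integrable one_le_two

lemma integrable_coord_mul_envelope (H : IsCountModel P Y f Θ θ₀ α c C) :
    Integrable (fun s : ℤ → ℕ => (s 0 : ℝ) * envelope α C (pastOf s)) (pathLaw Y P) :=
  (H.memLp_coord 0).integrable_mul H.memLp_envelope

open Classical in
/-- The remainder is asymptotically bounded below by the information. -/
theorem eventually_le_remSum (H : IsCountModel P Y f Θ θ₀ α c C)
    (hJ : ∀ i j, Integrable (entryJ f Y θ₀ i j) P) {η : ℝ} (hη : 0 < η) :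
    ∃ δ : ℝ, 0 < δ ∧ ∀ᶠ x in whp P, ∀ θ ∈ segSet Θ θ₀, dist θ θ₀ < δ →
      x.1 * (1 / 2 * ((θ - θ₀).ofLp ⬝ᵥ (matJ f Y P θ₀).mulVec (θ - θ₀).ofLp) - η * ‖θ - θ₀‖ ^ 2)
        ≤ remSum f Y θ₀ θ x.1 x.2 := by
  have R := H.regular
  have hc := R.pos
  have hu := H.integrable_obs_mul_norm_sq hJ
  have hum : Measurable fun s : ℤ → ℕ => (s 0 : ℝ) * ‖logGrad f θ₀ (pastOf s)‖ ^ 2 :=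
    measurable_coord_zero.mul (((H.measurable_logGrad.comp measurable_pastOf).norm).pow_const 2)
  set φ : (ℤ → ℕ) → ℝ := fun s => (s 0 : ℝ) * ‖logGrad f θ₀ (pastOf s)‖ ^ 2 with hφ
  have hφ0 : ∀ s, 0 ≤ φ s := fun s => by positivity
  -- On `S B` only the positivity of the remainder is used, and the lost information is at most half
  -- of φ‖v‖², which is small in mean for large B because φ is integrable, J being finite. Off `S B`
  -- the relative increments are uniformly small and the quadratic expansion is valid. No
  -- integrability of Y times the squared envelope is needed.
  set S : ℝ → Set (ℤ → ℕ) := fun B => {s | B < envelope α C (pastOf s)} with hS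
  have hSm : ∀ B, MeasurableSet (S B) := fun B =>
    measurableSet_lt measurable_const (measurable_envelope α C)
  have hlim : Tendsto (fun k : ℕ => ∫ s, (S k).indicator φ s ∂(pathLaw Y P)) atTop (𝓝 0) := by
    have := tendsto_integral_of_dominated_convergence (μ := pathLaw Y P)
      (F := fun (k : ℕ) s => (S k).indicator φ s) (f := fun _ => 0) φ
      (fun k => (hum.indicator (hSm k)).aestronglyMeasurable) hu
      (fun k => ae_of_all _ fun s => by
        rw [Real.norm_eq_abs, abs_of_nonneg (Set.indicator_nonneg (fun s _ => hφ0 s) s)]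
        exact Set.indicator_le_self' (fun s _ => hφ0 s) s)
      (ae_of_all _ fun s => by
        obtain ⟨N, hN⟩ := exists_nat_ge (envelope α C (pastOf s))
        refine tendsto_const_nhds.congr' ?_
        filter_upwards [eventually_ge_atTop N] with k hk
        rw [Set.indicator_of_notMem]
        have : (N : ℝ) ≤ k := by exact_mod_cast hk
        simp only [hS, Set.mem_ofPred_eq, not_lt]
        linarith)
    simpa using this
  obtain ⟨k, hk⟩ := (hlim.eventually (gt_mem_nhds (half_pos hη))).exists
  set B : ℝ := (k : ℝ) with hB
  set b : ℝ := c⁻¹ * B with hb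
  have hb0 : 0 ≤ b := by positivity
  set κ₁ : ℝ := 2 * b * (c⁻¹ * (1 + b)) with hκ₁
  set κ₂ : ℝ := 2 * b ^ 2 + 16 * b ^ 3 with hκ₂
  have hκ₁0 : 0 ≤ κ₁ := by positivity
  have hκ₂0 : 0 ≤ κ₂ := by positivity
  set A : ℝ := ∫ s, (s 0 : ℝ) ∂(pathLaw Y P) with hA
  have hδev : ∀ᶠ δ in 𝓝[>] (0 : ℝ), 0 < δ ∧ δ < 1 ∧ 2 * b * δ < 1 / 2 ∧ κ₂ * δ * A < η / 4 := by
    have lim : ∀ g : ℝ → ℝ, Continuous g → g 0 = 0 → Tendsto g (𝓝[>] 0) (𝓝 0) := fun g hg h0 =>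
      (hg.tendsto' 0 0 h0).mono_left nhdsWithin_le_nhds
    filter_upwards [self_mem_nhdsWithin,
      (lim (fun δ => δ) continuous_id rfl).eventually (gt_mem_nhds one_pos),
      (lim (fun δ => 2 * b * δ) (by fun_prop) (by simp)).eventually
        (gt_mem_nhds (by norm_num : (0 : ℝ) < 1 / 2)),
      (lim (fun δ => κ₂ * δ * A) (by fun_prop) (by simp)).eventually
        (gt_mem_nhds (by linarith : (0 : ℝ) < η / 4))] with δ h1 h2 h3 h4
    exact ⟨h1, h2, h3, h4⟩
  obtain ⟨δ, hδ0, hδ1, hδ2, hδ3⟩ := hδev.exists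
  refine ⟨δ, hδ0, ?_⟩
  have hindm : Measurable ((S B).indicator φ) := hum.indicator (hSm B)
  have hindi : Integrable ((S B).indicator φ) (pathLaw Y P) := hu.indicator (hSm B)
  have hi2 := (H.integrable_coord_zero).const_mul (κ₂ * δ)
  have hev := H.eventually_sum_le
    (g := fun t s => 1 / 2 * (S B).indicator φ s
      + κ₁ * ((s 0 : ℝ) * (tailSum α t (pastOf s)).toReal) + κ₂ * δ * (s 0 : ℝ))
    (g' := fun s => 1 / 2 * (S B).indicator φ s + κ₂ * δ * (s 0 : ℝ))
    (G := fun s => 1 / 2 * (S B).indicator φ s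
      + κ₁ * ((s 0 : ℝ) * envelope α C (pastOf s)) + κ₂ * δ * (s 0 : ℝ)) (r := η / 2)
    (fun t => ((hindm.const_mul _).add ((measurable_coord_zero.mul
      ((measurable_tailSum α t).comp measurable_pastOf).ennreal_toReal).const_mul κ₁)).add
      (measurable_coord_zero.const_mul _))
    (((hindi.const_mul _).add (H.integrable_coord_mul_envelope.const_mul κ₁)).add hi2)
    (fun s hs t => by
      have h1 := R.tailSum_le_envelope hs t
      have h2 : 0 ≤ (S B).indicator φ s := Set.indicator_nonneg (fun s _ => hφ0 s) s
      have h3 : (0 : ℝ) ≤ (tailSum α t (pastOf s)).toReal := ENNReal.toReal_nonneg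
      rw [abs_of_nonneg (by positivity)]
      gcongr)
    (fun s hs => by
      have h1 := ((((tendsto_tailSum hs).const_mul (s 0 : ℝ)).const_mul κ₁).const_add
        (1 / 2 * (S B).indicator φ s)).add_const (κ₂ * δ * (s 0 : ℝ))
      simpa using h1)
    (by
      rw [integral_add (hindi.const_mul _) hi2, integral_const_mul, integral_const_mul]
      linarith)
  filter_upwards [hev, H.eventually_tailSum_ne_top, H.eventually_abs_sum_inner_sq_sub_le hJ hη]
    with x h1 hgood h2 θ hθ hd
  have hV : ‖θ - θ₀‖ ≤ δ := by
    rw [← dist_eq_norm]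
    exact hd.le
  set v := θ - θ₀ with hv
  have hterm : ∀ t ∈ Finset.Icc 1 x.1,
      1 / 2 * ((Y (t : ℕ) x.2 : ℝ) * inner ℝ (logGrad f θ₀ (pastOf (pathAt Y t x.2))) v ^ 2)
        - (1 / 2 * (S B).indicator φ (pathAt Y t x.2)
          + κ₁ * ((pathAt Y t x.2 0 : ℝ) * (tailSum α t (pastOf (pathAt Y t x.2))).toReal)
          + κ₂ * δ * (pathAt Y t x.2 0 : ℝ)) * ‖v‖ ^ 2
      ≤ (Y (t : ℕ) x.2 : ℝ) * logRem
        ((f θ (trunc t (pastOf (pathAt Y t x.2))) - f θ₀ (trunc t (pastOf (pathAt Y t x.2))))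
          / f θ₀ (trunc t (pastOf (pathAt Y t x.2)))) := by
    intro t _
    set s := pathAt Y t x.2 with hs
    have hs0 : (Y (t : ℕ) x.2 : ℝ) = (s 0 : ℝ) := by rw [hs, pathAt_zero_apply]
    have ha : (0 : ℝ) ≤ (s 0 : ℝ) := Nat.cast_nonneg _
    have hT : (0 : ℝ) ≤ (tailSum α t (pastOf s)).toReal := ENNReal.toReal_nonneg
    rw [hs0]
    by_cases hE : s ∈ S B
    · rw [Set.indicator_of_mem hE]
      have h3 := mul_nonneg ha (logRem_nonneg (R.neg_one_lt_ratio hθ.1 (trunc t (pastOf s))))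
      refine le_trans ?_ h3
      have h4 : inner ℝ (logGrad f θ₀ (pastOf s)) v ^ 2
          ≤ ‖logGrad f θ₀ (pastOf s)‖ ^ 2 * ‖v‖ ^ 2 := by
        rw [← sq_abs, ← mul_pow]
        exact pow_le_pow_left₀ (abs_nonneg _) (abs_real_inner_le_norm _ _) 2
      have h5 := mul_le_mul_of_nonneg_left h4 ha
      have h6 : 0 ≤ (κ₁ * ((s 0 : ℝ) * (tailSum α t (pastOf s)).toReal)
        + κ₂ * δ * (s 0 : ℝ)) * ‖v‖ ^ 2 := by positivity
      simp only [hφ]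
      nlinarith
    · rw [Set.indicator_of_notMem hE]
      have h3 := R.half_inner_sq_sub_le_logRem (hgood t) t hθ (not_lt.1 hE) hV hδ1.le hδ2.le
      have h4 := mul_le_mul_of_nonneg_left h3 ha
      refine le_trans (le_of_eq ?_) h4
      simp only [hκ₁, hκ₂, hb]
      ring
  have hsum := Finset.sum_le_sum hterm
  rw [Finset.sum_sub_distrib, ← Finset.mul_sum, ← Finset.sum_mul] at hsum
  have h3 := mul_le_mul_of_nonneg_right h1 (sq_nonneg ‖v‖)
  have h4 := (abs_le.1 (h2 v)).1
  unfold remSum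
  linarith

/-- The remainder is asymptotically bounded above by the information, for parameters at distance
`O(n^{-1/2})` of the true one. -/
theorem eventually_remSum_le (H : IsCountModel P Y f Θ θ₀ α c C)
    (hJ : ∀ i j, Integrable (entryJ f Y θ₀ i j) P) (hrate : InitialEffectRate f Y P Θ)
    {K η : ℝ} (hK : 0 ≤ K) (hη : 0 < η) :
    ∀ᶠ x in whp P, ∀ θ ∈ segSet Θ θ₀, Real.sqrt x.1 * ‖θ - θ₀‖ ≤ K →
      remSum f Y θ₀ θ x.1 x.2
        ≤ x.1 * (1 / 2 * ((θ - θ₀).ofLp ⬝ᵥ (matJ f Y P θ₀).mulVec (θ - θ₀).ofLp)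
          + η * ‖θ - θ₀‖ ^ 2) := by
  have R := H.regular
  have hc := R.pos
  obtain ⟨N, hN0, hN⟩ := exists_abs_quadratic_le (matJ f Y P θ₀)
  set A : ℝ := ∫ s, (s 0 : ℝ) * envelope α C (pastOf s) ∂(pathLaw Y P) with hA
  have hA0 : 0 ≤ A := integral_nonneg fun s =>
    mul_nonneg (Nat.cast_nonneg _) (R.envelope_nonneg _)
  have lim : ∀ g : ℝ → ℝ, Continuous g → g 0 = 0 → Tendsto g (𝓝[>] 0) (𝓝 0) := fun g hg h0 =>
      (hg.tendsto' 0 0 h0).mono_left nhdsWithin_le_nhds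
  have hβev : ∀ᶠ β in 𝓝[>] (0 : ℝ), 0 < β ∧ β < 1 ∧ 3 * β * N / 2 + 2 * β < η / 2 := by
    filter_upwards [self_mem_nhdsWithin,
      (lim (fun δ => δ) continuous_id rfl).eventually (gt_mem_nhds one_pos),
      (lim (fun β => 3 * β * N / 2 + 2 * β) (by fun_prop) (by simp)).eventually
        (gt_mem_nhds (by linarith : (0 : ℝ) < η / 2))] with δ h1 h2 h3
    exact ⟨h1, h2, h3⟩
  obtain ⟨β, hβ0, hβ1, hβ2⟩ := hβev.exists
  set M : ℝ := 2 * c⁻¹ + c⁻¹ ^ 2 * K ^ 2 * (A + 1) with hM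
  have hσev : ∀ᶠ σ in 𝓝[>] (0 : ℝ), 0 < σ ∧ 4 / β * (σ * M) < η / 2 ∧
      c⁻¹ * σ * (K * (1 + K)) < β / 4 := by
    filter_upwards [self_mem_nhdsWithin,
      (lim (fun σ => 4 / β * (σ * M)) (by fun_prop) (by simp)).eventually
        (gt_mem_nhds (by linarith : (0 : ℝ) < η / 2)),
      (lim (fun σ => c⁻¹ * σ * (K * (1 + K))) (by fun_prop) (by simp)).eventually
        (gt_mem_nhds (by linarith : (0 : ℝ) < β / 4))] with δ h1 h2 h3
    exact ⟨h1, h2, h3⟩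
  obtain ⟨σ, hσ0, hσ1, hσ2⟩ := hσev.exists
  have hAev := H.eventually_sum_le (g := fun _ s => (s 0 : ℝ) * envelope α C (pastOf s))
    (g' := fun s => (s 0 : ℝ) * envelope α C (pastOf s))
    (fun _ => measurable_coord_zero.mul (measurable_envelope α C)) H.integrable_coord_mul_envelope
    (fun s _ _ => (abs_of_nonneg (mul_nonneg (Nat.cast_nonneg _) (R.envelope_nonneg _))).le)
    (fun _ _ => tendsto_const_nhds) (lt_add_one A)
  -- The squared envelope is integrable, so its maximum over t ≤ n is at most σ²n with probability
  -- tending to one. As ‖v‖ ≤ K/√n, the product of envelope and increment is at most σK for all t at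
  -- once, which replaces the truncation of the lower bound.
  filter_upwards [hAev, H.eventually_tailSum_ne_top, H.eventually_abs_sum_inner_sq_sub_le hJ hβ0,
    (H.tendsto_obs_mul_logGradDiff hrate).eventually (gt_mem_nhds one_pos),
    eventually_whp_forall_le H.stationary.measurePreserving_pathAt H.memLp_envelope.integrable_sq
      (show 0 < σ ^ 2 by positivity),
    tendsto_fst_whp.eventually (eventually_ge_atTop 1)] with x h1 hgood h2 h3 h4 hn θ hθ hd
  have hn1 : (1 : ℝ) ≤ x.1 := by exact_mod_cast hn
  have hs1 : 1 ≤ Real.sqrt x.1 := Real.one_le_sqrt.2 hn1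
  have hss : Real.sqrt x.1 * Real.sqrt x.1 = x.1 := Real.mul_self_sqrt (by linarith)
  rw [inv_mul_lt_iff₀ (by linarith), mul_one] at h3
  set r := Real.sqrt x.1 with hr
  set v := θ - θ₀ with hv
  have hV0 := norm_nonneg v
  have hVK : ‖v‖ ≤ K := le_trans (by nlinarith) hd
  have hterm : ∀ t ∈ Finset.Icc 1 x.1, (Y (t : ℕ) x.2 : ℝ) * logRem
        ((f θ (trunc t (pastOf (pathAt Y t x.2))) - f θ₀ (trunc t (pastOf (pathAt Y t x.2))))
          / f θ₀ (trunc t (pastOf (pathAt Y t x.2))))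
      ≤ 1 / 2 * (1 + 3 * β) *
          ((Y (t : ℕ) x.2 : ℝ) * inner ℝ (logGrad f θ₀ (pastOf (pathAt Y t x.2))) v ^ 2)
        + 4 / β * ‖v‖ ^ 2 * (2 * c⁻¹ * σ * r * ((Y (t : ℕ) x.2 : ℝ) * logGradDiff f Y θ₀ t x.2)
          + c⁻¹ ^ 2 * σ * K ^ 2 * ((pathAt Y t x.2 0 : ℝ)
            * envelope α C (pastOf (pathAt Y t x.2)))) := by
    intro t ht
    have hE2 := h4 t ht
    set s := pathAt Y t x.2 with hs
    have hs0 : (Y (t : ℕ) x.2 : ℝ) = (s 0 : ℝ) := by rw [hs, pathAt_zero_apply]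
    have ha : (0 : ℝ) ≤ (s 0 : ℝ) := Nat.cast_nonneg _
    have hE0 := R.envelope_nonneg (pastOf s)
    set E := envelope α C (pastOf s) with hE
    have hE1 : E ≤ σ * r := by
      rw [← sq_le_sq₀ hE0 (by positivity), mul_pow, sq r, hss]
      exact hE2
    have hEV : E * ‖v‖ ≤ σ * K := by
      calc E * ‖v‖ ≤ σ * r * ‖v‖ := by gcongr
        _ = σ * (r * ‖v‖) := by ring
        _ ≤ σ * K := by gcongr
    have hx : c⁻¹ * E * (‖v‖ + ‖v‖ ^ 2) ≤ β / 4 := by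
      calc c⁻¹ * E * (‖v‖ + ‖v‖ ^ 2) = c⁻¹ * ((E * ‖v‖) * (1 + ‖v‖)) := by ring
        _ ≤ c⁻¹ * ((σ * K) * (1 + K)) := by gcongr
        _ = c⁻¹ * σ * (K * (1 + K)) := by ring
        _ ≤ β / 4 := hσ2.le
    have h5 := R.logRem_le (hgood t) t hθ hβ0 hβ1.le hx
    have hD : logGradDiff f Y θ₀ t x.2 = ‖logGrad f θ₀ (trunc t (pastOf s))
      - logGrad f θ₀ (pastOf s)‖ := rfl
    rw [← hD] at h5
    set D := logGradDiff f Y θ₀ t x.2 with hD'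
    have hD0 : 0 ≤ D := norm_nonneg _
    have hDE : D ≤ 2 * c⁻¹ * E := by
      have i1 := R.norm_logGrad_le (hgood t)
      have i2 := R.norm_logGrad_le (IsRegularFamily.tailSum_trunc_ne_top (hgood t) t)
      have i3 : envelope α C (trunc t (pastOf s)) ≤ E := IsRegularFamily.envelope_trunc_le (hgood t) t
      have i4 : c⁻¹ * envelope α C (trunc t (pastOf s)) ≤ c⁻¹ * E := by gcongr
      rw [hD]
      refine (norm_sub_le _ _).trans ?_
      linarith
    -- One factor of each square is sacrificed to the uniform bound of the envelope by σ√n, here and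
    -- in `hb2`. What remains is linear in D, with ∑ Y_t D_t ≤ √n, or linear in the envelope, whose
    -- product with Y is integrable.
    have hD2 : D ^ 2 ≤ 2 * c⁻¹ * σ * r * D := by
      rw [sq]
      refine mul_le_mul_of_nonneg_right (hDE.trans ?_) hD0
      rw [mul_assoc (2 * c⁻¹)]
      gcongr
    have hb2 : (c⁻¹ * E * ‖v‖) ^ 2 ≤ c⁻¹ ^ 2 * σ * K ^ 2 * E := by
      calc (c⁻¹ * E * ‖v‖) ^ 2 = c⁻¹ ^ 2 * ((E * ‖v‖) * ‖v‖ * E) := by ring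
        _ ≤ c⁻¹ ^ 2 * ((σ * K) * K * E) := by gcongr
        _ = _ := by ring
    rw [hs0]
    calc _ ≤ (s 0 : ℝ) * (1 / 2 * (1 + 3 * β) * inner ℝ (logGrad f θ₀ (pastOf s)) v ^ 2
        + 4 / β * ‖v‖ ^ 2 * (2 * c⁻¹ * σ * r * D + c⁻¹ ^ 2 * σ * K ^ 2 * E)) := by
          refine mul_le_mul_of_nonneg_left (h5.trans ?_) ha
          gcongr
      _ = _ := by ring
  have hsum := Finset.sum_le_sum hterm
  rw [Finset.sum_add_distrib, ← Finset.mul_sum, ← Finset.mul_sum, Finset.sum_add_distrib,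
    ← Finset.mul_sum, ← Finset.mul_sum] at hsum
  have h5 := (abs_le.1 (h2 v)).2
  have h6 := (abs_le.1 (hN v)).2
  unfold remSum
  refine hsum.trans ?_
  set Q := v.ofLp ⬝ᵥ (matJ f Y P θ₀).mulVec v.ofLp with hQ
  set S1 := ∑ t ∈ Finset.Icc 1 x.1,
    (Y (t : ℕ) x.2 : ℝ) * inner ℝ (logGrad f θ₀ (pastOf (pathAt Y t x.2))) v ^ 2 with hS1
  have k1 : 1 / 2 * (1 + 3 * β) * S1
      ≤ x.1 * (1 / 2 * Q) + x.1 * ‖v‖ ^ 2 * (3 * β * N / 2 + 2 * β) := by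
    have j1 : S1 ≤ x.1 * Q + β * (x.1 * ‖v‖ ^ 2) := by linarith
    have j2 : 1 / 2 * (1 + 3 * β) * S1
        ≤ 1 / 2 * (1 + 3 * β) * (x.1 * Q + β * (x.1 * ‖v‖ ^ 2)) := by gcongr
    have j3 : 3 / 2 * β * (x.1 * Q) ≤ 3 / 2 * β * (x.1 * (N * ‖v‖ ^ 2)) := by gcongr
    have j4 : 1 / 2 * (1 + 3 * β) * (β * (x.1 * ‖v‖ ^ 2)) ≤ 2 * (β * (x.1 * ‖v‖ ^ 2)) := by
      have : 0 ≤ β * (x.1 * ‖v‖ ^ 2) := by positivity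
      refine mul_le_mul_of_nonneg_right (by linarith) this
    linarith
  have k2 : 2 * c⁻¹ * σ * r * ∑ t ∈ Finset.Icc 1 x.1, (Y (t : ℕ) x.2 : ℝ) * logGradDiff f Y θ₀ t x.2
      + c⁻¹ ^ 2 * σ * K ^ 2 * ∑ t ∈ Finset.Icc 1 x.1, ((pathAt Y t x.2 0 : ℝ)
            * envelope α C (pastOf (pathAt Y t x.2))) ≤ x.1 * (σ * M) := by
    calc _ ≤ 2 * c⁻¹ * σ * r * r + c⁻¹ ^ 2 * σ * K ^ 2 * ((A + 1) * x.1) := by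
          gcongr
      _ = 2 * c⁻¹ * σ * (r * r) + c⁻¹ ^ 2 * σ * K ^ 2 * ((A + 1) * x.1) := by ring
      _ = _ := by
          rw [hss, hM]
          ring
  have k3 : 4 / β * ‖v‖ ^ 2 * (x.1 * (σ * M)) ≤ x.1 * ‖v‖ ^ 2 * (η / 2) := by
    calc 4 / β * ‖v‖ ^ 2 * (x.1 * (σ * M)) = x.1 * ‖v‖ ^ 2 * (4 / β * (σ * M)) := by ring
      _ ≤ _ := by gcongr
  have k4 := (mul_le_mul_of_nonneg_left k2 (by positivity : 0 ≤ 4 / β * ‖v‖ ^ 2)).trans k3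
  have k5 : x.1 * ‖v‖ ^ 2 * (3 * β * N / 2 + 2 * β) ≤ x.1 * ‖v‖ ^ 2 * (η / 2) := by gcongr
  linarith

end IsCountModel

/-! ### Linear algebra of the active coordinates -/

section ActiveBlock

variable {d : ℕ} (m : Finset (Fin d))

/-- The inclusion of the coordinates of the model `m`. -/
def embedMat : Matrix (Fin d) m ℝ := Matrix.of fun i a => if i = a then 1 else 0

lemma activeBlock_eq (A : Matrix (Fin d) (Fin d) ℝ) :
    activeBlock m A = (embedMat m).transpose * A * embedMat m := by
  ext a b
  simp [activeBlock, embedMat, Matrix.mul_apply]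

lemma embedMat_mul_mul_apply (X : Matrix m m ℝ) (i j : Fin d) :
    (embedMat m * X * (embedMat m).transpose) i j
      = if h : i ∈ m ∧ j ∈ m then X ⟨i, h.1⟩ ⟨j, h.2⟩ else 0 := by
  have key : ∀ (i : Fin d) (g : m → ℝ), ∑ a : m, (if i = (a : Fin d) then g a else 0)
      = if h : i ∈ m then g ⟨i, h⟩ else 0 := by
    intro i g
    split_ifs with h
    · rw [Finset.sum_eq_single ⟨i, h⟩]
      · simp
      · intro a _ ha
        rw [if_neg fun h' => ha (Subtype.ext h'.symm)]
      · simp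
    · refine Finset.sum_eq_zero fun a _ => if_neg fun h' => h (by
        rw [h']
        exact a.2)
  simp only [Matrix.mul_apply, embedMat, Matrix.of_apply, Matrix.transpose_apply, ite_mul, one_mul,
    zero_mul, mul_ite, mul_one, mul_zero, key]
  by_cases hi : i ∈ m <;> by_cases hj : j ∈ m <;> simp [hi, hj]

lemma embedMat_mulVec_apply (w : m → ℝ) {i : Fin d} (hi : i ∉ m) : (embedMat m).mulVec w i = 0 := by
  simp only [Matrix.mulVec, dotProduct, embedMat, Matrix.of_apply, ite_mul, one_mul, zero_mul]
  exact Finset.sum_eq_zero fun a _ => if_neg fun h' => hi (by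
    rw [h']
    exact a.2)

lemma embedMat_mulVec_transpose {w : Fin d → ℝ} (hw : ∀ i, i ∉ m → w i = 0) :
    (embedMat m).mulVec ((embedMat m).transpose.mulVec w) = w := by
  ext i
  have h1 : ∀ a : m, (embedMat m).transpose.mulVec w a = w a := by
    intro a
    simp [Matrix.mulVec, dotProduct, embedMat]
  by_cases hi : i ∈ m
  · simp only [Matrix.mulVec, dotProduct] at h1 ⊢
    simp only [h1]
    rw [Finset.sum_eq_single ⟨i, hi⟩]
    · simp [embedMat]
    · intro a _ ha
      have h2 : i ≠ (a : Fin d) := fun h' => ha (Subtype.ext h'.symm)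
      simp [embedMat, h2]
    · simp
  · rw [embedMat_mulVec_apply m _ hi, hw i hi]

/-- The inverse of the active block, as an operator on the whole space. -/
noncomputable def gain (J : Matrix (Fin d) (Fin d) ℝ) : Matrix (Fin d) (Fin d) ℝ :=
  embedMat m * (activeBlock m J)⁻¹ * (embedMat m).transpose

/-- This presents Σ as the covariance of the gain applied to a vector of covariance I; both its
positivity and the limit law are read off from this form. -/
lemma sandwich_eq {J : Matrix (Fin d) (Fin d) ℝ} (hJ : J.transpose = J)
    (I : Matrix (Fin d) (Fin d) ℝ) : sandwich m J I = gain m J * I * (gain m J).transpose := by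
  have h1 : (activeBlock m J).transpose = activeBlock m J := by
    rw [activeBlock, Matrix.transpose_submatrix, hJ]
  have h2 : gain m J * I * (gain m J).transpose = embedMat m *
      ((activeBlock m J)⁻¹ * activeBlock m I * (activeBlock m J)⁻¹) * (embedMat m).transpose := by
    rw [gain, Matrix.transpose_mul, Matrix.transpose_mul, Matrix.transpose_transpose,
      Matrix.transpose_nonsing_inv, h1, activeBlock_eq m I]
    simp only [Matrix.mul_assoc]
  rw [h2]
  ext i j
  rw [embedMat_mul_mul_apply]
  rfl

lemma gain_mulVec_apply (J : Matrix (Fin d) (Fin d) ℝ) (z : Fin d → ℝ) {i : Fin d} (hi : i ∉ m) :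
    (gain m J).mulVec z i = 0 := by
  rw [gain, Matrix.mul_assoc, ← Matrix.mulVec_mulVec]
  exact embedMat_mulVec_apply m _ hi

/-- The first order condition of the maximization of ⟨w, z⟩ - w'Jw/2 over the model: at the gain of
z, the gradient z - Jw is orthogonal to the model subspace. -/
lemma dotProduct_mulVec_gain {J : Matrix (Fin d) (Fin d) ℝ} (hJ : IsUnit (activeBlock m J).det)
    (z : Fin d → ℝ) {w : Fin d → ℝ} (hw : ∀ i, i ∉ m → w i = 0) :
    w ⬝ᵥ J.mulVec ((gain m J).mulVec z) = w ⬝ᵥ z := by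
  have h : (embedMat m).transpose * (J * gain m J) = (embedMat m).transpose := by
    calc (embedMat m).transpose * (J * gain m J)
        = (embedMat m).transpose * J * embedMat m * (activeBlock m J)⁻¹
          * (embedMat m).transpose := by
          simp only [gain, Matrix.mul_assoc]
      _ = _ := by
          rw [← activeBlock_eq, Matrix.mul_nonsing_inv _ hJ, Matrix.one_mul]
  have key : ∀ u : Fin d → ℝ, w ⬝ᵥ u = (embedMat m).transpose.mulVec w ⬝ᵥ
      (embedMat m).transpose.mulVec u := by
    intro u
    conv_lhs => rw [← embedMat_mulVec_transpose m hw]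
    rw [Matrix.dotProduct_mulVec, Matrix.vecMul_transpose]
  rw [key, key z, Matrix.mulVec_mulVec, Matrix.mulVec_mulVec, Matrix.mul_assoc, h]

/-- The maximum of the limiting quadratic criterion over the model. -/
lemma quadratic_criterion_eq {J : Matrix (Fin d) (Fin d) ℝ} (hJ : J.transpose = J)
    (hJu : IsUnit (activeBlock m J).det) (z : Fin d → ℝ) {w : Fin d → ℝ}
    (hw : ∀ i, i ∉ m → w i = 0) :
    w ⬝ᵥ z - 1 / 2 * (w ⬝ᵥ J.mulVec w)
      = (gain m J).mulVec z ⬝ᵥ z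
        - 1 / 2 * ((gain m J).mulVec z ⬝ᵥ J.mulVec ((gain m J).mulVec z))
        - 1 / 2 * ((w - (gain m J).mulVec z) ⬝ᵥ J.mulVec (w - (gain m J).mulVec z)) := by
  set h := (gain m J).mulVec z with hh
  have h1 : w ⬝ᵥ J.mulVec h = w ⬝ᵥ z := dotProduct_mulVec_gain m hJu z hw
  have h2 : h ⬝ᵥ J.mulVec h = h ⬝ᵥ z :=
    dotProduct_mulVec_gain m hJu z fun i hi => gain_mulVec_apply m J z hi
  have h3 : h ⬝ᵥ J.mulVec w = w ⬝ᵥ J.mulVec h := by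
    rw [Matrix.dotProduct_mulVec, ← Matrix.mulVec_transpose, hJ, dotProduct_comm]
  rw [Matrix.mulVec_sub, sub_dotProduct, dotProduct_sub, dotProduct_sub, h3, h1, h2]
  ring

/-- The constant is the minimum of the form on the unit sphere, by compactness and homogeneity. The
sphere is empty when d = 0, where any constant works. -/
lemma exists_le_quadratic {A : Matrix (Fin d) (Fin d) ℝ}
    (hA : ∀ v : Param d, v ≠ 0 → 0 < v.ofLp ⬝ᵥ A.mulVec v.ofLp) :
    ∃ j : ℝ, 0 < j ∧ ∀ v : Param d, j * ‖v‖ ^ 2 ≤ v.ofLp ⬝ᵥ A.mulVec v.ofLp := by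
  have hc : Continuous fun v : Param d => v.ofLp ⬝ᵥ A.mulVec v.ofLp := by fun_prop
  rcases (Metric.sphere (0 : Param d) 1).eq_empty_or_nonempty with he | hne
  · refine ⟨1, one_pos, fun v => ?_⟩
    have hv : v = 0 := by
      by_contra hv
      have : ‖v‖⁻¹ • v ∈ Metric.sphere (0 : Param d) 1 := by
        rw [mem_sphere_zero_iff_norm, norm_smul, norm_inv, norm_norm,
          inv_mul_cancel₀ (norm_ne_zero_iff.2 hv)]
      simp [he] at this
    simp [hv]
  · obtain ⟨u, hu, hmin⟩ := (isCompact_sphere (0 : Param d) 1).exists_isMinOn hne hc.continuousOn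
    have hu0 : u ≠ 0 := by
      rintro rfl
      simp at hu
    refine ⟨_, hA u hu0, fun v => ?_⟩
    rcases eq_or_ne v 0 with rfl | hv
    · simp
    have hv' := norm_ne_zero_iff.2 hv
    have hmem : ‖v‖⁻¹ • v ∈ Metric.sphere (0 : Param d) 1 := by
      rw [mem_sphere_zero_iff_norm, norm_smul, norm_inv, norm_norm, inv_mul_cancel₀ hv']
    have h1 := hmin hmem
    simp only [Set.mem_ofPred_eq, WithLp.ofLp_smul, Matrix.mulVec_smul, smul_dotProduct,
      dotProduct_smul, smul_eq_mul] at h1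
    have h2 := mul_le_mul_of_nonneg_right h1 (sq_nonneg ‖v‖)
    refine h2.trans (le_of_eq ?_)
    field_simp

/-- The gain operator on the Euclidean space. -/
noncomputable def gainMap (J : Matrix (Fin d) (Fin d) ℝ) (z : Param d) : Param d := WithLp.toLp 2 ((gain m J).mulVec z.ofLp)

lemma continuous_gainMap (J : Matrix (Fin d) (Fin d) ℝ) :
    Continuous (gainMap m J) := by
  unfold gainMap
  fun_prop

lemma inner_gainMap (J : Matrix (Fin d) (Fin d) ℝ) (z v : Param d) :
    inner ℝ (gainMap m J z) v
      = inner ℝ z (WithLp.toLp 2 ((gain m J).transpose.mulVec v.ofLp)) := by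
  simp only [EuclideanSpace.inner_eq_star_dotProduct, gainMap, star_trivial]
  rw [Matrix.dotProduct_mulVec, Matrix.mulVec_transpose]

end ActiveBlock

lemma transpose_matJ {Ω : Type*} [MeasurableSpace Ω] {d : ℕ} (f : Param d → (ℕ → ℕ) → ℝ) (Y : ℤ → Ω → ℕ) (P : Measure Ω)
    (θ₀ : Param d) : (matJ f Y P θ₀).transpose = matJ f Y P θ₀ := by
  ext i j
  simp only [matJ, Matrix.transpose_apply, Matrix.of_apply, entryJ,
    mul_comm (gradLam f Y 1 θ₀ _ i)]

lemma transpose_matI {Ω : Type*} [MeasurableSpace Ω] {d : ℕ} (f : Param d → (ℕ → ℕ) → ℝ) (Y : ℤ → Ω → ℕ) (P : Measure Ω)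
    (θ₀ : Param d) : (matI f Y P θ₀).transpose = matI f Y P θ₀ := by
  ext i j
  simp only [matI, Matrix.transpose_apply, Matrix.of_apply, entryI,
    mul_comm (gradLam f Y 1 θ₀ _ i)]

/-! ### Nondegeneracy of J and the Gaussian limit -/

namespace IsCountModel

variable {Ω : Type*} [MeasurableSpace Ω] {d : ℕ} {P : Measure Ω} [IsProbabilityMeasure P]
  {Y : ℤ → Ω → ℕ} {f : Param d → (ℕ → ℕ) → ℝ} {Θ : Set (Param d)} {θ₀ : Param d} {α : ℕ → ℝ≥0}
  {c C : ℝ}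

lemma posSemidef_matI (H : IsCountModel P Y f Θ θ₀ α c C)
    (hI : ∀ i j, Integrable (entryI f Y P θ₀ i j) P) : (matI f Y P θ₀).PosSemidef := by
  refine Matrix.PosSemidef.of_dotProduct_mulVec_nonneg ?_ fun x => ?_
  · rw [Matrix.IsHermitian, Matrix.conjTranspose_eq_transpose_of_trivial, transpose_matI]
  · have h := (H.memLp_score hI (WithLp.toLp 2 x)).2
    rw [star_trivial]
    change 0 ≤ (WithLp.toLp 2 x).ofLp ⬝ᵥ (matI f Y P θ₀).mulVec (WithLp.toLp 2 x).ofLp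
    rw [← h]
    exact integral_nonneg fun s => sq_nonneg _

-- v'Jv is the mean of λ⁻¹⟨v, ∂λ⟩² with λ > 0; if it vanished, ⟨v, ∂λ⟩ would be zero almost surely.
omit [IsProbabilityMeasure P] in
lemma quadratic_matJ_pos (H : IsCountModel P Y f Θ θ₀ α c C)
    (hJ : ∀ i j, Integrable (entryJ f Y θ₀ i j) P)
    (hgrad : ∀ c : Param d, (∀ᵐ ω ∂P, inner ℝ c (gradLam f Y 1 θ₀ ω) = 0) → c = 0)
    {v : Param d} (hv : v ≠ 0) : 0 < v.ofLp ⬝ᵥ (matJ f Y P θ₀).mulVec v.ofLp := by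
  have R := H.regular
  have e : ∀ ω, (lam f Y 1 θ₀ ω)⁻¹ * inner ℝ v (gradLam f Y 1 θ₀ ω) ^ 2
      = ∑ i, ∑ j, v i * v j * entryJ f Y θ₀ i j ω := by
    intro ω
    rw [real_inner_comm, inner_sq_eq_sum, Finset.mul_sum]
    refine Finset.sum_congr rfl fun i _ => ?_
    rw [Finset.mul_sum]
    refine Finset.sum_congr rfl fun j _ => ?_
    rw [entryJ]
    ring
  have hint : Integrable (fun ω => ∑ i, ∑ j, v i * v j * entryJ f Y θ₀ i j ω) P :=
    integrable_finsetSum _ fun i _ => integrable_finsetSum _ fun j _ => (hJ i j).const_mul _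
  have hval : ∫ ω, (lam f Y 1 θ₀ ω)⁻¹ * inner ℝ v (gradLam f Y 1 θ₀ ω) ^ 2 ∂P
      = v.ofLp ⬝ᵥ (matJ f Y P θ₀).mulVec v.ofLp := by
    simp only [e]
    rw [integral_finsetSum _ fun i _ => integrable_finsetSum _ fun j _ => (hJ i j).const_mul _,
      dotProduct_mulVec_eq_sum]
    refine Finset.sum_congr rfl fun i _ => ?_
    rw [integral_finsetSum _ fun j _ => (hJ i j).const_mul _]
    refine Finset.sum_congr rfl fun j _ => ?_
    rw [integral_const_mul]
    rfl
  have hlam : ∀ ω, 0 < lam f Y 1 θ₀ ω := fun ω => R.nonneg R.mem _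
  have hnn : ∀ ω, 0 ≤ (lam f Y 1 θ₀ ω)⁻¹ * inner ℝ v (gradLam f Y 1 θ₀ ω) ^ 2 := fun ω =>
    mul_nonneg (inv_nonneg.2 (hlam ω).le) (sq_nonneg _)
  rw [← hval]
  refine lt_of_le_of_ne (integral_nonneg hnn) fun h0 => hv (hgrad v ?_)
  have hint' : Integrable (fun ω => (lam f Y 1 θ₀ ω)⁻¹ * inner ℝ v (gradLam f Y 1 θ₀ ω) ^ 2) P := by
    simpa only [e] using hint
  have h1 := (integral_eq_zero_iff_of_nonneg hnn hint').1 h0.symm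
  filter_upwards [h1] with ω hω
  have hω' : (lam f Y 1 θ₀ ω)⁻¹ * inner ℝ v (gradLam f Y 1 θ₀ ω) ^ 2 = 0 := hω
  rcases mul_eq_zero.1 hω' with h2 | h2
  · exact absurd h2 (inv_ne_zero (hlam ω).ne')
  · exact pow_eq_zero_iff two_ne_zero |>.1 h2

omit [IsProbabilityMeasure P] in
lemma isUnit_det_activeBlock (H : IsCountModel P Y f Θ θ₀ α c C)
    (hJ : ∀ i j, Integrable (entryJ f Y θ₀ i j) P)
    (hgrad : ∀ c : Param d, (∀ᵐ ω ∂P, inner ℝ c (gradLam f Y 1 θ₀ ω) = 0) → c = 0)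
    (m : Finset (Fin d)) : IsUnit (activeBlock m (matJ f Y P θ₀)).det := by
  have hpd : (matJ f Y P θ₀).PosDef := by
    refine Matrix.PosDef.of_dotProduct_mulVec_pos ?_ fun x hx => ?_
    · rw [Matrix.IsHermitian, Matrix.conjTranspose_eq_transpose_of_trivial, transpose_matJ]
    · rw [star_trivial]
      exact H.quadratic_matJ_pos hJ hgrad (v := WithLp.toLp 2 x) (by simpa using hx)
  exact (hpd.submatrix Subtype.val_injective).det_pos.ne'.isUnit

lemma posSemidef_sandwich (H : IsCountModel P Y f Θ θ₀ α c C)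
    (hI : ∀ i j, Integrable (entryI f Y P θ₀ i j) P) (m : Finset (Fin d)) :
    (sandwich m (matJ f Y P θ₀) (matI f Y P θ₀)).PosSemidef := by
  rw [sandwich_eq m (transpose_matJ f Y P θ₀), ← Matrix.conjTranspose_eq_transpose_of_trivial]
  exact (H.posSemidef_matI hI).mul_mul_conjTranspose_same _

/-- The limit law of the maximizer of the quadratic approximation. -/
lemma tendstoInDistribution_gainMap (H : IsCountModel P Y f Θ θ₀ α c C)
    (hI : ∀ i j, Integrable (entryI f Y P θ₀ i j) P) (m : Finset (Fin d)) :
    TendstoInDistribution (fun n ω => gainMap m (matJ f Y P θ₀) (normScore f Y θ₀ n ω)) atTop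
      (id : Param d → Param d) (fun _ => P)
      (multivariateGaussian 0 (sandwich m (matJ f Y P θ₀) (matI f Y P θ₀))) := by
  set J := matJ f Y P θ₀ with hJdef
  have hm : ∀ n, Measurable fun ω => gainMap m J (normScore f Y θ₀ n ω) := fun n =>
    (continuous_gainMap m J).measurable.comp (H.measurable_normScore n)
  refine ⟨fun n => (hm n).aemeasurable, aemeasurable_id, ?_⟩
  refine ProbabilityMeasure.tendsto_iff_tendsto_charFun.2 fun v => ?_
  change Tendsto (fun n => charFun (P.map fun ω => gainMap m J (normScore f Y θ₀ n ω)) v) atTop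
    (𝓝 (charFun ((multivariateGaussian 0 (sandwich m J (matI f Y P θ₀))).map id) v))
  rw [Measure.map_id, charFun_multivariateGaussian (H.posSemidef_sandwich hI m)]
  -- The characteristic function of a linear image at v is that of the original vector at the
  -- transposed image of v.
  set u : Param d := WithLp.toLp 2 ((gain m J).transpose.mulVec v.ofLp) with hu
  have h := H.tendsto_charFun_normScore hI u
  have e1 : u.ofLp ⬝ᵥ (matI f Y P θ₀).mulVec u.ofLp
      = v.ofLp ⬝ᵥ (sandwich m J (matI f Y P θ₀)).mulVec v.ofLp := by
    rw [sandwich_eq m (transpose_matJ f Y P θ₀), ← Matrix.mulVec_mulVec, ← Matrix.mulVec_mulVec,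
      Matrix.dotProduct_mulVec v.ofLp, ← Matrix.mulVec_transpose]
  rw [e1] at h
  have e2 : Complex.exp (↑(inner ℝ v (0 : Param d)) * Complex.I
      - ↑(v.ofLp ⬝ᵥ (sandwich m J (matI f Y P θ₀)).mulVec v.ofLp) / 2)
      = Complex.exp (-((v.ofLp ⬝ᵥ (sandwich m J (matI f Y P θ₀)).mulVec v.ofLp : ℝ) : ℂ) / 2) := by
    congr 1
    simp
    ring
  rw [e2]
  refine h.congr fun n => ?_
  rw [charFun_apply, charFun_apply, integral_map (H.measurable_normScore n).aemeasurable
    (by fun_prop), integral_map (hm n).aemeasurable (by fun_prop)]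
  simp only [inner_gainMap, hu]

end IsCountModel

/-! ### Rate of convergence, behaviour of the maximizer, and model selection -/

namespace IsCountModel

variable {Ω : Type*} [MeasurableSpace Ω] {d : ℕ} {P : Measure Ω} [IsProbabilityMeasure P]
  {Y : ℤ → Ω → ℕ} {f : Param d → (ℕ → ℕ) → ℝ} {Θ : Set (Param d)} {θ₀ : Param d} {α : ℕ → ℝ≥0}
  {c C : ℝ}

/-- The quadratic upper bound of the quasi-log-likelihood ratio near the true parameter. -/
lemma eventually_quasiLogLik_sub_le (H : IsCountModel P Y f Θ θ₀ α c C)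
    (hJ : ∀ i j, Integrable (entryJ f Y θ₀ i j) P) (hrate : InitialEffectRate f Y P Θ)
    {j : ℝ} (hj0 : 0 < j)
    (hj : ∀ v : Param d, j * ‖v‖ ^ 2 ≤ v.ofLp ⬝ᵥ (matJ f Y P θ₀).mulVec v.ofLp) :
    ∃ δ : ℝ, 0 < δ ∧ ∀ᶠ x in whp P, ∀ θ ∈ segSet Θ θ₀, dist θ θ₀ < δ →
      quasiLogLik f Y x.1 θ x.2 - quasiLogLik f Y x.1 θ₀ x.2
        ≤ Real.sqrt x.1 * ‖θ - θ₀‖ * (‖normScore f Y θ₀ x.1 x.2‖ + 1)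
          - j / 4 * (Real.sqrt x.1 * ‖θ - θ₀‖) ^ 2 := by
  -- The curvature j/2 loses j/8 in the expansion and j/8 in the bound of the remainder, which
  -- leaves j/4. The cap 1 bounds the first order error, absorbed in ‖Z_n‖ + 1.
  have hη : 0 < min (j / 8) 1 := lt_min (by linarith) one_pos
  obtain ⟨δ₁, hδ₁, h1⟩ := H.eventually_abs_expansion_le hrate hη
  obtain ⟨δ₂, hδ₂, h2⟩ := H.eventually_le_remSum hJ (show 0 < j / 8 by linarith)
  refine ⟨min δ₁ δ₂, lt_min hδ₁ hδ₂, ?_⟩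
  filter_upwards [h1, h2] with x h1 h2 θ hθ hd
  have h3 := (abs_le.1 (h1 θ hθ (hd.trans_le (min_le_left _ _)))).2
  have h4 := h2 θ hθ (hd.trans_le (min_le_right _ _))
  have h5 := hj (θ - θ₀)
  set v := θ - θ₀ with hv
  have hn : (0 : ℝ) ≤ x.1 := Nat.cast_nonneg _
  have hss : Real.sqrt x.1 * Real.sqrt x.1 = x.1 := Real.mul_self_sqrt hn
  have hs := Real.sqrt_nonneg (x.1 : ℝ)
  have h6 := mul_le_mul_of_nonneg_left (real_inner_le_norm (normScore f Y θ₀ x.1 x.2) v) hs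
  have h7 := mul_le_mul_of_nonneg_right (min_le_right (j / 8) 1)
    (show 0 ≤ Real.sqrt x.1 * ‖v‖ by positivity)
  have h8 := mul_le_mul_of_nonneg_right (min_le_left (j / 8) 1)
    (show 0 ≤ x.1 * ‖v‖ ^ 2 by positivity)
  have h9 := mul_le_mul_of_nonneg_left h5 hn
  rw [mul_pow, sq (Real.sqrt _), hss]
  rw [mul_add (min (j / 8) 1)] at h3
  linarith

/-- Parameters with a large quasi-likelihood are `√n`-close to the true one. -/
lemma eventually_close_of_quasiLogLik_le (H : IsCountModel P Y f Θ θ₀ α c C)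
    (hident : Identifiable f Y P Θ)
    (hJ : ∀ i j, Integrable (entryJ f Y θ₀ i j) P) (hrate : InitialEffectRate f Y P Θ)
    {j : ℝ} (hj0 : 0 < j)
    (hj : ∀ v : Param d, j * ‖v‖ ^ 2 ≤ v.ofLp ⬝ᵥ (matJ f Y P θ₀).mulVec v.ofLp)
    {S : Set (Param d)} (hS : S ⊆ Θ) {r : ℝ} (hr : 0 < r)
    (hseg : ∀ θ ∈ S, dist θ θ₀ < r → segment ℝ θ₀ θ ⊆ Θ) :
    ∀ᶠ x in whp P, ∀ θ ∈ S, quasiLogLik f Y x.1 θ₀ x.2 ≤ quasiLogLik f Y x.1 θ x.2 →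
      θ ∈ segSet Θ θ₀ ∧
      Real.sqrt x.1 * ‖θ - θ₀‖ ≤ 4 / j * (‖normScore f Y θ₀ x.1 x.2‖ + 1) ∧
      quasiLogLik f Y x.1 θ x.2 - quasiLogLik f Y x.1 θ₀ x.2
        ≤ (‖normScore f Y θ₀ x.1 x.2‖ + 1) ^ 2 / j := by
  obtain ⟨δ, hδ, h1⟩ := H.eventually_quasiLogLik_sub_le hJ hrate hj0 hj
  have hclosed : IsClosed {θ | min δ r ≤ dist θ θ₀} :=
    isClosed_le continuous_const (by fun_prop)
  obtain ⟨ρ, hρ, h2⟩ := H.eventually_quasiLogLik_le hident hclosed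
    (by simp [hδ, hr])
  filter_upwards [h1, h2, tendsto_fst_whp.eventually (eventually_ge_atTop 1)]
    with x h1 h2 hn θ hθ hL
  have hn0 : (0 : ℝ) < x.1 := by exact_mod_cast hn
  have hd : dist θ θ₀ < min δ r := by
    by_contra hcon
    have h3 := h2 θ ⟨hS hθ, not_lt.1 hcon⟩
    have := mul_pos hρ hn0
    linarith
  have hseg' : θ ∈ segSet Θ θ₀ := ⟨hS hθ, hseg θ hθ (hd.trans_le (min_le_right _ _))⟩
  have h3 := h1 θ hseg' (hd.trans_le (min_le_left _ _))
  set s := Real.sqrt x.1 * ‖θ - θ₀‖ with hs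
  set z := ‖normScore f Y θ₀ x.1 x.2‖ + 1 with hz
  have hs0 : 0 ≤ s := by positivity
  have hz0 : 0 < z := by positivity
  refine ⟨hseg', ?_, ?_⟩
  · by_contra hcon
    have h4 : 4 / j * z < s := not_le.1 hcon
    have hspos : 0 < s := lt_of_le_of_lt (by positivity) h4
    have h5 : z < j / 4 * s := by
      have := mul_lt_mul_of_pos_left h4 (show 0 < j / 4 by linarith)
      have e : j / 4 * (4 / j * z) = z := by field_simp
      linarith
    have h6 := mul_lt_mul_of_pos_left h5 hspos
    nlinarith
  -- The maximum of sz - js²/4 over s is z²/j.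
  · refine h3.trans ?_
    rw [le_div_iff₀ hj0]
    nlinarith [sq_nonneg (j * s - 2 * z)]

/-- The quadratic approximation of the quasi-log-likelihood ratio at distance `O(n^{-1/2})`. -/
lemma eventually_abs_quasiLogLik_sub_le (H : IsCountModel P Y f Θ θ₀ α c C)
    (hJ : ∀ i j, Integrable (entryJ f Y θ₀ i j) P) (hrate : InitialEffectRate f Y P Θ)
    {K η : ℝ} (hK : 0 ≤ K) (hη : 0 < η) :
    ∀ᶠ x in whp P, ∀ θ ∈ segSet Θ θ₀, ‖Real.sqrt x.1 • (θ - θ₀)‖ ≤ K →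
      |quasiLogLik f Y x.1 θ x.2 - quasiLogLik f Y x.1 θ₀ x.2
        - ((Real.sqrt x.1 • (θ - θ₀)).ofLp ⬝ᵥ (normScore f Y θ₀ x.1 x.2).ofLp
          - 1 / 2 * ((Real.sqrt x.1 • (θ - θ₀)).ofLp ⬝ᵥ
            (matJ f Y P θ₀).mulVec (Real.sqrt x.1 • (θ - θ₀)).ofLp))| ≤ η := by
  -- The expansion costs ε(K + K²) and the remainder a further εK²; the added 1 keeps the
  -- denominator positive when K = 0.
  set ε : ℝ := η / (K + 2 * K ^ 2 + 1) with hε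
  have hden : 0 < K + 2 * K ^ 2 + 1 := by positivity
  have hε0 : 0 < ε := by positivity
  obtain ⟨δ₁, hδ₁, h1⟩ := H.eventually_abs_expansion_le hrate hε0
  obtain ⟨δ₂, hδ₂, h2⟩ := H.eventually_le_remSum hJ hε0
  have hlim : Tendsto (fun n : ℕ => Real.sqrt n * min δ₁ δ₂) atTop atTop :=
    (Real.tendsto_sqrt_atTop.comp tendsto_natCast_atTop_atTop).atTop_mul_const (lt_min hδ₁ hδ₂)
  filter_upwards [h1, h2, H.eventually_remSum_le hJ hrate hK hε0,
    tendsto_fst_whp.eventually (hlim.eventually_gt_atTop K)] with x h1 h2 h3 hn θ hθ hθK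
  have hs := Real.sqrt_nonneg (x.1 : ℝ)
  rw [norm_smul, Real.norm_eq_abs, abs_of_nonneg hs] at hθK
  have hd : dist θ θ₀ < min δ₁ δ₂ := by
    rw [dist_eq_norm]
    exact lt_of_mul_lt_mul_left (hθK.trans_lt hn) hs
  have i1 := abs_le.1 (h1 θ hθ (hd.trans_le (min_le_left _ _)))
  have i2 := h2 θ hθ (hd.trans_le (min_le_right _ _))
  have i3 := h3 θ hθ hθK
  set v := θ - θ₀ with hv
  have hss : Real.sqrt x.1 * Real.sqrt x.1 = x.1 := Real.mul_self_sqrt (Nat.cast_nonneg _)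
  have e1 : (Real.sqrt x.1 • v).ofLp ⬝ᵥ (normScore f Y θ₀ x.1 x.2).ofLp
      = Real.sqrt x.1 * inner ℝ (normScore f Y θ₀ x.1 x.2) v := by
    rw [WithLp.ofLp_smul, smul_dotProduct, smul_eq_mul, EuclideanSpace.inner_eq_star_dotProduct,
      star_trivial]
  have e2 : (Real.sqrt x.1 • v).ofLp ⬝ᵥ (matJ f Y P θ₀).mulVec (Real.sqrt x.1 • v).ofLp
      = x.1 * (v.ofLp ⬝ᵥ (matJ f Y P θ₀).mulVec v.ofLp) := by
    rw [WithLp.ofLp_smul, Matrix.mulVec_smul, smul_dotProduct, dotProduct_smul, smul_eq_mul,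
      smul_eq_mul, ← mul_assoc, hss]
  rw [e1, e2]
  have hV : x.1 * ‖v‖ ^ 2 ≤ K ^ 2 := by
    calc x.1 * ‖v‖ ^ 2 = (Real.sqrt x.1 * ‖v‖) ^ 2 := by
          rw [mul_pow, sq (Real.sqrt _), hss]
      _ ≤ K ^ 2 := pow_le_pow_left₀ (by positivity) hθK 2
  have b1 : ε * (Real.sqrt x.1 * ‖v‖ + x.1 * ‖v‖ ^ 2) ≤ ε * (K + K ^ 2) := by gcongr
  have b2 : ε * (x.1 * ‖v‖ ^ 2) ≤ ε * K ^ 2 := by gcongr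
  have b3 : ε * (K + 2 * K ^ 2 + 1) = η := div_mul_cancel₀ _ hden.ne'
  rw [abs_le]
  constructor <;> linarith [i1.1, i1.2]

/-- The maximizer over the model `m` is close to the maximizer of the quadratic approximation. -/
lemma eventually_norm_sub_gainMap_le (H : IsCountModel P Y f Θ θ₀ α c C)
    (hident : Identifiable f Y P Θ)
    (hJ : ∀ i j, Integrable (entryJ f Y θ₀ i j) P) (hrate : InitialEffectRate f Y P Θ)
    (hgrad : ∀ c : Param d, (∀ᵐ ω ∂P, inner ℝ c (gradLam f Y 1 θ₀ ω) = 0) → c = 0)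
    {m : Finset (Fin d)} (hm : θ₀ ∈ modelSet Θ m) {r : ℝ} (hr : 0 < r)
    (hint : ∀ θ : Param d, (∀ i, i ∉ m → θ i = 0) → dist θ θ₀ < r → θ ∈ Θ)
    (K : ℝ) {ε : ℝ} (hε : 0 < ε) :
    ∀ᶠ x in whp P ⊓ 𝓟 {x : ℕ × Ω | ‖normScore f Y θ₀ x.1 x.2‖ ≤ K}, ∀ θ ∈ modelSet Θ m,
      IsMaxOn (fun θ => quasiLogLik f Y x.1 θ x.2) (modelSet Θ m) θ →
      ‖Real.sqrt x.1 • (θ - θ₀) - gainMap m (matJ f Y P θ₀) (normScore f Y θ₀ x.1 x.2)‖ ≤ ε := by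
  set J := matJ f Y P θ₀ with hJdef
  obtain ⟨j, hj0, hj⟩ := exists_le_quadratic fun v hv => H.quadratic_matJ_pos hJ hgrad (v := v) hv
  obtain ⟨G, hG⟩ := (isCompact_closedBall (0 : Param d) K).exists_bound_of_continuousOn
    (continuous_gainMap m J).continuousOn
  -- A common bound, on the event ‖Z_n‖ ≤ K, for the rescaled estimator and for the maximizer of the
  -- quadratic approximation, so that the approximation holds at both.
  set K' : ℝ := max (4 / j * (K + 1)) (max G 0) with hK'
  have hK'0 : 0 ≤ K' := (le_max_right _ _).trans (le_max_right _ _)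
  have hsegm : ∀ θ : Param d, (∀ i, i ∉ m → θ i = 0) → dist θ θ₀ < r → segment ℝ θ₀ θ ⊆ Θ := by
    intro θ hθ hd ϑ hϑ
    obtain ⟨s, hs, rfl⟩ := (segment_eq_image' ℝ θ₀ θ) ▸ hϑ
    refine hint _ (fun i hi => ?_) ?_
    · simp [hm.2 i hi, hθ i hi]
    · rw [dist_eq_norm, add_sub_cancel_left, norm_smul, Real.norm_eq_abs, abs_of_nonneg hs.1]
      rw [dist_eq_norm] at hd
      exact (mul_le_of_le_one_left (norm_nonneg _) hs.2).trans_lt hd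
  have hclose := H.eventually_close_of_quasiLogLik_le hident hJ hrate hj0 hj
    (S := modelSet Θ m) (fun θ hθ => hθ.1) hr (fun θ hθ => hsegm θ hθ.2)
  have hquad := H.eventually_abs_quasiLogLik_sub_le hJ hrate hK'0
    (show 0 < j * ε ^ 2 / 4 by positivity)
  have hlim : Tendsto (fun n : ℕ => Real.sqrt n * r) atTop atTop :=
    (Real.tendsto_sqrt_atTop.comp tendsto_natCast_atTop_atTop).atTop_mul_const hr
  filter_upwards [hclose.filter_mono inf_le_left, hquad.filter_mono inf_le_left,
    (tendsto_fst_whp.eventually (hlim.eventually_gt_atTop K')).filter_mono inf_le_left,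
    mem_inf_of_right (mem_principal_self _)] with x hclose hquad hn hZ θ hθ hmax
  have hZ' : ‖normScore f Y θ₀ x.1 x.2‖ ≤ K := hZ
  have hr0 : 0 < Real.sqrt x.1 := by
    by_contra hcon
    have := mul_nonpos_of_nonpos_of_nonneg (not_lt.1 hcon) hr.le
    linarith
  set Z := normScore f Y θ₀ x.1 x.2 with hZdef
  set h := gainMap m J Z with hh
  have hhK : ‖h‖ ≤ K' := (hG Z (by simpa using hZ')).trans
    ((le_max_left _ _).trans (le_max_right _ _))
  have hh0 : ∀ i, i ∉ m → h i = 0 := fun i hi => gain_mulVec_apply m J _ hi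
  -- The competitor: the maximizer of the quadratic approximation in the original scale. It lies in
  -- Θ(m) for large n because θ₀ is interior. The likelihood at θ is at least that at θ₁, and each
  -- is known up to jε²/4, so that (j/2)‖w - h‖² ≤ jε²/2.
  set θ₁ : Param d := θ₀ + (Real.sqrt x.1)⁻¹ • h with hθ₁
  have hθ₁0 : ∀ i, i ∉ m → θ₁ i = 0 := fun i hi => by simp [hθ₁, hm.2 i hi, hh0 i hi]
  have hd₁ : dist θ₁ θ₀ < r := by
    rw [dist_eq_norm, hθ₁, add_sub_cancel_left, norm_smul, norm_inv, Real.norm_eq_abs,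
      abs_of_pos hr0, inv_mul_lt_iff₀ hr0]
    exact hhK.trans_lt hn
  have hθ₁m : θ₁ ∈ modelSet Θ m := ⟨hint θ₁ hθ₁0 hd₁, hθ₁0⟩
  have hsm₁ : Real.sqrt x.1 • (θ₁ - θ₀) = h := by
    rw [hθ₁, add_sub_cancel_left, smul_smul, mul_inv_cancel₀ hr0.ne', one_smul]
  have hq₁ := hquad θ₁ ⟨hθ₁m.1, hsegm θ₁ hθ₁0 hd₁⟩ (by rwa [hsm₁])
  rw [hsm₁] at hq₁
  obtain ⟨hseg, hsn, -⟩ := hclose θ hθ (hmax hm)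
  have hsm : ‖Real.sqrt x.1 • (θ - θ₀)‖ ≤ K' := by
    rw [norm_smul, Real.norm_eq_abs, abs_of_pos hr0]
    refine hsn.trans (le_trans ?_ (le_max_left _ _))
    gcongr
  have hq := hquad θ hseg hsm
  set w := Real.sqrt x.1 • (θ - θ₀) with hw
  have hw0 : ∀ i, i ∉ m → w.ofLp i = 0 := fun i hi => by simp [hw, hm.2 i hi, hθ.2 i hi]
  have hcrit := quadratic_criterion_eq m (transpose_matJ f Y P θ₀)
    (H.isUnit_det_activeBlock hJ hgrad m) Z.ofLp hw0
  have hL : quasiLogLik f Y x.1 θ₁ x.2 ≤ quasiLogLik f Y x.1 θ x.2 := hmax hθ₁m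
  have hjw := hj (w - h)
  have e : (w - h).ofLp = w.ofLp - (gain m J).mulVec Z.ofLp := rfl
  have e' : h.ofLp = (gain m J).mulVec Z.ofLp := rfl
  rw [e] at hjw
  rw [e'] at hq₁
  have h5 : j * ‖w - h‖ ^ 2 ≤ j * ε ^ 2 := by
    linarith [(abs_le.1 hq).2, (abs_le.1 hq₁).1]
  have h6 := le_of_mul_le_mul_left h5 hj0
  exact (sq_le_sq₀ (norm_nonneg _) hε.le).1 h6

/-- The selected model is the true one with probability tending to one. -/
lemma eventually_selection (H : IsCountModel P Y f Θ θ₀ α c C)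
    (hident : Identifiable f Y P Θ)
    (hJ : ∀ i j, Integrable (entryJ f Y θ₀ i j) P)
    (hI : ∀ i j, Integrable (entryI f Y P θ₀ i j) P) (hrate : InitialEffectRate f Y P Θ)
    (hgrad : ∀ c : Param d, (∀ᵐ ω ∂P, inner ℝ c (gradLam f Y 1 θ₀ ω) = 0) → c = 0)
    {M : Finset (Finset (Fin d))} {mstar : Finset (Fin d)} (hmstar : mstar ∈ M)
    (hθ₀ : θ₀ ∈ modelSet Θ mstar)
    (hmin : ∀ m ∈ M, θ₀ ∈ modelSet Θ m → mstar ⊆ m) {r : ℝ} (hr : 0 < r)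
    (hseg : ∀ m ∈ M, mstar ⊆ m → ∀ θ ∈ modelSet Θ m, dist θ θ₀ < r → segment ℝ θ₀ θ ⊆ Θ)
    {κ : ℕ → ℝ} (hκ_top : Tendsto κ atTop atTop) (hκ_o : κ =o[atTop] (fun n : ℕ => (n : ℝ)))
    {θhat : ℕ → Finset (Fin d) → Ω → Param d} {mhat : ℕ → Ω → Finset (Fin d)}
    (hθhat : ∀ᶠ x in whp P, ∀ m ∈ M, θhat x.1 m x.2 ∈ modelSet Θ m ∧
      IsMaxOn (fun θ => quasiLogLik f Y x.1 θ x.2) (modelSet Θ m) (θhat x.1 m x.2))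
    (hmhat : ∀ᶠ x in whp P, mhat x.1 x.2 ∈ M ∧ ∀ m ∈ M,
      criterion f Y κ θhat x.1 (mhat x.1 x.2) x.2 ≤ criterion f Y κ θhat x.1 m x.2) :
    ∀ᶠ x in whp P, mhat x.1 x.2 = mstar := by
  obtain ⟨j, hj0, hj⟩ := exists_le_quadratic fun v hv => H.quadratic_matJ_pos hJ hgrad (v := v) hv
  refine eventually_whp_of_exhaust
    (fun K : ℕ => {x : ℕ × Ω | ‖normScore f Y θ₀ x.1 x.2‖ ≤ K}) (H.exhaust_normScore hI) fun K => ?_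
  have hm : ∀ m ∈ M, ∀ᶠ x in whp P ⊓ 𝓟 {x : ℕ × Ω | ‖normScore f Y θ₀ x.1 x.2‖ ≤ K},
      mhat x.1 x.2 = m → m = mstar := by
    intro m hmM
    by_cases hθm : θ₀ ∈ modelSet Θ m
    -- A correct model that strictly contains the true one: on the event ‖Z_n‖ ≤ K twice its gain in
    -- likelihood is at most 2(K + 1)²/j, whereas its penalty exceeds that of the true model by at
    -- least κ_n → ∞.
    · have hsub := hmin m hmM hθm
      have hclose := H.eventually_close_of_quasiLogLik_le hident hJ hrate hj0 hj
        (S := modelSet Θ m) (fun θ hθ => hθ.1) hr (hseg m hmM hsub)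
      filter_upwards [hclose.filter_mono inf_le_left, hθhat.filter_mono inf_le_left,
        hmhat.filter_mono inf_le_left, (tendsto_fst_whp.eventually
          (hκ_top.eventually_gt_atTop (2 * (((K : ℝ) + 1) ^ 2 / j)))).filter_mono inf_le_left,
        mem_inf_of_right (mem_principal_self _)] with x hclose hθhat hmhat hκ hZ heq
      by_contra hne
      have hZ' : ‖normScore f Y θ₀ x.1 x.2‖ ≤ K := hZ
      have hcard : (mstar.card : ℝ) + 1 ≤ m.card := by
        exact_mod_cast Finset.card_lt_card (hsub.ssubset_of_ne (Ne.symm hne))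
      have hc := hmhat.2 mstar hmstar
      rw [heq] at hc
      have h1 : quasiLogLik f Y x.1 θ₀ x.2 ≤ quasiLogLik f Y x.1 (θhat x.1 m x.2) x.2 :=
        (hθhat m hmM).2 hθm
      have h2 : quasiLogLik f Y x.1 θ₀ x.2 ≤ quasiLogLik f Y x.1 (θhat x.1 mstar x.2) x.2 :=
        (hθhat mstar hmstar).2 hθ₀
      have h3 := (hclose _ (hθhat m hmM).1 h1).2.2
      have h4 : (‖normScore f Y θ₀ x.1 x.2‖ + 1) ^ 2 / j ≤ ((K : ℝ) + 1) ^ 2 / j := by gcongr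
      have hκ0 : 0 ≤ κ x.1 := le_trans (by positivity) hκ.le
      have h5 := mul_le_mul_of_nonneg_left hcard hκ0
      unfold criterion at hc
      linarith
    -- A wrong model: its parameter set is closed and misses θ₀, so it loses at least ρn in
    -- likelihood, while the penalty of the true model is at most dκ_n = o(n).
    · have hclosed : IsClosed {θ : Param d | ∀ i, i ∉ m → θ i = 0} := by
        simp only [Set.ofPred_forall]
        exact isClosed_iInter fun i => isClosed_iInter fun _ =>
          isClosed_eq (by fun_prop) continuous_const
      obtain ⟨ρ, hρ, hwald⟩ := H.eventually_quasiLogLik_le hident hclosed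
        fun h => hθm ⟨H.regular.mem, h⟩
      have hκρ := (hκ_o.def (show 0 < ρ / ((d : ℝ) + 1) by positivity))
      filter_upwards [hwald.filter_mono inf_le_left, hθhat.filter_mono inf_le_left,
        hmhat.filter_mono inf_le_left, (tendsto_fst_whp.eventually hκρ).filter_mono inf_le_left,
        (tendsto_fst_whp.eventually (hκ_top.eventually_ge_atTop 0)).filter_mono inf_le_left,
        (tendsto_fst_whp.eventually (eventually_ge_atTop 1)).filter_mono inf_le_left]
        with x hwald hθhat hmhat hκ hκ0 hn heq
      exfalso
      have hn0 : (0 : ℝ) < x.1 := by exact_mod_cast hn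
      have hc := hmhat.2 mstar hmstar
      rw [heq] at hc
      have h1 := hwald _ ⟨(hθhat m hmM).1.1, (hθhat m hmM).1.2⟩
      have h2 : quasiLogLik f Y x.1 θ₀ x.2 ≤ quasiLogLik f Y x.1 (θhat x.1 mstar x.2) x.2 :=
        (hθhat mstar hmstar).2 hθ₀
      rw [Real.norm_eq_abs, abs_of_nonneg hκ0, Real.norm_eq_abs, abs_of_pos hn0] at hκ
      have hcard : (mstar.card : ℝ) ≤ d := by
        exact_mod_cast (Finset.card_le_univ mstar).trans (Fintype.card_fin d).le
      have h3 : κ x.1 * mstar.card ≤ ρ * x.1 := by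
        calc κ x.1 * mstar.card ≤ ρ / ((d : ℝ) + 1) * x.1 * d := by gcongr
          _ = d / ((d : ℝ) + 1) * (ρ * x.1) := by ring
          _ ≤ 1 * (ρ * x.1) := by
            gcongr
            rw [div_le_one (by positivity)]
            linarith
          _ = _ := one_mul _
      have h4 : 0 ≤ κ x.1 * m.card := by positivity
      have h5 := mul_pos hρ hn0
      unfold criterion at hc
      linarith
  have hall := (eventually_all_finset M).2 hm
  filter_upwards [hall, hmhat.filter_mono inf_le_left] with x h1 h2
  exact h1 _ h2.1 rfl

end IsCountModel

/-- A measurable choice among finitely many measurable functions is almost everywhere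
measurable. -/
lemma aemeasurable_selection {Ω ι E : Type*} [MeasurableSpace Ω] {P : Measure Ω}
    [AddCommMonoid E] [MeasurableSpace E] [MeasurableAdd₂ E] {M : Finset ι} {g : ι → Ω → E}
    {s : Ω → ι} (hg : ∀ m ∈ M, Measurable (g m)) (hs : ∀ m, MeasurableSet {ω | s ω = m})
    (hsM : ∀ᵐ ω ∂P, s ω ∈ M) : AEMeasurable (fun ω => g (s ω) ω) P := by
  refine ⟨fun ω => ∑ m ∈ M, ({ω | s ω = m}).indicator (g m) ω,
    Finset.measurable_sum _ fun m hm => (hg m hm).indicator (hs m), ?_⟩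
  filter_upwards [hsM] with ω hω
  have h0 : ∀ m ∈ M, m ≠ s ω → ({ω' | s ω' = m}).indicator (g m) ω = 0 := fun m _ hm =>
    Set.indicator_of_notMem (show ω ∉ {ω' | s ω' = m} from fun h => hm (Eq.symm h)) _
  rw [Finset.sum_eq_single_of_mem (s ω) hω h0]
  exact (Set.indicator_of_mem (show ω ∈ {ω' | s ω' = s ω} from rfl) _).symm

end CountSeries

/-! ### Asymptotic normality after selection -/

theorem mainTheorem2
    {Ω : Type*} [MeasurableSpace Ω] (P : Measure Ω) [IsProbabilityMeasure P]
    -- the parametric family, the parameter set, the competing models, the true model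
    {d : ℕ} (f : CountSeries.Param d → (ℕ → ℕ) → ℝ) (Θ : Set (CountSeries.Param d))
    (M : Finset (Finset (Fin d))) (mstar : Finset (Fin d)) (θstar : CountSeries.Param d)
    (Y : ℤ → Ω → ℕ) (α : Fin 3 → ℕ → ℝ≥0) (κ : ℕ → ℝ)
    (θhat : ℕ → Finset (Fin d) → Ω → CountSeries.Param d) (mhat : ℕ → Ω → Finset (Fin d))
    (hf_meas : ∀ θ, Measurable (f θ))
    (hΘ : IsCompact Θ)
    -- the true model belongs to the collection, and it is contained in every correct model
    (hmstar : mstar ∈ M) (hθstar : θstar ∈ CountSeries.modelSet Θ mstar)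
    (hmin : ∀ m ∈ M, θstar ∈ CountSeries.modelSet Θ m → mstar ⊆ m)
    -- the observed process
    (hY_erg : CountSeries.IsStationaryErgodic Y P)
    (hY_od : CountSeries.IsODProcess f Y P θstar)
    (hY_mom : CountSeries.HasMoments Y P)
    -- identifiability and lower bound of the conditional mean
    (hident : CountSeries.Identifiable f Y P Θ)
    (hlower : ∃ c : ℝ, 0 < c ∧ ∀ θ ∈ Θ, ∀ y, c ≤ f θ y)
    -- the true parameter is an interior point of the parameter set of the true model
    (hint : ∃ r : ℝ, 0 < r ∧ ∀ θ : CountSeries.Param d,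
      (∀ i, i ∉ mstar → θ i = 0) → dist θ θstar < r → θ ∈ Θ)
    -- in the models that contain the true one, the segments that join the true parameter to
    -- nearby parameters stay in the parameter set
    (hseg : ∃ r : ℝ, 0 < r ∧ ∀ m ∈ M, mstar ⊆ m → ∀ θ ∈ CountSeries.modelSet Θ m,
      dist θ θstar < r → segment ℝ θstar θ ⊆ Θ)
    -- smoothness in the parameter, and the Lipschitz conditions
    (hsmooth : ∀ y, ∀ θ ∈ Θ, ContDiffAt ℝ 2 (fun ϑ => f ϑ y) θ)
    (hα_sum : ∀ i, Summable (fun k => α i (k + 1)))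
    (hα_zero : ∑' k, α 0 (k + 1) < 1)
    (hlip : ∀ i : Fin 3, CountSeries.DerivLipschitz f Θ i (α i))
    -- the effect of the unobserved initial values
    (ha : CountSeries.InitialEffectVanishes f Y P Θ)
    (hrate : CountSeries.InitialEffectRate f Y P Θ)
    -- finiteness of the two matrices, non-degeneracy of the gradient, domination of the Hessian
    (hJ : ∀ i j, Integrable (CountSeries.entryJ f Y θstar i j) P)
    (hI : ∀ i j, Integrable (CountSeries.entryI f Y P θstar i j) P)
    (hgrad : ∀ c : CountSeries.Param d,
      (∀ᵐ ω ∂P, inner ℝ c (CountSeries.gradLam f Y 1 θstar ω) = 0) → c = 0)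
    (hhess : CountSeries.HessianDominated f Y P Θ θstar)
    -- the regularization sequence
    (hκ_mono : MonotoneOn κ (Set.Ici 1))
    (hκ_lt : ∀ n : ℕ, 1 ≤ n → κ n < n)
    (hκ_top : Tendsto κ atTop atTop)
    (hκ_sum : ∀ i, Summable (fun l : ℕ => 1 / κ (l + 1) * ∑' k : ℕ, (α i (l + 1 + k) : ℝ)))
    (hκ_o : κ =o[atTop] (fun n : ℕ => (n : ℝ)))
    -- the estimators in the models, and the selected model
    (hθhat_meas : ∀ n, ∀ m ∈ M, Measurable (θhat n m))
    (hθhat : ∀ n, ∀ m ∈ M, ∀ᵐ ω ∂P, θhat n m ω ∈ CountSeries.modelSet Θ m ∧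
      IsMaxOn (fun θ => CountSeries.quasiLogLik f Y n θ ω) (CountSeries.modelSet Θ m)
        (θhat n m ω))
    (hmhat_meas : ∀ n m, MeasurableSet {ω | mhat n ω = m})
    (hmhat : ∀ n, ∀ᵐ ω ∂P, mhat n ω ∈ M ∧ ∀ m ∈ M,
      CountSeries.criterion f Y κ θhat n (mhat n ω) ω ≤ CountSeries.criterion f Y κ θhat n m ω) :
    -- the inverse exists, the limiting covariance is a covariance matrix, and the estimator in
    -- the selected model is asymptotically normal
    IsUnit (CountSeries.activeBlock mstar (CountSeries.matJ f Y P θstar)).det ∧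
    (CountSeries.sandwich mstar (CountSeries.matJ f Y P θstar)
      (CountSeries.matI f Y P θstar)).PosSemidef ∧
    TendstoInDistribution
      (fun (n : ℕ) (ω : Ω) => Real.sqrt n • (θhat n (mhat n ω) ω - θstar)) atTop
      (id : CountSeries.Param d → CountSeries.Param d) (fun _ => P)
      (multivariateGaussian 0 (CountSeries.sandwich mstar (CountSeries.matJ f Y P θstar)
        (CountSeries.matI f Y P θstar))) := by
  obtain ⟨c, hc, hlow⟩ := hlower
  obtain ⟨C, hreg⟩ := CountSeries.exists_isRegularFamily hf_meas hΘ hθstar.1 hsmooth hlip hc hlow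
  have H : CountSeries.IsCountModel P Y f Θ θstar (fun k => ∑ i, α i k) c C :=
    ⟨hreg, summable_sum fun i _ => hα_sum i, hY_erg, hY_od, hY_mom⟩
  obtain ⟨r, hr, hint⟩ := hint
  obtain ⟨r', hr', hseg⟩ := hseg
  have hθ : ∀ᶠ x in CountSeries.whp P, ∀ m ∈ M,
      θhat x.1 m x.2 ∈ CountSeries.modelSet Θ m ∧
      IsMaxOn (fun θ => CountSeries.quasiLogLik f Y x.1 θ x.2) (CountSeries.modelSet Θ m)
        (θhat x.1 m x.2) :=
    CountSeries.eventually_whp_of_ae <| Eventually.of_forall fun n =>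
      (eventually_all_finset M).2 fun m hm => hθhat n m hm
  have hm : ∀ᶠ x in CountSeries.whp P, mhat x.1 x.2 ∈ M ∧ ∀ m ∈ M,
      CountSeries.criterion f Y κ θhat x.1 (mhat x.1 x.2) x.2
        ≤ CountSeries.criterion f Y κ θhat x.1 m x.2 :=
    CountSeries.eventually_whp_of_ae <| Eventually.of_forall hmhat
  have hsel := H.eventually_selection hident hJ hI hrate hgrad hmstar hθstar hmin hr' hseg
    hκ_top hκ_o hθ hm
  refine ⟨H.isUnit_det_activeBlock hJ hgrad mstar, H.posSemidef_sandwich hI mstar, ?_⟩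
  -- Slutsky's lemma: with probability tending to one the selected model is the true one, where the
  -- rescaled estimator is close to the gain of the normalized score. Working on the events ‖Z_n‖ ≤
  -- K is harmless, as they are exhausting.
  refine tendstoInDistribution_of_tendstoInMeasure_sub _ _ (H.tendstoInDistribution_gainMap hI mstar)
    (CountSeries.tendstoInMeasure_of_whp ?_) fun n => ?_
  · refine CountSeries.tendsto_whp_of_exhaust
      (fun K : ℕ => {x : ℕ × Ω | ‖CountSeries.normScore f Y θstar x.1 x.2‖ ≤ K})
      (H.exhaust_normScore hI) fun K => Metric.tendsto_nhds.2 fun ε hε => ?_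
    filter_upwards [H.eventually_norm_sub_gainMap_le hident hJ hrate hgrad hθstar hr hint K
      (half_pos hε), hθ.filter_mono inf_le_left, hsel.filter_mono inf_le_left] with x h1 h2 h3
    rw [dist_zero_right]
    simp only [Pi.sub_apply, h3]
    exact (h1 _ (h2 mstar hmstar).1 (h2 mstar hmstar).2).trans_lt (half_lt_self hε)
  · exact ((CountSeries.aemeasurable_selection (hθhat_meas n) (hmhat_meas n)
      ((hmhat n).mono fun _ h => h.1)).sub_const θstar).const_smul (Real.sqrt n)
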